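/- Let $k$ be a field of characteristic $0$. **Classical data.** Let $\mathcal A$ be the commutative $k$-algebra generated by $a,b,c,d$ with $ad-bc=1$, and let $\mathcal M$ be the $\mathbb Z_2$-graded $k$-algebra generated by the even elements $a,b,c,d$ and odd elements $\theta^0,\theta^1,\theta^2$, with the relations of $\mathcal A$ and $t\theta^i=\theta^i t$ for $t\in\{a,b,c,d\}$, $\theta^i\theta^j=-\theta^j\theta^i$. Put $T=\begin{pmatrix}a&b\\c&d\end{pmatrix}$. Let $\Delta(T)=T\otimes T$, $\epsilon(T)=1$ on $\mathcal A$, and let $\Delta_L:\mathcal M\to\mathcal A\otimes\mathcal M$, $\Delta_R:\mathcal M\to\mathcal M\otimes\mathcal A$ be the algebra homomorphisms that equal $\Delta$ on $\mathcal A$ and satisfy $\Delta_R\theta^i=\theta^i\otimes 1$ and $$\Delta_L\theta^0=(1+2bc)\otimes\theta^0-ac\otimes\theta^1+bd\otimes\theta^2,$$ $$\Delta_L\theta^1=-2ab\otimes\theta^0+a^2\otimes\theta^1-b^2\otimes\theta^2,\qquad \Delta_L\theta^2=2cd\otimes\theta^0-c^2\otimes\theta^1+d^2\otimes\theta^2.$$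 A graded Poisson bracket on $\mathcal M$ is a bilinear map with $\deg\{x,y\}=\deg x+\deg y$, $\{x,y\}=-(-1)^{\deg x\deg y}\{y,x\}$, $\{xy,z\}=x\{y,z\}+(-1)^{\deg y\deg z}\{x,z\}y$ and the super Jacobi identity $$(-1)^{\deg x\deg z}\{\{x,y\},z\}+(-1)^{\deg y\deg z}\{\{z,x\},y\}+(-1)^{\deg x\deg y}\{\{y,z\},x\}=0$$ for homogeneous $x,y,z$; it is extended to $\mathcal M\otimes\mathcal M$ by $\{x\otimes y,z\otimes w\}=(-1)^{\deg y\deg z}(\{x,z\}\otimes yw+xz\otimes\{y,w\})$. It is graded Poisson–Lie if it maps $\mathcal A\times\mathcal A$ to $\mathcal A$ with $\Delta\{f,g\}=\{\Delta f,\Delta g\}$ on $\mathcal A$ and $\Delta_{L,R}\{x,y\}=\{\Delta_{L,R}x,\Delta_{L,R}y\}$ on $\mathcal M$. The brackets of type I and of type II are the graded Poisson brackets with $$\{a,b\}=-ab,\ \{a,c\}=-ac,\ \{b,d\}=-bd,\ \{c,d\}=-cd,\ \{c,b\}=0,\ \{a,d\}=-2bc,$$ $$\{\theta^0,\theta^0\}=-2\theta^1\theta^2,\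 \{\theta^0,\theta^1\}=-2\theta^0\theta^1,\ \{\theta^0,\theta^2\}=2\theta^0\theta^2,\ \{\theta^1,\theta^1\}=\{\theta^1,\theta^2\}=\{\theta^2,\theta^2\}=0$$ and, for $(x,y)\in\{(a,c),(b,d)\}$, * type I: $\{\theta^0,x\}=-2y\theta^1$, $\{\theta^1,x\}=x\theta^1$, $\{\theta^2,x\}=4y\theta^0-x\theta^2$, $\{\theta^0,y\}=0$, $\{\theta^1,y\}=-y\theta^1$, $\{\theta^2,y\}=y\theta^2$; * type II: $\{\theta^0,x\}=0$, $\{\theta^1,x\}=-x\theta^1$, $\{\theta^2,x\}=x\theta^2$, $\{\theta^0,y\}=-2x\theta^2$, $\{\theta^1,y\}=4x\theta^0+y\theta^1$, $\{\theta^2,y\}=-y\theta^2$. **Quantum data.** In $k[[h]]$ let $q=e^{-h}$, $\mu=q-q^{-1}$, $\lambda=q+q^{-1}$. Let $\mathcal A_q$ be the $k[[h]]$-algebra generated by $a,b,c,d$ with $$ab=qba,\quad ac=qca,\quad ad-da=\mu bc,\quad bc=cb,\quad cd=qdc,\quad bd=qdb \qquad(1)$$ and $\det_qT:=ad-qbc=1$.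 Let $\widetilde{\mathcal M}_q$ be the $k[[h]]$-algebra generated by $a,b,c,d,\theta^0,\theta^1,\theta^2$ with the relations (1), the relations $$(\theta^0)^2=\tfrac{q^2\mu}{\lambda}\theta^1\theta^2,\ (\theta^1)^2=(\theta^2)^2=0,\ \theta^1\theta^2=-\theta^2\theta^1,\ \theta^1\theta^0=-q^{-2}\theta^0\theta^1,\ \theta^2\theta^0=-q^2\theta^0\theta^2$$ and, for $(x,y)\in\{(a,c),(b,d)\}$, either * (I) $\theta^0x=x\theta^0+q^2\mu y\theta^1$, $\theta^1x=q^{-1}x\theta^1$, $\theta^2x=qx\theta^2-\mu\lambda y\theta^0$, $\theta^0y=y\theta^0$, $\theta^1y=qy\theta^1$, $\theta^2y=q^{-1}y\theta^2$, or * (II) $\theta^0x=x\theta^0$, $\theta^1x=qx\theta^1$, $\theta^2x=q^{-1}x\theta^2$, $\theta^0y=y\theta^0+\mu x\theta^2$, $\theta^1y=q^{-1}y\theta^1-q^{-2}\mu\lambda x\theta^0$, $\theta^2y=qy\theta^2$, and let $\mathcal M_q$ be its quotient by $\det_qT=1$, graded by $\deg t=0$ for $t\in\{a,b,c,d\}$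 and $\deg\theta^i=1$. **Theorem.** For each of the types I, II: 1. The bracket on $\mathcal M$ of that type exists and is unique, and it is graded Poisson–Lie. 2. There are algebra homomorphisms $\Delta:\mathcal A_q\to\mathcal A_q\otimes\mathcal A_q$, $\epsilon:\mathcal A_q\to k[[h]]$ with $\Delta(T)=T\otimes T$, $\epsilon(T)=1$, and $\Delta_L(q):\mathcal M_q\to\mathcal A_q\otimes\mathcal M_q$, $\Delta_R(q):\mathcal M_q\to\mathcal M_q\otimes\mathcal A_q$, equal to $\Delta$ on $\mathcal A_q$, with $\Delta_R(q)\theta^i=\theta^i\otimes1$ and $$\Delta_L(q)\theta^0=(ad+q^{-1}bc)\otimes\theta^0-q\,ac\otimes\theta^1+bd\otimes\theta^2,$$ $$\Delta_L(q)\theta^1=-\tfrac{\lambda}{q}ba\otimes\theta^0+a^2\otimes\theta^1-\tfrac1q b^2\otimes\theta^2,\qquad \Delta_L(q)\theta^2=\lambda\,dc\otimes\theta^0-q\,c^2\otimes\theta^1+d^2\otimes\theta^2;$$ $(\Delta,\epsilon)$ is a bialgebra structure on $\mathcal A_q$ and $\Delta_L(q),\Delta_R(q)$ make $\mathcal M_q$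 an $\mathcal A_q$-bicomodule. The same holds for the classical $\Delta,\epsilon,\Delta_L,\Delta_R$. 3. With these comultiplications $\mathcal M_q$ is a quantization of $\mathcal M$ with the bracket of that type: $\mathcal M_q$ is a free $k[[h]]$-module; sending generators to generators and $h$ to $0$ induces algebra isomorphisms $\mathcal A_q/h\mathcal A_q\cong\mathcal A$ and $\mathcal M_q/h\mathcal M_q\cong\mathcal M$ which carry $\Delta,\epsilon,\Delta_L(q),\Delta_R(q)$ to $\Delta,\epsilon,\Delta_L,\Delta_R$; and for homogeneous $\hat x,\hat y\in\mathcal M_q$ with images $x,y\in\mathcal M$ the graded commutator $[\hat x,\hat y]=\hat x\hat y-(-1)^{\deg\hat x\deg\hat y}\hat y\hat x$ lies in $h\mathcal M_q$ and $\frac1h[\hat x,\hat y]$ has image $\{x,y\}$. 4. The quantum determinant $\det_qT$ is central in $\widetilde{\mathcal M}_q$ and in $\mathcal M_q$. -/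

import Mathlib

open scoped TensorProduct PowerSeries

noncomputable section

namespace SLForms

/-! ### Generators -/

/-- The entries of the matrix `T = (a b; c d)`. -/
inductive TGen
  | a | b | c | d

/-- The even generators `a, b, c, d` and the odd generators `θ⁰, θ¹, θ²`. -/
inductive Gen
  | t (x : TGen)
  | θ (i : Fin 3)

/-- The `ℤ/2`-degree of a generator. -/
def Gen.deg : Gen → ZMod 2
  | .t _ => 0
  | .θ _ => 1

/-- The Koszul sign `(-1)^(p r)`. -/
def koszul (p r : ZMod 2) : ℤ := if p = 1 ∧ r = 1 then -1 else 1

/-- The component of degree `p` in an algebra generated by elements `g s` of degree `s.deg`: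
the span of all words whose total degree is `p`. -/
def parityPart (R : Type*) {B : Type*} [CommRing R] [Ring B] [Algebra R B] (g : Gen → B)
    (p : ZMod 2) : Submodule R B :=
  Submodule.span R {x | ∃ w : List Gen, (w.map Gen.deg).sum = p ∧ x = (w.map g).prod}

/-- The two types of commutation relations (and of brackets) between the `θ`'s and `a, b, c, d`. -/
inductive Kind
  | I | II

/-! ### The classical algebras -/

section Classical

variable (k : Type*) [Field k]

/-- Commutativity of the matrix entries and `ad - bc = 1`. -/
inductive ARel {B : Type*} [Ring B] (t : TGen → B) : B → B → Prop
  | comm (x y : TGen) : ARel t (t x * t y) (t y * t x)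
  | det : ARel t (t .a * t .d - t .b * t .c) 1

/-- The relations of the external algebra of `SL(2)`. -/
inductive MRel {B : Type*} [Ring B] (t : TGen → B) (θ : Fin 3 → B) : B → B → Prop
  | base {x y : B} : ARel t x y → MRel t θ x y
  | tθ (x : TGen) (i : Fin 3) : MRel t θ (t x * θ i) (θ i * t x)
  | θθ (i j : Fin 3) : MRel t θ (θ i * θ j) (-(θ j * θ i))

/-- The function algebra of `SL(2)` over `k`. -/
def A := RingQuot (ARel (FreeAlgebra.ι k : TGen → FreeAlgebra k TGen))

instance : Ring (A k) := inferInstanceAs (Ring (RingQuot _))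

instance : Algebra k (A k) := inferInstanceAs (Algebra k (RingQuot _))

/-- The external algebra of `SL(2)` over `k`. -/
def M := RingQuot (MRel (fun x => FreeAlgebra.ι k (Gen.t x)) (fun i => FreeAlgebra.ι k (Gen.θ i)))

instance : Ring (M k) := inferInstanceAs (Ring (RingQuot _))

instance : Algebra k (M k) := inferInstanceAs (Algebra k (RingQuot _))

/-- The quotient map onto `A`. -/
def mkA : FreeAlgebra k TGen →ₐ[k] A k := RingQuot.mkAlgHom k _

/-- The quotient map onto `M`. -/
def mkM : FreeAlgebra k Gen →ₐ[k] M k := RingQuot.mkAlgHom k _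

/-- The matrix entries in `A`. -/
def tA (x : TGen) : A k := mkA k (FreeAlgebra.ι k x)

/-- The generators of `M`. -/
def gM (s : Gen) : M k := mkM k (FreeAlgebra.ι k s)

/-- The matrix entries in `M`. -/
def tM (x : TGen) : M k := gM k (.t x)

/-- The right-invariant one-forms in `M`. -/
def θM (i : Fin 3) : M k := gM k (.θ i)

theorem ARel.map {B B' : Type*} [Ring B] [Ring B'] [Algebra k B] [Algebra k B'] (f : B →ₐ[k] B')
    {t : TGen → B} {x y : B} (h : ARel t x y) : ARel (fun s => f (t s)) (f x) (f y) := by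
  cases h with
  | comm x y => simpa using ARel.comm (t := fun s => f (t s)) x y
  | det => simpa using ARel.det (t := fun s => f (t s))

/-- The canonical homomorphism `A → M`. -/
def inclA : A k →ₐ[k] M k :=
  RingQuot.liftAlgHom k ⟨FreeAlgebra.lift k (tM k), fun x y h => by
    have h0 := h.map k (FreeAlgebra.lift k fun s => FreeAlgebra.ι k (Gen.t s))
    simp only [FreeAlgebra.lift_ι_apply] at h0
    have h1 : mkM k _ = mkM k _ :=
      RingQuot.mkAlgHom_rel k (MRel.base (θ := fun i => FreeAlgebra.ι k (Gen.θ i)) h0)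
    have h2 : FreeAlgebra.lift k (tM k) =
        (mkM k).comp (FreeAlgebra.lift k fun s => FreeAlgebra.ι k (Gen.t s)) := by
      ext s; simp [tM, gM]
    rw [h2]; exact h1⟩

end Classical

/-! ### The quantum algebras -/

section Quantum

variable (k : Type*) [Field k] [CharZero k]

/-- The deformation parameter `q = exp(-h)` in `k[[h]]`. -/
def q : k⟦X⟧ := PowerSeries.evalNegHom (PowerSeries.exp k)

/-- `μ = q - 1/q`. -/
def mu : k⟦X⟧ := q k - (q k)⁻¹

/-- `λ = q + 1/q` (its constant term is `2`). -/
def lam : k⟦X⟧ := q k + (q k)⁻¹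

section Relations

variable {B : Type*} [Ring B] [Algebra k⟦X⟧ B] (t : TGen → B) (θ : Fin 3 → B)

/-- The quantum determinant `ad - q bc`. -/
def detq : B := t .a * t .d - q k • (t .b * t .c)

/-- The defining relations of the quantum matrix algebra. -/
inductive GLqRel : B → B → Prop
  | ab : GLqRel (t .a * t .b) (q k • (t .b * t .a))
  | ac : GLqRel (t .a * t .c) (q k • (t .c * t .a))
  | ad : GLqRel (t .a * t .d - t .d * t .a) (mu k • (t .b * t .c))
  | bc : GLqRel (t .b * t .c) (t .c * t .b)
  | cd : GLqRel (t .c * t .d) (q k • (t .d * t .c))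
  | bd : GLqRel (t .b * t .d) (q k • (t .d * t .b))

/-- The relations of the function algebra of `SL_q(2)`. -/
inductive SLqRel : B → B → Prop
  | base {x y : B} : GLqRel k t x y → SLqRel x y
  | det : SLqRel (detq k t) 1

/-- The right-hand side of the relation `θⁱ x = …` for a matrix entry `x`; for a given `x` the three
entries are those for `i = 0, 1, 2`. -/
def crossRhs : Kind → TGen → Fin 3 → B
  | .I, .a => ![t .a * θ 0 + (q k ^ 2 * mu k) • (t .c * θ 1),
                (q k)⁻¹ • (t .a * θ 1),
                q k • (t .a * θ 2) - (mu k * lam k) • (t .c * θ 0)]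
  | .I, .b => ![t .b * θ 0 + (q k ^ 2 * mu k) • (t .d * θ 1),
                (q k)⁻¹ • (t .b * θ 1),
                q k • (t .b * θ 2) - (mu k * lam k) • (t .d * θ 0)]
  | .I, .c => ![t .c * θ 0, q k • (t .c * θ 1), (q k)⁻¹ • (t .c * θ 2)]
  | .I, .d => ![t .d * θ 0, q k • (t .d * θ 1), (q k)⁻¹ • (t .d * θ 2)]
  | .II, .a => ![t .a * θ 0, q k • (t .a * θ 1), (q k)⁻¹ • (t .a * θ 2)]
  | .II, .b => ![t .b * θ 0, q k • (t .b * θ 1), (q k)⁻¹ • (t .b * θ 2)]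
  | .II, .c => ![t .c * θ 0 + mu k • (t .a * θ 2),
                 (q k)⁻¹ • (t .c * θ 1) - (mu k * lam k * (q k ^ 2)⁻¹) • (t .a * θ 0),
                 q k • (t .c * θ 2)]
  | .II, .d => ![t .d * θ 0 + mu k • (t .b * θ 2),
                 (q k)⁻¹ • (t .d * θ 1) - (mu k * lam k * (q k ^ 2)⁻¹) • (t .b * θ 0),
                 q k • (t .d * θ 2)]

/-- The quadratic relations among the `θ`'s. -/
inductive ThetaRel : B → B → Prop
  | sq0 : ThetaRel (θ 0 ^ 2) ((q k ^ 2 * mu k * (lam k)⁻¹) • (θ 1 * θ 2))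
  | sq1 : ThetaRel (θ 1 ^ 2) 0
  | sq2 : ThetaRel (θ 2 ^ 2) 0
  | r12 : ThetaRel (θ 1 * θ 2) (-(θ 2 * θ 1))
  | r10 : ThetaRel (θ 1 * θ 0) (-((q k ^ 2)⁻¹ • (θ 0 * θ 1)))
  | r20 : ThetaRel (θ 2 * θ 0) (-(q k ^ 2 • (θ 0 * θ 2)))

/-- All relations except `det_q = 1`. -/
inductive GLFormsRel (τ : Kind) : B → B → Prop
  | tt {x y : B} : GLqRel k t x y → GLFormsRel τ x y
  | cross (i : Fin 3) (x : TGen) : GLFormsRel τ (θ i * t x) (crossRhs k t θ τ x i)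
  | θθ {x y : B} : ThetaRel k θ x y → GLFormsRel τ x y

/-- All relations. -/
inductive SLFormsRel (τ : Kind) : B → B → Prop
  | base {x y : B} : GLFormsRel k t θ τ x y → SLFormsRel τ x y
  | det : SLFormsRel τ (detq k t) 1

end Relations

/-- The function algebra of `SL_q(2)`, over `k[[h]]`. -/
def Aq := RingQuot (SLqRel k (FreeAlgebra.ι k⟦X⟧ : TGen → FreeAlgebra k⟦X⟧ TGen))

/-- The algebra generated by `SL_q(2)` and the `θ`'s, with cross relations of type `τ`. -/
def Mq (τ : Kind) := RingQuot (SLFormsRel k (fun x => FreeAlgebra.ι k⟦X⟧ (Gen.t x))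
  (fun i => FreeAlgebra.ι k⟦X⟧ (Gen.θ i)) τ)

/-- The same algebra before the quantum determinant is set equal to `1`. -/
def MqGL (τ : Kind) := RingQuot (GLFormsRel k (fun x => FreeAlgebra.ι k⟦X⟧ (Gen.t x))
  (fun i => FreeAlgebra.ι k⟦X⟧ (Gen.θ i)) τ)

instance : Ring (Aq k) := inferInstanceAs (Ring (RingQuot _))

instance : Algebra k⟦X⟧ (Aq k) := inferInstanceAs (Algebra k⟦X⟧ (RingQuot _))

instance (τ : Kind) : Ring (Mq k τ) := inferInstanceAs (Ring (RingQuot _))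

instance (τ : Kind) : Algebra k⟦X⟧ (Mq k τ) := inferInstanceAs (Algebra k⟦X⟧ (RingQuot _))

instance (τ : Kind) : Ring (MqGL k τ) := inferInstanceAs (Ring (RingQuot _))

instance (τ : Kind) : Algebra k⟦X⟧ (MqGL k τ) := inferInstanceAs (Algebra k⟦X⟧ (RingQuot _))

/-- The quotient map onto `Aq`. -/
def mkAq : FreeAlgebra k⟦X⟧ TGen →ₐ[k⟦X⟧] Aq k := RingQuot.mkAlgHom k⟦X⟧ _

/-- The quotient map onto `Mq`. -/
def mkMq (τ : Kind) : FreeAlgebra k⟦X⟧ Gen →ₐ[k⟦X⟧] Mq k τ := RingQuot.mkAlgHom k⟦X⟧ _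

/-- The quotient map onto `MqGL`. -/
def mkMqGL (τ : Kind) : FreeAlgebra k⟦X⟧ Gen →ₐ[k⟦X⟧] MqGL k τ := RingQuot.mkAlgHom k⟦X⟧ _

/-- The matrix entries in `Aq`. -/
def tAq (x : TGen) : Aq k := mkAq k (FreeAlgebra.ι k⟦X⟧ x)

/-- The generators of `Mq`. -/
def gMq (τ : Kind) (s : Gen) : Mq k τ := mkMq k τ (FreeAlgebra.ι k⟦X⟧ s)

/-- The matrix entries in `Mq`. -/
def tMq (τ : Kind) (x : TGen) : Mq k τ := gMq k τ (.t x)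

/-- The one-forms `θ⁰, θ¹, θ²` in `Mq`. -/
def θMq (τ : Kind) (i : Fin 3) : Mq k τ := gMq k τ (.θ i)

/-- The matrix entries in `MqGL`. -/
def tMqGL (τ : Kind) (x : TGen) : MqGL k τ :=
  mkMqGL k τ (FreeAlgebra.ι k⟦X⟧ (Gen.t x))

theorem SLqRel.map {B B' : Type*} [Ring B] [Ring B'] [Algebra k⟦X⟧ B] [Algebra k⟦X⟧ B']
    (f : B →ₐ[k⟦X⟧] B') {t : TGen → B} {x y : B} (h : SLqRel k t x y) :
    SLqRel k (fun s => f (t s)) (f x) (f y) := by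
  cases h with
  | base h =>
    refine .base ?_
    cases h <;> simp only [map_mul, map_sub, map_smul]
    · exact .ab
    · exact .ac
    · exact .ad
    · exact .bc
    · exact .cd
    · exact .bd
  | det => simpa [detq] using SLqRel.det (k := k) (t := fun s => f (t s))

theorem SLqRel.toForms {B : Type*} [Ring B] [Algebra k⟦X⟧ B] {t : TGen → B} (θ : Fin 3 → B)
    (τ : Kind) {x y : B} (h : SLqRel k t x y) : SLFormsRel k t θ τ x y := by
  cases h with
  | base h => exact .base (.tt h)
  | det => exact .det

/-- The canonical homomorphism `Aq → Mq`. -/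
def inclAq (τ : Kind) : Aq k →ₐ[k⟦X⟧] Mq k τ :=
  RingQuot.liftAlgHom k⟦X⟧ ⟨FreeAlgebra.lift k⟦X⟧ (tMq k τ), fun x y h => by
    have h0 := (h.map k (FreeAlgebra.lift k⟦X⟧ fun s => FreeAlgebra.ι k⟦X⟧ (Gen.t s)))
    simp only [FreeAlgebra.lift_ι_apply] at h0
    have h1 : mkMq k τ _ = mkMq k τ _ := RingQuot.mkAlgHom_rel k⟦X⟧
      (h0.toForms k (fun i => FreeAlgebra.ι k⟦X⟧ (Gen.θ i)) τ)
    have h2 : FreeAlgebra.lift k⟦X⟧ (tMq k τ) = (mkMq k τ).comp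
        (FreeAlgebra.lift k⟦X⟧ fun s => FreeAlgebra.ι k⟦X⟧ (Gen.t s)) := by
      ext s; simp [tMq, gMq]
    rw [h2]; exact h1⟩

end Quantum

/-! ### Comultiplications -/

/-- A bialgebra structure `(Δ, ε)` on `A` together with comultiplications
`ΔL : M → A ⊗ M`, `ΔR : M → M ⊗ A`, all of them algebra homomorphisms, which prolong `Δ` along
`incl : A → M` and make `M` an `A`-bicomodule. (As `A` is purely even, `A ⊗ M` and `M ⊗ A` carry the
ordinary tensor product multiplication: all Koszul signs are trivial there.) -/
structure Comultiplications (R A M : Type*) [CommRing R] [Ring A] [Algebra R A] [Ring M]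
    [Algebra R M] (incl : A →ₐ[R] M) where
  Δ : A →ₐ[R] A ⊗[R] A
  ε : A →ₐ[R] R
  ΔL : M →ₐ[R] A ⊗[R] M
  ΔR : M →ₐ[R] M ⊗[R] A
  coassoc : ∀ x : A, TensorProduct.assoc R A A A (Δ.toLinearMap.rTensor A (Δ x)) =
    Δ.toLinearMap.lTensor A (Δ x)
  counit_left : ∀ x : A, TensorProduct.lid R A (ε.toLinearMap.rTensor A (Δ x)) = x
  counit_right : ∀ x : A, TensorProduct.rid R A (ε.toLinearMap.lTensor A (Δ x)) = x
  ΔL_incl : ∀ x : A, ΔL (incl x) = incl.toLinearMap.lTensor A (Δ x)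
  ΔR_incl : ∀ x : A, ΔR (incl x) = incl.toLinearMap.rTensor A (Δ x)
  ΔL_coassoc : ∀ x : M, TensorProduct.assoc R A A M (Δ.toLinearMap.rTensor M (ΔL x)) =
    ΔL.toLinearMap.lTensor A (ΔL x)
  ΔR_coassoc : ∀ x : M, TensorProduct.assoc R M A A (ΔR.toLinearMap.rTensor A (ΔR x)) =
    Δ.toLinearMap.lTensor M (ΔR x)
  ΔL_counit : ∀ x : M, TensorProduct.lid R M (ε.toLinearMap.rTensor M (ΔL x)) = x
  ΔR_counit : ∀ x : M, TensorProduct.rid R M (ε.toLinearMap.lTensor M (ΔR x)) = x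
  ΔL_ΔR : ∀ x : M, TensorProduct.assoc R A M A (ΔL.toLinearMap.rTensor A (ΔR x)) =
    ΔR.toLinearMap.lTensor A (ΔL x)

/-- `Δ(T) = T ⊗ T` and `ε(T) = 1`. -/
structure IsMatrixCoproduct {R A : Type*} [CommRing R] [Ring A] [Algebra R A] (t : TGen → A)
    (Δ : A →ₐ[R] A ⊗[R] A) (ε : A →ₐ[R] R) : Prop where
  Δa : Δ (t .a) = t .a ⊗ₜ t .a + t .b ⊗ₜ t .c
  Δb : Δ (t .b) = t .a ⊗ₜ t .b + t .b ⊗ₜ t .d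
  Δc : Δ (t .c) = t .c ⊗ₜ t .a + t .d ⊗ₜ t .c
  Δd : Δ (t .d) = t .c ⊗ₜ t .b + t .d ⊗ₜ t .d
  εa : ε (t .a) = 1
  εb : ε (t .b) = 0
  εc : ε (t .c) = 0
  εd : ε (t .d) = 1

section

variable {k : Type*} [Field k]

/-- The values of the classical comultiplications on the generators. -/
structure IsClassical (C : Comultiplications k (A k) (M k) (inclA k)) : Prop where
  matrix : IsMatrixCoproduct (tA k) C.Δ C.ε
  right : ∀ i, C.ΔR (θM k i) = θM k i ⊗ₜ 1
  left0 : C.ΔL (θM k 0) = (1 + (2 : k) • (tA k .b * tA k .c)) ⊗ₜ θM k 0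
    - (tA k .a * tA k .c) ⊗ₜ θM k 1 + (tA k .b * tA k .d) ⊗ₜ θM k 2
  left1 : C.ΔL (θM k 1) = -(((2 : k) • (tA k .a * tA k .b)) ⊗ₜ θM k 0)
    + (tA k .a ^ 2) ⊗ₜ θM k 1 - (tA k .b ^ 2) ⊗ₜ θM k 2
  left2 : C.ΔL (θM k 2) = ((2 : k) • (tA k .c * tA k .d)) ⊗ₜ θM k 0
    - (tA k .c ^ 2) ⊗ₜ θM k 1 + (tA k .d ^ 2) ⊗ₜ θM k 2

/-- The values of the quantum comultiplications on the generators. -/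
structure IsQuantum [CharZero k] {τ : Kind}
    (Q : Comultiplications k⟦X⟧ (Aq k) (Mq k τ) (inclAq k τ)) : Prop where
  matrix : IsMatrixCoproduct (tAq k) Q.Δ Q.ε
  right : ∀ i, Q.ΔR (θMq k τ i) = θMq k τ i ⊗ₜ 1
  left0 : Q.ΔL (θMq k τ 0) =
    (tAq k .a * tAq k .d + (q k)⁻¹ • (tAq k .b * tAq k .c)) ⊗ₜ θMq k τ 0
    - (q k • (tAq k .a * tAq k .c)) ⊗ₜ θMq k τ 1 + (tAq k .b * tAq k .d) ⊗ₜ θMq k τ 2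
  left1 : Q.ΔL (θMq k τ 1) =
    -(((lam k * (q k)⁻¹) • (tAq k .b * tAq k .a)) ⊗ₜ θMq k τ 0)
    + (tAq k .a ^ 2) ⊗ₜ θMq k τ 1 - ((q k)⁻¹ • tAq k .b ^ 2) ⊗ₜ θMq k τ 2
  left2 : Q.ΔL (θMq k τ 2) = (lam k • (tAq k .d * tAq k .c)) ⊗ₜ θMq k τ 0
    - (q k • tAq k .c ^ 2) ⊗ₜ θMq k τ 1 + (tAq k .d ^ 2) ⊗ₜ θMq k τ 2

/-! ### Graded Poisson–Lie structures on `M` -/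

/-- A graded Poisson bracket on `M`. -/
structure IsGradedPoisson (br : M k →ₗ[k] M k →ₗ[k] M k) : Prop where
  degree : ∀ p r, ∀ x ∈ parityPart k (gM k) p, ∀ y ∈ parityPart k (gM k) r,
    br x y ∈ parityPart k (gM k) (p + r)
  symm : ∀ p r, ∀ x ∈ parityPart k (gM k) p, ∀ y ∈ parityPart k (gM k) r,
    br x y = -(koszul p r • br y x)
  leibniz : ∀ r s, ∀ x : M k, ∀ y ∈ parityPart k (gM k) r, ∀ z ∈ parityPart k (gM k) s,
    br (x * y) z = x * br y z + koszul r s • (br x z * y)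
  jacobi : ∀ p r s, ∀ x ∈ parityPart k (gM k) p, ∀ y ∈ parityPart k (gM k) r,
    ∀ z ∈ parityPart k (gM k) s,
    koszul p s • br (br x y) z + koszul r s • br (br z x) y + koszul p r • br (br y z) x = 0

/-- `B` is the extension of the bracket `br` to `M ⊗ M`. -/
def IsTensorBracket (br : M k →ₗ[k] M k →ₗ[k] M k)
    (B : M k ⊗[k] M k →ₗ[k] M k ⊗[k] M k →ₗ[k] M k ⊗[k] M k) : Prop :=
  ∀ p r, ∀ x : M k, ∀ y ∈ parityPart k (gM k) p, ∀ z ∈ parityPart k (gM k) r, ∀ w : M k,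
    B (x ⊗ₜ y) (z ⊗ₜ w) = koszul p r • (br x z ⊗ₜ (y * w) + (x * z) ⊗ₜ br y w)

/-- A graded Poisson–Lie structure: a graded Poisson bracket which restricts to a bracket on `A`
compatible with `Δ`, and which is covariant under `ΔL` and `ΔR`. Here `A ⊗ A`, `A ⊗ M` and `M ⊗ A`
are mapped to `M ⊗ M` through `A → M`. -/
structure IsGradedPoissonLie (C : Comultiplications k (A k) (M k) (inclA k))
    (br : M k →ₗ[k] M k →ₗ[k] M k) : Prop where
  poisson : IsGradedPoisson br
  covariant : ∃ B, IsTensorBracket br B ∧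
    (∀ f g : A k, ∃ e : A k, inclA k e = br (inclA k f) (inclA k g) ∧
      TensorProduct.map (inclA k).toLinearMap (inclA k).toLinearMap (C.Δ e) =
        B (TensorProduct.map (inclA k).toLinearMap (inclA k).toLinearMap (C.Δ f))
          (TensorProduct.map (inclA k).toLinearMap (inclA k).toLinearMap (C.Δ g))) ∧
    (∀ x y : M k, (inclA k).toLinearMap.rTensor (M k) (C.ΔL (br x y)) =
      B ((inclA k).toLinearMap.rTensor (M k) (C.ΔL x))
        ((inclA k).toLinearMap.rTensor (M k) (C.ΔL y))) ∧
    (∀ x y : M k, (inclA k).toLinearMap.lTensor (M k) (C.ΔR (br x y)) =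
      B ((inclA k).toLinearMap.lTensor (M k) (C.ΔR x))
        ((inclA k).toLinearMap.lTensor (M k) (C.ΔR y)))

/-- The brackets `{θⁱ, x}` of type I and II with a matrix entry `x`; for a given `x` the three entries
are those for `i = 0, 1, 2`. -/
def crossBracket (k : Type*) [Field k] : Kind → TGen → Fin 3 → M k
  | .I, .a => ![-((2 : k) • (tM k .c * θM k 1)), tM k .a * θM k 1,
                (4 : k) • (tM k .c * θM k 0) - tM k .a * θM k 2]
  | .I, .b => ![-((2 : k) • (tM k .d * θM k 1)), tM k .b * θM k 1,
                (4 : k) • (tM k .d * θM k 0) - tM k .b * θM k 2]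
  | .I, .c => ![0, -(tM k .c * θM k 1), tM k .c * θM k 2]
  | .I, .d => ![0, -(tM k .d * θM k 1), tM k .d * θM k 2]
  | .II, .a => ![0, -(tM k .a * θM k 1), tM k .a * θM k 2]
  | .II, .b => ![0, -(tM k .b * θM k 1), tM k .b * θM k 2]
  | .II, .c => ![-((2 : k) • (tM k .a * θM k 2)),
                 (4 : k) • (tM k .a * θM k 0) + tM k .c * θM k 1, -(tM k .c * θM k 2)]
  | .II, .d => ![-((2 : k) • (tM k .b * θM k 2)),
                 (4 : k) • (tM k .b * θM k 0) + tM k .d * θM k 1, -(tM k .d * θM k 2)]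

/-- The values of the bracket of type `τ` on the generators: the Sklyanin bracket, the brackets
`{θⁱ, x}` and the brackets `{θⁱ, θʲ}`. -/
structure HasBracketValues (τ : Kind) (br : M k →ₗ[k] M k →ₗ[k] M k) : Prop where
  ab : br (tM k .a) (tM k .b) = -(tM k .a * tM k .b)
  ac : br (tM k .a) (tM k .c) = -(tM k .a * tM k .c)
  bd : br (tM k .b) (tM k .d) = -(tM k .b * tM k .d)
  cd : br (tM k .c) (tM k .d) = -(tM k .c * tM k .d)
  cb : br (tM k .c) (tM k .b) = 0
  ad : br (tM k .a) (tM k .d) = -((2 : k) • (tM k .b * tM k .c))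
  cross : ∀ i x, br (θM k i) (tM k x) = crossBracket k τ x i
  θ00 : br (θM k 0) (θM k 0) = -((2 : k) • (θM k 1 * θM k 2))
  θ01 : br (θM k 0) (θM k 1) = -((2 : k) • (θM k 0 * θM k 1))
  θ02 : br (θM k 0) (θM k 2) = (2 : k) • (θM k 0 * θM k 2)
  θ11 : br (θM k 1) (θM k 1) = 0
  θ12 : br (θM k 1) (θM k 2) = 0
  θ22 : br (θM k 2) (θM k 2) = 0

/-! ### Quantization -/

/-- A `k`-algebra `B` is the reduction modulo `h` of a `k[[h]]`-algebra `Bh`: `π` is a surjective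
ring homomorphism, semilinear over `h ↦ 0`, with kernel `h Bh`, so that it induces
`Bh / h Bh ≅ B`. -/
structure IsReduction {Bh B : Type*} [Ring Bh] [Algebra k⟦X⟧ Bh] [Ring B] [Algebra k B]
    (π : Bh →ₛₗ[(PowerSeries.constantCoeff : k⟦X⟧ →+* k)] B) : Prop where
  map_one : π 1 = 1
  map_mul : ∀ x y, π (x * y) = π x * π y
  surjective : Function.Surjective π
  ker : ∀ x, π x = 0 ↔ ∃ y, x = (PowerSeries.X : k⟦X⟧) • y

/-- `Mq` with the comultiplications `Q` is a quantization of `M` with the comultiplications `C` and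
the bracket `br`:
* `Mq` is a free `k[[h]]`-module;
* `Mq / h Mq ≅ M` (and `Aq / h Aq ≅ A`) as algebras, generators corresponding to generators, and
  the comultiplications of `Q` reduce to those of `C`;
* for homogeneous `x, y` in `Mq` the graded commutator `[x, y]` is divisible by `h`, and
  `[x, y] / h` reduces modulo `h` to the bracket of the reductions of `x` and `y`. -/
structure IsQuantization [CharZero k] {τ : Kind}
    (C : Comultiplications k (A k) (M k) (inclA k)) (br : M k →ₗ[k] M k →ₗ[k] M k)
    (Q : Comultiplications k⟦X⟧ (Aq k) (Mq k τ) (inclAq k τ)) : Prop where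
  free : Module.Free k⟦X⟧ (Mq k τ)
  limit : ∃ (πA : Aq k →ₛₗ[(PowerSeries.constantCoeff : k⟦X⟧ →+* k)] A k)
      (π : Mq k τ →ₛₗ[(PowerSeries.constantCoeff : k⟦X⟧ →+* k)] M k),
    IsReduction πA ∧ IsReduction π ∧
    (∀ x, πA (tAq k x) = tA k x) ∧ (∀ s, π (gMq k τ s) = gM k s) ∧
    (∀ x, TensorProduct.map πA πA (Q.Δ x) = C.Δ (πA x)) ∧
    (∀ x, PowerSeries.constantCoeff (Q.ε x) = C.ε (πA x)) ∧
    (∀ x, TensorProduct.map πA π (Q.ΔL x) = C.ΔL (π x)) ∧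
    (∀ x, TensorProduct.map π πA (Q.ΔR x) = C.ΔR (π x)) ∧
    (∀ p r, ∀ x ∈ parityPart k⟦X⟧ (gMq k τ) p, ∀ y ∈ parityPart k⟦X⟧ (gMq k τ) r,
      ∃ w, x * y - koszul p r • (y * x) = (PowerSeries.X : k⟦X⟧) • w ∧ π w = br (π x) (π y))

end

end SLForms

end

/-!
Write the relations over an arbitrary parameter ring, so that the classical algebras are the case
`q = 1` of the quantum ones. Everything except flatness is formal. The comultiplications exist
because matrix products and the left coaction preserve the relations, and their axioms are checked
on generators. Flatness is a PBW theorem: the external algebra acts on a free module spanned by the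
ordered monomials in the matrix entries and the one-forms, so that these monomials, which span the
algebra by the relations, form a basis.

Since `M` is supercommutative and `Mq` has no `h`-torsion, the graded commutator of `Mq` is
divisible by `h`, and its quotient by `h` reduces to a graded Poisson bracket on `M`; the values of
this bracket on the generators are the first-order terms of the quantum relations, and the Leibniz
rule makes it the only bracket with these values. It is covariant because the quantum
comultiplications are algebra homomorphisms that reduce to the classical ones modulo `h`.
-/

noncomputable section

namespace SLForms

universe u

/-! ### Quantum matrices and one-forms over a ring of parameters -/

/-- Deformation parameters in a commutative ring: `q` with inverse `qi`, such that `q + qi` has the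
inverse `li`. The quantum algebras use `q = e⁻ʰ` in `k⟦h⟧`, the classical ones `q = 1` in `k`. -/
@[ext]
structure QParam (R : Type*) [CommRing R] where
  q : R
  qi : R
  li : R
  q_mul_qi : q * qi = 1
  add_mul_li : (q + qi) * li = 1

section Relations

variable {R : Type*} [CommRing R] (P : QParam R) {B B' : Type*} [Ring B] [Algebra R B] [Ring B']
  [Algebra R B'] {τ : Kind} {t s : TGen → B} {θ : Fin 3 → B} {x y x' y' : B}

/-- The scalar `μ = q - q⁻¹`. -/
def QParam.mu : R := P.q - P.qi

/-- The scalar `λ = q + q⁻¹`. -/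
def QParam.lam : R := P.q + P.qi

/-- The relations of quantum `2 × 2` matrices, imposed on the entries `t` of a matrix over `B`. -/
structure MatRels (t : TGen → B) : Prop where
  ab : t .a * t .b = P.q • (t .b * t .a)
  ac : t .a * t .c = P.q • (t .c * t .a)
  ad : t .a * t .d - t .d * t .a = P.mu • (t .b * t .c)
  bc : t .b * t .c = t .c * t .b
  cd : t .c * t .d = P.q • (t .d * t .c)
  bd : t .b * t .d = P.q • (t .d * t .b)

/-- The relations of quantum `2 × 2` matrices of quantum determinant `1`. -/
structure SLRels (t : TGen → B) : Prop extends MatRels P t where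
  det : t .a * t .d - P.q • (t .b * t .c) = 1

/-- The quadratic relations among the one-forms `θ⁰, θ¹, θ²`. -/
structure ThetaRels (θ : Fin 3 → B) : Prop where
  sq0 : θ 0 * θ 0 = (P.q ^ 2 * P.mu * P.li) • (θ 1 * θ 2)
  sq1 : θ 1 * θ 1 = 0
  sq2 : θ 2 * θ 2 = 0
  r21 : θ 2 * θ 1 = -(θ 1 * θ 2)
  r10 : θ 1 * θ 0 = -(P.qi ^ 2 • (θ 0 * θ 1))
  r20 : θ 2 * θ 0 = -(P.q ^ 2 • (θ 0 * θ 2))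

/-- The normal form of the products `θⁱ x`, where `(x, y)` is a column of the quantum matrix. -/
def upperRhs (θ : Fin 3 → B) (x y : B) : Kind → Fin 3 → B
  | .I => ![x * θ 0 + (P.q ^ 2 * P.mu) • (y * θ 1), P.qi • (x * θ 1),
            P.q • (x * θ 2) - (P.mu * P.lam) • (y * θ 0)]
  | .II => ![x * θ 0, P.q • (x * θ 1), P.qi • (x * θ 2)]

/-- The normal form of the products `θⁱ y`, where `(x, y)` is a column of the quantum matrix. -/
def lowerRhs (θ : Fin 3 → B) (x y : B) : Kind → Fin 3 → B
  | .I => ![y * θ 0, P.q • (y * θ 1), P.qi • (y * θ 2)]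
  | .II => ![y * θ 0 + P.mu • (x * θ 2),
             P.qi • (y * θ 1) - (P.mu * P.lam * P.qi ^ 2) • (x * θ 0), P.q • (y * θ 2)]

/-- The relations of type `τ` which move the one-forms past a column `(x, y)` of the quantum
matrix. -/
structure ColRels (τ : Kind) (θ : Fin 3 → B) (x y : B) : Prop where
  upper : ∀ i, θ i * x = upperRhs P θ x y τ i
  lower : ∀ i, θ i * y = lowerRhs P θ x y τ i

/-- The relations of type `τ` which involve one-forms. -/
structure FormsRels (τ : Kind) (t : TGen → B) (θ : Fin 3 → B) : Prop extends ThetaRels P θ where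
  ac : ColRels P τ θ (t .a) (t .c)
  bd : ColRels P τ θ (t .b) (t .d)

/-- The entries of the product of two `2 × 2` matrices, written out on the index type `TGen`. -/
def matMul (t s : TGen → B) : TGen → B
  | .a => t .a * s .a + t .b * s .c
  | .b => t .a * s .b + t .b * s .d
  | .c => t .c * s .a + t .d * s .c
  | .d => t .c * s .b + t .d * s .d

/-- The left coaction on one-forms, for a matrix and one-forms in a common algebra. -/
def leftCoaction (t : TGen → B) (θ : Fin 3 → B) : Fin 3 → B :=
  ![(t .a * t .d + P.qi • (t .b * t .c)) * θ 0 - (P.q • (t .a * t .c)) * θ 1 + t .b * t .d * θ 2,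
    -(((P.lam * P.qi) • (t .b * t .a)) * θ 0) + t .a ^ 2 * θ 1 - (P.qi • t .b ^ 2) * θ 2,
    (P.lam • (t .d * t .c)) * θ 0 - (P.q • t .c ^ 2) * θ 1 + t .d ^ 2 * θ 2]

variable {P}

/-! ### Functoriality of the relations -/

theorem MatRels.map (h : MatRels P t) (f : B →ₐ[R] B') : MatRels P (f ∘ t) where
  ab := by simpa using congrArg f h.ab
  ac := by simpa using congrArg f h.ac
  ad := by simpa using congrArg f h.ad
  bc := by simpa using congrArg f h.bc
  cd := by simpa using congrArg f h.cd
  bd := by simpa using congrArg f h.bd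

theorem SLRels.map (h : SLRels P t) (f : B →ₐ[R] B') : SLRels P (f ∘ t) where
  toMatRels := h.toMatRels.map f
  det := by simpa using congrArg f h.det

theorem ThetaRels.map (h : ThetaRels P θ) (f : B →ₐ[R] B') : ThetaRels P (f ∘ θ) where
  sq0 := by simpa using congrArg f h.sq0
  sq1 := by simpa using congrArg f h.sq1
  sq2 := by simpa using congrArg f h.sq2
  r21 := by simpa using congrArg f h.r21
  r10 := by simpa using congrArg f h.r10
  r20 := by simpa using congrArg f h.r20

theorem map_upperRhs (f : B →ₐ[R] B') (i : Fin 3) :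
    f (upperRhs P θ x y τ i) = upperRhs P (f ∘ θ) (f x) (f y) τ i := by
  cases τ <;> fin_cases i <;> simp [upperRhs]

theorem map_lowerRhs (f : B →ₐ[R] B') (i : Fin 3) :
    f (lowerRhs P θ x y τ i) = lowerRhs P (f ∘ θ) (f x) (f y) τ i := by
  cases τ <;> fin_cases i <;> simp [lowerRhs]

theorem ColRels.map (h : ColRels P τ θ x y) (f : B →ₐ[R] B') :
    ColRels P τ (f ∘ θ) (f x) (f y) where
  upper i := by rw [← map_upperRhs, ← h.upper, map_mul, Function.comp_apply]
  lower i := by rw [← map_lowerRhs, ← h.lower, map_mul, Function.comp_apply]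

theorem FormsRels.map (h : FormsRels P τ t θ) (f : B →ₐ[R] B') :
    FormsRels P τ (f ∘ t) (f ∘ θ) where
  toThetaRels := h.toThetaRels.map f
  ac := h.ac.map f
  bd := h.bd.map f

theorem map_comp_leftCoaction (f : B →ₐ[R] B') :
    f ∘ leftCoaction P t θ = leftCoaction P (f ∘ t) (f ∘ θ) := by
  ext i
  fin_cases i <;> simp [leftCoaction]

/-! ### Products of quantum matrices and the left coaction -/

theorem mul_mul_of_eq {x y z : B} (h : x * y = z) (w : B) : x * (y * w) = z * w := by
  rw [← mul_assoc, h]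

theorem QParam.eq_qi_smul {V : Type*} [AddCommGroup V] [Module R V] {x y : V} (h : x = P.q • y) :
    y = P.qi • x := by
  rw [h, smul_smul, mul_comm, P.q_mul_qi, one_smul]

theorem SLRels.mul_ad (h : SLRels P t) : t .a * t .d = 1 + P.q • (t .b * t .c) :=
  sub_eq_iff_eq_add.1 h.det

theorem SLRels.mul_da (h : SLRels P t) : t .d * t .a = 1 + P.qi • (t .b * t .c) := by
  have had := h.ad
  rw [h.mul_ad] at had
  rw [← sub_sub_cancel (1 + P.q • (t .b * t .c)) (t .d * t .a), had, QParam.mu, sub_smul]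
  abel

/-- Rules which rewrite every word in the matrix entries into words `bⁱ cʲ aⁿ` and `bⁱ cʲ dⁿ`. -/
theorem SLRels.mul_eq_normal (h : SLRels P t) :
    t .a * t .b = P.q • (t .b * t .a) ∧ t .a * t .c = P.q • (t .c * t .a) ∧
    t .d * t .b = P.qi • (t .b * t .d) ∧ t .d * t .c = P.qi • (t .c * t .d) ∧
    t .c * t .b = t .b * t .c ∧ t .a * t .d = 1 + P.q • (t .b * t .c) ∧
    t .d * t .a = 1 + P.qi • (t .b * t .c) :=
  ⟨h.ab, h.ac, P.eq_qi_smul h.bd, P.eq_qi_smul h.cd, h.bc.symm, h.mul_ad, h.mul_da⟩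

theorem SLRels.mul_mul_eq_normal (h : SLRels P t) (w : B) :
    t .a * (t .b * w) = P.q • (t .b * (t .a * w)) ∧
    t .a * (t .c * w) = P.q • (t .c * (t .a * w)) ∧
    t .d * (t .b * w) = P.qi • (t .b * (t .d * w)) ∧
    t .d * (t .c * w) = P.qi • (t .c * (t .d * w)) ∧
    t .c * (t .b * w) = t .b * (t .c * w) ∧
    t .a * (t .d * w) = w + P.q • (t .b * (t .c * w)) ∧
    t .d * (t .a * w) = w + P.qi • (t .b * (t .c * w)) := by
  obtain ⟨hab, hac, hdb, hdc, hcb, had, hda⟩ := h.mul_eq_normal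
  simp only [mul_mul_of_eq hab, mul_mul_of_eq hac, mul_mul_of_eq hdb, mul_mul_of_eq hdc,
    mul_mul_of_eq hcb, mul_mul_of_eq had, mul_mul_of_eq hda, add_mul, smul_mul_assoc, mul_assoc,
    one_mul, and_self]

theorem SLRels.matMul (ht : SLRels P t) (hs : SLRels P s) (hst : ∀ x y, s x * t y = t y * s x) :
    SLRels P (matMul t s) := by
  have hst' := fun x y => mul_mul_of_eq (hst x y)
  have hq := P.q_mul_qi
  refine ⟨⟨?_, ?_, ?_, ?_, ?_, ?_⟩, ?_⟩ <;>
  simp only [SLForms.matMul, mul_add, add_mul, mul_assoc, hst', ht.mul_eq_normal,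
    ht.mul_mul_eq_normal, hs.mul_eq_normal, mul_smul_comm, mul_one, smul_add] <;>
  match_scalars <;> grind [QParam.mu]

theorem ThetaRels.leftCoaction (hθ : ThetaRels P θ) (ht : SLRels P t)
    (hθt : ∀ i x, θ i * t x = t x * θ i) : ThetaRels P (leftCoaction P t θ) := by
  have hθt' := fun i x => mul_mul_of_eq (hθt i x)
  have hq := P.q_mul_qi
  have hl := P.add_mul_li
  obtain ⟨h00, h11, h22, h21, h10, h20⟩ := hθ
  refine ⟨?_, ?_, ?_, ?_, ?_, ?_⟩ <;>
  simp only [SLForms.leftCoaction, Matrix.cons_val, mul_add, add_mul, mul_sub, sub_mul, neg_mul,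
    mul_neg, mul_assoc, pow_two (t _), hθt', ht.mul_eq_normal, ht.mul_mul_eq_normal, h00, h11, h22,
    h21, h10, h20, smul_mul_assoc, mul_smul_comm, one_mul, smul_add, mul_zero] <;>
  match_scalars <;> grind [QParam.mu, QParam.lam]

theorem ColRels.leftCoaction_mul_upper (h : ColRels P τ θ x y) (ht : SLRels P t)
    (hθt : ∀ i z, θ i * t z = t z * θ i) (hx : ∀ z, x * t z = t z * x)
    (hy : ∀ z, y * t z = t z * y) (i : Fin 3) :
    leftCoaction P t θ i * (t .a * x + t .b * y) =
      upperRhs P (leftCoaction P t θ) (t .a * x + t .b * y) (t .c * x + t .d * y) τ i := by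
  have hθt' := fun i z => mul_mul_of_eq (hθt i z)
  have hx' := fun z => mul_mul_of_eq (hx z)
  have hy' := fun z => mul_mul_of_eq (hy z)
  have hq := P.q_mul_qi
  cases τ <;> fin_cases i <;>
  simp only [SLForms.leftCoaction, h.upper, h.lower, upperRhs, lowerRhs, Fin.zero_eta, Fin.mk_one,
    Fin.reduceFinMk, Matrix.cons_val, mul_add, add_mul, mul_sub, sub_mul, neg_mul, mul_neg,
    mul_assoc, pow_two (t _), hθt', hx', hy', ht.mul_eq_normal, ht.mul_mul_eq_normal,
    smul_mul_assoc, mul_smul_comm, one_mul, smul_add, smul_sub] <;>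
  match_scalars <;> grind [QParam.mu, QParam.lam]

theorem ColRels.leftCoaction_mul_lower (h : ColRels P τ θ x y) (ht : SLRels P t)
    (hθt : ∀ i z, θ i * t z = t z * θ i) (hx : ∀ z, x * t z = t z * x)
    (hy : ∀ z, y * t z = t z * y) (i : Fin 3) :
    leftCoaction P t θ i * (t .c * x + t .d * y) =
      lowerRhs P (leftCoaction P t θ) (t .a * x + t .b * y) (t .c * x + t .d * y) τ i := by
  have hθt' := fun i z => mul_mul_of_eq (hθt i z)
  have hx' := fun z => mul_mul_of_eq (hx z)
  have hy' := fun z => mul_mul_of_eq (hy z)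
  have hq := P.q_mul_qi
  cases τ <;> fin_cases i <;>
  simp only [SLForms.leftCoaction, h.upper, h.lower, upperRhs, lowerRhs, Fin.zero_eta, Fin.mk_one,
    Fin.reduceFinMk, Matrix.cons_val, mul_add, add_mul, mul_sub, sub_mul, neg_mul, mul_neg,
    mul_assoc, pow_two (t _), hθt', hx', hy', ht.mul_eq_normal, ht.mul_mul_eq_normal,
    smul_mul_assoc, mul_smul_comm, one_mul, smul_add, smul_sub] <;>
  match_scalars <;> grind [QParam.mu, QParam.lam]

theorem ColRels.leftCoaction (h : ColRels P τ θ x y) (ht : SLRels P t)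
    (hθt : ∀ i z, θ i * t z = t z * θ i) (hx : ∀ z, x * t z = t z * x)
    (hy : ∀ z, y * t z = t z * y) :
    ColRels P τ (leftCoaction P t θ) (t .a * x + t .b * y) (t .c * x + t .d * y) where
  upper := h.leftCoaction_mul_upper ht hθt hx hy
  lower := h.leftCoaction_mul_lower ht hθt hx hy

theorem FormsRels.leftCoaction (hθ : FormsRels P τ s θ) (ht : SLRels P t)
    (hst : ∀ x y, s x * t y = t y * s x) (hθt : ∀ i x, θ i * t x = t x * θ i) :
    FormsRels P τ (SLForms.matMul t s) (leftCoaction P t θ) where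
  toThetaRels := hθ.toThetaRels.leftCoaction ht hθt
  ac := hθ.ac.leftCoaction ht hθt (hst .a) (hst .c)
  bd := hθ.bd.leftCoaction ht hθt (hst .b) (hst .d)

theorem ColRels.add (h : ColRels P τ θ x y) (h' : ColRels P τ θ x' y') :
    ColRels P τ θ (x + x') (y + y') where
  upper i := by
    rw [mul_add, h.upper, h'.upper]
    cases τ <;> fin_cases i <;> simp [upperRhs, add_mul] <;> abel
  lower i := by
    rw [mul_add, h.lower, h'.lower]
    cases τ <;> fin_cases i <;> simp [lowerRhs, add_mul] <;> abel

theorem ColRels.mul_right (h : ColRels P τ θ x y) {z : B} (hz : ∀ i, z * θ i = θ i * z) :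
    ColRels P τ θ (x * z) (y * z) where
  upper i := by
    rw [← mul_assoc, h.upper]
    cases τ <;> fin_cases i <;> simp [upperRhs, add_mul, sub_mul, mul_assoc, hz]
  lower i := by
    rw [← mul_assoc, h.lower]
    cases τ <;> fin_cases i <;> simp [lowerRhs, add_mul, sub_mul, mul_assoc, hz]

theorem FormsRels.rightCoaction (hθ : FormsRels P τ t θ) (hsθ : ∀ x i, s x * θ i = θ i * s x) :
    FormsRels P τ (SLForms.matMul t s) θ where
  toThetaRels := hθ.toThetaRels
  ac := (hθ.ac.mul_right (hsθ .a)).add (hθ.bd.mul_right (hsθ .c))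
  bd := (hθ.ac.mul_right (hsθ .b)).add (hθ.bd.mul_right (hsθ .d))

theorem leftCoaction_leftCoaction (ht : SLRels P t) (hs : SLRels P s)
    (hst : ∀ x y, s x * t y = t y * s x) :
    leftCoaction P t (leftCoaction P s θ) = leftCoaction P (matMul t s) θ := by
  have hst' := fun x y => mul_mul_of_eq (hst x y)
  have hq := P.q_mul_qi
  ext i
  fin_cases i <;>
  simp only [leftCoaction, matMul, Fin.zero_eta, Fin.mk_one, Fin.reduceFinMk, Matrix.cons_val,
    mul_add, add_mul, mul_sub, mul_neg, mul_assoc, hst', pow_two, ht.mul_eq_normal,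
    ht.mul_mul_eq_normal, hs.mul_eq_normal, smul_mul_assoc, mul_smul_comm, one_mul, mul_one,
    smul_add] <;>
  match_scalars <;> grind [QParam.mu, QParam.lam]

end Relations

/-! ### Presentations -/

section Presentation

variable {R : Type u} [CommRing R]

/-- The algebra `X` is presented by the generators `g` and the relations `Rel`. -/
structure Presents {ι : Type} (Rel : ∀ (B : Type u) [Ring B] [Algebra R B], (ι → B) → Prop)
    {X : Type u} [Ring X] [Algebra R X] (g : ι → X) : Prop where
  rel : Rel X g
  lift : ∀ (B : Type u) [Ring B] [Algebra R B] (t : ι → B), Rel B t →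
    ∃ f : X →ₐ[R] B, ∀ s, f (g s) = t s
  adjoin_eq_top : Algebra.adjoin R (Set.range g) = ⊤

theorem Presents.hom_ext {ι : Type} {Rel : ∀ (B : Type u) [Ring B] [Algebra R B], (ι → B) → Prop}
    {X : Type u} [Ring X] [Algebra R X] {g : ι → X} (h : Presents Rel g) {B : Type*} [Semiring B]
    [Algebra R B] {f₁ f₂ : X →ₐ[R] B} (hf : ∀ s, f₁ (g s) = f₂ (g s)) : f₁ = f₂ :=
  AlgHom.ext_of_adjoin_eq_top h.adjoin_eq_top (by rintro _ ⟨s, rfl⟩; exact hf s)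

variable (P : QParam R)

/-- The relations of the function algebra, for presentations. -/
def FunRel (B : Type u) [Ring B] [Algebra R B] (t : TGen → B) : Prop := SLRels P t

/-- The relations of the external algebra, for presentations. -/
def ExtRel (τ : Kind) (B : Type u) [Ring B] [Algebra R B] (g : Gen → B) : Prop :=
  SLRels P (g ∘ .t) ∧ FormsRels P τ (g ∘ .t) (g ∘ .θ)

/-- The relations of the external algebra without the determinant relation, for presentations. -/
def GLExtRel (τ : Kind) (B : Type u) [Ring B] [Algebra R B] (g : Gen → B) : Prop :=
  MatRels P (g ∘ .t) ∧ FormsRels P τ (g ∘ .t) (g ∘ .θ)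

theorem presents_ringQuot {ι : Type} {r : FreeAlgebra R ι → FreeAlgebra R ι → Prop}
    {Rel : ∀ (B : Type u) [Ring B] [Algebra R B], (ι → B) → Prop}
    (h : ∀ (B : Type u) [Ring B] [Algebra R B] (f : FreeAlgebra R ι →ₐ[R] B),
      (∀ x y, r x y → f x = f y) ↔ Rel B (f ∘ FreeAlgebra.ι R)) :
    Presents Rel (RingQuot.mkAlgHom R r ∘ FreeAlgebra.ι R) where
  rel := (h _ _).1 fun _ _ => RingQuot.mkAlgHom_rel R
  lift B _ _ t ht :=
    ⟨RingQuot.liftAlgHom R ⟨FreeAlgebra.lift R t, fun {x y} => (h _ _).2 (by simpa using ht) x y⟩,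
      by simp⟩
  adjoin_eq_top := by
    rw [Set.range_comp, ← AlgHom.map_adjoin, FreeAlgebra.adjoin_range_ι, Algebra.map_top,
      AlgHom.range_eq_top]
    exact RingQuot.mkAlgHom_surjective R r

end Presentation

/-! ### The comultiplications -/

section Comultiplications

open Algebra.TensorProduct

variable {R : Type*} [CommRing R] {P : QParam R} {τ : Kind} {A M : Type*} [Ring A] [Algebra R A]
  [Ring M] [Algebra R M] {t : TGen → A} {s : TGen → M} {θ : Fin 3 → M}

/-- The matrix product `t ⊗ s` which defines the coproduct of matrix entries. -/
def matTensor (t : TGen → A) (s : TGen → M) : TGen → A ⊗[R] M :=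
  matMul ((includeLeft : A →ₐ[R] A ⊗[R] M) ∘ t) ((includeRight : M →ₐ[R] A ⊗[R] M) ∘ s)

/-- The entries of the identity matrix: the counit of the matrix entries. -/
def matOne : TGen → R
  | .a | .d => 1
  | .b | .c => 0

variable (P) in
/-- The left coaction on the one-forms, with values in a tensor product. -/
def thetaTensor (t : TGen → A) (θ : Fin 3 → M) : Fin 3 → A ⊗[R] M :=
  leftCoaction P ((includeLeft : A →ₐ[R] A ⊗[R] M) ∘ t)
    ((includeRight : M →ₐ[R] A ⊗[R] M) ∘ θ)

variable (P) in
theorem thetaTensor_eq (t : TGen → A) (θ : Fin 3 → M) :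
    thetaTensor P t θ =
      ![(t .a * t .d + P.qi • (t .b * t .c)) ⊗ₜ θ 0 - (P.q • (t .a * t .c)) ⊗ₜ θ 1 +
          (t .b * t .d) ⊗ₜ θ 2,
        -(((P.lam * P.qi) • (t .b * t .a)) ⊗ₜ θ 0) + (t .a ^ 2) ⊗ₜ θ 1 -
          (P.qi • t .b ^ 2) ⊗ₜ θ 2,
        (P.lam • (t .d * t .c)) ⊗ₜ θ 0 - (P.q • t .c ^ 2) ⊗ₜ θ 1 + (t .d ^ 2) ⊗ₜ θ 2] := by
  simp [thetaTensor, leftCoaction, add_mul, TensorProduct.add_tmul, TensorProduct.smul_tmul',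
    pow_two]

theorem SLRels.matTensor (ht : SLRels P t) (hs : SLRels P s) :
    SLRels P (matTensor (R := R) t s) :=
  (ht.map _).matMul (hs.map _) (by simp)

theorem SLRels.matOne : SLRels P (matOne (R := R)) := by
  refine ⟨⟨?_, ?_, ?_, ?_, ?_, ?_⟩, ?_⟩ <;> simp [SLForms.matOne]

theorem FormsRels.thetaTensor (ht : SLRels P t) (hθ : FormsRels P τ s θ) :
    FormsRels P τ (SLForms.matTensor (R := R) t s) (thetaTensor P t θ) :=
  (hθ.map _).leftCoaction (ht.map _) (by simp) (by simp)

theorem FormsRels.tmul_one (hθ : FormsRels P τ s θ) :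
    FormsRels P τ (SLForms.matTensor (R := R) s t) fun i => θ i ⊗ₜ 1 :=
  (hθ.map (includeLeft : M →ₐ[R] M ⊗[R] A)).rightCoaction (by simp)

end Comultiplications

section Axioms

open Algebra.TensorProduct

variable {R : Type u} [CommRing R] {P : QParam R} {τ : Kind} {A M : Type u} [Ring A] [Algebra R A]
  [Ring M] [Algebra R M] {t : TGen → A} {g : Gen → M} {Δ : A →ₐ[R] A ⊗[R] A} {ε : A →ₐ[R] R}
  {ΔL : M →ₐ[R] A ⊗[R] M} {ΔR : M →ₐ[R] M ⊗[R] A} {incl : A →ₐ[R] M}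

theorem comul_coassoc (hA : Presents (FunRel P) t) (hΔ : ∀ x, Δ (t x) = matTensor t t x) :
    ((Algebra.TensorProduct.assoc R R R A A A).toAlgHom.comp (map Δ (.id R A))).comp Δ =
      (map (.id R A) Δ).comp Δ := by
  refine hA.hom_ext fun x => ?_
  cases x <;>
    simp [hΔ, matTensor, matMul, TensorProduct.add_tmul, TensorProduct.tmul_add] <;> abel

theorem comul_counit_left (hA : Presents (FunRel P) t) (hΔ : ∀ x, Δ (t x) = matTensor t t x)
    (hε : ∀ x, ε (t x) = matOne x) :
    ((Algebra.TensorProduct.lid R A).toAlgHom.comp (map ε (.id R A))).comp Δ = .id R A := by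
  refine hA.hom_ext fun x => ?_
  cases x <;> simp [hΔ, hε, matTensor, matMul, matOne]

theorem comul_counit_right (hA : Presents (FunRel P) t) (hΔ : ∀ x, Δ (t x) = matTensor t t x)
    (hε : ∀ x, ε (t x) = matOne x) :
    ((Algebra.TensorProduct.rid R R A).toAlgHom.comp (map (.id R A) ε)).comp Δ = .id R A := by
  refine hA.hom_ext fun x => ?_
  cases x <;> simp [hΔ, hε, matTensor, matMul, matOne]

theorem leftComul_incl (hA : Presents (FunRel P) t) (hincl : ∀ x, incl (t x) = g (.t x))
    (hΔ : ∀ x, Δ (t x) = matTensor t t x) (hL : ∀ x, ΔL (g (.t x)) = matTensor t (g ∘ .t) x) :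
    ΔL.comp incl = (map (.id R A) incl).comp Δ := by
  refine hA.hom_ext fun x => ?_
  cases x <;> simp [hΔ, hincl, hL, matTensor, matMul]

theorem rightComul_incl (hA : Presents (FunRel P) t) (hincl : ∀ x, incl (t x) = g (.t x))
    (hΔ : ∀ x, Δ (t x) = matTensor t t x) (hR : ∀ x, ΔR (g (.t x)) = matTensor (g ∘ .t) t x) :
    ΔR.comp incl = (map incl (.id R A)).comp Δ := by
  refine hA.hom_ext fun x => ?_
  cases x <;> simp [hΔ, hincl, hR, matTensor, matMul]

theorem leftComul_coassoc_theta (ht : SLRels P t) (hΔ : ∀ x, Δ (t x) = matTensor t t x)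
    (hLθ : ∀ i, ΔL (g (.θ i)) = thetaTensor P t (g ∘ .θ) i) (i : Fin 3) :
    (Algebra.TensorProduct.assoc R R R A A M) (map Δ (.id R M) (ΔL (g (.θ i)))) =
      map (.id R A) ΔL (ΔL (g (.θ i))) := by
  have left (f : A ⊗[R] M →ₐ[R] A ⊗[R] (A ⊗[R] M)) : f (ΔL (g (.θ i))) =
      leftCoaction P (fun x => f (t x ⊗ₜ 1)) (fun j => f (1 ⊗ₜ g (.θ j))) i :=
    (congrArg f (hLθ i)).trans (congrFun (map_comp_leftCoaction f) i)
  let θ₂ : Fin 3 → A ⊗[R] (A ⊗[R] M) := fun j => 1 ⊗ₜ (1 ⊗ₜ g (.θ j))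
  have ht₁ : SLRels P fun x => t x ⊗ₜ[R] (1 : A ⊗[R] M) := ht.map includeLeft
  have ht₂ : SLRels P fun x => (1 : A) ⊗ₜ[R] (t x ⊗ₜ[R] (1 : M)) :=
    (ht.map (includeLeft : A →ₐ[R] A ⊗[R] M)).map
      (includeRight : A ⊗[R] M →ₐ[R] A ⊗[R] (A ⊗[R] M))
  have hθ : (fun j => (1 : A) ⊗ₜ[R] ΔL (g (.θ j))) =
      leftCoaction P (fun x => (1 : A) ⊗ₜ[R] (t x ⊗ₜ[R] (1 : M))) θ₂ := by
    simp only [hLθ]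
    exact map_comp_leftCoaction (includeRight : A ⊗[R] M →ₐ[R] A ⊗[R] (A ⊗[R] M))
  have hmat : (fun x => (Algebra.TensorProduct.assoc R R R A A M) (Δ (t x) ⊗ₜ[R] (1 : M))) =
      matMul (fun x => t x ⊗ₜ[R] (1 : A ⊗[R] M)) (fun x => 1 ⊗ₜ[R] (t x ⊗ₜ[R] (1 : M))) := by
    ext x
    cases x <;> simp [hΔ, matTensor, matMul, TensorProduct.add_tmul]
  have h₁ := left ((Algebra.TensorProduct.assoc R R R A A M).toAlgHom.comp (map Δ (.id R M)))
  have h₂ := left (map (.id R A) ΔL)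
  simp only [map_tmul, AlgHom.id_apply, map_one, hθ] at h₂
  rw [leftCoaction_leftCoaction ht₁ ht₂ (by simp), ← hmat] at h₂
  refine h₁.trans (Eq.trans ?_ h₂.symm)
  simp [one_def, θ₂]

theorem leftComul_coassoc (hM : Presents (ExtRel P τ) g) (ht : SLRels P t)
    (hΔ : ∀ x, Δ (t x) = matTensor t t x) (hL : ∀ x, ΔL (g (.t x)) = matTensor t (g ∘ .t) x)
    (hLθ : ∀ i, ΔL (g (.θ i)) = thetaTensor P t (g ∘ .θ) i) :
    ((Algebra.TensorProduct.assoc R R R A A M).toAlgHom.comp (map Δ (.id R M))).comp ΔL =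
      (map (.id R A) ΔL).comp ΔL := by
  refine hM.hom_ext fun
    | .t x => ?_
    | .θ i => leftComul_coassoc_theta ht hΔ hLθ i
  cases x <;>
    simp [hΔ, hL, matTensor, matMul, TensorProduct.add_tmul, TensorProduct.tmul_add] <;> abel

theorem rightComul_coassoc (hM : Presents (ExtRel P τ) g) (hΔ : ∀ x, Δ (t x) = matTensor t t x)
    (hR : ∀ x, ΔR (g (.t x)) = matTensor (g ∘ .t) t x) (hRθ : ∀ i, ΔR (g (.θ i)) = g (.θ i) ⊗ₜ 1) :
    ((Algebra.TensorProduct.assoc R R R M A A).toAlgHom.comp (map ΔR (.id R A))).comp ΔR =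
      (map (.id R M) Δ).comp ΔR := by
  refine hM.hom_ext fun
    | .t x => ?_
    | .θ i => by simp [hRθ, one_def]
  cases x <;>
    simp [hΔ, hR, matTensor, matMul, TensorProduct.add_tmul, TensorProduct.tmul_add] <;> abel

theorem leftComul_counit (hM : Presents (ExtRel P τ) g) (hε : ∀ x, ε (t x) = matOne x)
    (hL : ∀ x, ΔL (g (.t x)) = matTensor t (g ∘ .t) x)
    (hLθ : ∀ i, ΔL (g (.θ i)) = thetaTensor P t (g ∘ .θ) i) :
    ((Algebra.TensorProduct.lid R M).toAlgHom.comp (map ε (.id R M))).comp ΔL = .id R M := by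
  refine hM.hom_ext fun
    | .t x => ?_
    | .θ i => ?_
  · cases x <;> simp [hε, hL, matTensor, matMul, matOne]
  · fin_cases i <;> simp [hε, hLθ, thetaTensor, leftCoaction, matOne]

theorem rightComul_counit (hM : Presents (ExtRel P τ) g) (hε : ∀ x, ε (t x) = matOne x)
    (hR : ∀ x, ΔR (g (.t x)) = matTensor (g ∘ .t) t x) (hRθ : ∀ i, ΔR (g (.θ i)) = g (.θ i) ⊗ₜ 1) :
    ((Algebra.TensorProduct.rid R R M).toAlgHom.comp (map (.id R M) ε)).comp ΔR = .id R M := by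
  refine hM.hom_ext fun
    | .t x => ?_
    | .θ i => by simp [hRθ]
  cases x <;> simp [hε, hR, matTensor, matMul, matOne]

theorem leftComul_rightComul (hM : Presents (ExtRel P τ) g)
    (hL : ∀ x, ΔL (g (.t x)) = matTensor t (g ∘ .t) x)
    (hLθ : ∀ i, ΔL (g (.θ i)) = thetaTensor P t (g ∘ .θ) i)
    (hR : ∀ x, ΔR (g (.t x)) = matTensor (g ∘ .t) t x) (hRθ : ∀ i, ΔR (g (.θ i)) = g (.θ i) ⊗ₜ 1) :
    ((Algebra.TensorProduct.assoc R R R A M A).toAlgHom.comp (map ΔL (.id R A))).comp ΔR =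
      (map (.id R A) ΔR).comp ΔL := by
  refine hM.hom_ext fun
    | .t x => ?_
    | .θ i => ?_
  · cases x <;>
      simp [hL, hR, matTensor, matMul, TensorProduct.add_tmul, TensorProduct.tmul_add] <;> abel
  · fin_cases i <;>
      simp [hRθ, hLθ, thetaTensor, leftCoaction, add_mul, TensorProduct.add_tmul,
        TensorProduct.sub_tmul, TensorProduct.neg_tmul, TensorProduct.smul_tmul']

theorem exists_comultiplications (hA : Presents (FunRel P) t) (hM : Presents (ExtRel P τ) g)
    (hincl : ∀ x, incl (t x) = g (.t x)) :
    ∃ C : Comultiplications R A M incl, IsMatrixCoproduct t C.Δ C.ε ∧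
      (∀ i, C.ΔR (g (.θ i)) = g (.θ i) ⊗ₜ 1) ∧
      ∀ i, C.ΔL (g (.θ i)) = thetaTensor P t (g ∘ .θ) i := by
  have ht : SLRels P t := hA.rel
  obtain ⟨hs, hθ⟩ := hM.rel
  obtain ⟨Δ, hΔ⟩ := hA.lift _ (matTensor t t) (ht.matTensor ht)
  obtain ⟨ε, hε⟩ := hA.lift R matOne .matOne
  obtain ⟨ΔL, hΔL⟩ := hM.lift (A ⊗[R] M)
    (fun | .t x => matTensor t (g ∘ .t) x | .θ i => thetaTensor P t (g ∘ .θ) i)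
    ⟨ht.matTensor hs, .thetaTensor ht hθ⟩
  obtain ⟨ΔR, hΔR⟩ := hM.lift (M ⊗[R] A)
    (fun | .t x => matTensor (g ∘ .t) t x | .θ i => g (.θ i) ⊗ₜ 1)
    ⟨hs.matTensor ht, hθ.tmul_one⟩
  have hL x : ΔL (g (.t x)) = matTensor t (g ∘ .t) x := hΔL (.t x)
  have hLθ i : ΔL (g (.θ i)) = thetaTensor P t (g ∘ .θ) i := hΔL (.θ i)
  have hR x : ΔR (g (.t x)) = matTensor (g ∘ .t) t x := hΔR (.t x)
  have hRθ i : ΔR (g (.θ i)) = g (.θ i) ⊗ₜ 1 := hΔR (.θ i)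
  refine ⟨{ Δ, ε, ΔL, ΔR
            coassoc := DFunLike.congr_fun (comul_coassoc hA hΔ)
            counit_left := DFunLike.congr_fun (comul_counit_left hA hΔ hε)
            counit_right := DFunLike.congr_fun (comul_counit_right hA hΔ hε)
            ΔL_incl := DFunLike.congr_fun (leftComul_incl hA hincl hΔ hL)
            ΔR_incl := DFunLike.congr_fun (rightComul_incl hA hincl hΔ hR)
            ΔL_coassoc := DFunLike.congr_fun (leftComul_coassoc hM ht hΔ hL hLθ)
            ΔR_coassoc := DFunLike.congr_fun (rightComul_coassoc hM hΔ hR hRθ)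
            ΔL_counit := DFunLike.congr_fun (leftComul_counit hM hε hL hLθ)
            ΔR_counit := DFunLike.congr_fun (rightComul_counit hM hε hR hRθ)
            ΔL_ΔR := DFunLike.congr_fun (leftComul_rightComul hM hL hLθ hR hRθ) }, ?_, hRθ, hLθ⟩
  constructor <;> simp [hΔ, hε, matTensor, matMul, matOne]

end Axioms

/-! ### The presentations of the quantum and the classical algebras -/

section QuantumPresentations

variable (k : Type u) [Field k] [CharZero k]

theorem constantCoeff_q : PowerSeries.constantCoeff (q k) = 1 := by
  simp [q, PowerSeries.evalNegHom, PowerSeries.rescale]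

theorem constantCoeff_q_inv : PowerSeries.constantCoeff (q k)⁻¹ = 1 := by
  simp [constantCoeff_q]

theorem constantCoeff_lam : PowerSeries.constantCoeff (lam k) = 2 := by
  rw [lam, map_add, constantCoeff_q, constantCoeff_q_inv, one_add_one_eq_two]

/-- The parameters of the quantum algebras. -/
def qParam : QParam k⟦X⟧ where
  q := q k
  qi := (q k)⁻¹
  li := (lam k)⁻¹
  q_mul_qi := PowerSeries.mul_inv_cancel _ (by simp [constantCoeff_q])
  add_mul_li := PowerSeries.mul_inv_cancel (lam k) (by simp [constantCoeff_lam])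

@[simp]
theorem qParam_q : (qParam k).q = q k := rfl

@[simp]
theorem qParam_qi : (qParam k).qi = (q k)⁻¹ := rfl

@[simp]
theorem qParam_li : (qParam k).li = (lam k)⁻¹ := rfl

@[simp]
theorem qParam_mu : (qParam k).mu = mu k := rfl

theorem q_sq_inv : (q k ^ 2)⁻¹ = (q k)⁻¹ ^ 2 := by
  rw [pow_two, pow_two, PowerSeries.mul_inv_rev]

variable {k} {B B' : Type*} [Ring B] [Algebra k⟦X⟧ B] [Ring B'] [Algebra k⟦X⟧ B'] {τ : Kind}

theorem glqRel_iff {t : TGen → B} (f : B →ₐ[k⟦X⟧] B') :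
    (∀ x y, GLqRel k t x y → f x = f y) ↔ MatRels (qParam k) (f ∘ t) where
  mp h :=
    { ab := by simpa using h _ _ .ab
      ac := by simpa using h _ _ .ac
      ad := by simpa using h _ _ .ad
      bc := by simpa using h _ _ .bc
      cd := by simpa using h _ _ .cd
      bd := by simpa using h _ _ .bd }
  mpr h := by
    rintro _ _ (_ | _)
    exacts [by simpa using h.ab, by simpa using h.ac, by simpa using h.ad, by simpa using h.bc,
      by simpa using h.cd, by simpa using h.bd]

theorem thetaRel_iff {θ : Fin 3 → B} (f : B →ₐ[k⟦X⟧] B') :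
    (∀ x y, ThetaRel k θ x y → f x = f y) ↔ ThetaRels (qParam k) (f ∘ θ) where
  mp h :=
    { sq0 := by simpa [pow_two] using h _ _ .sq0
      sq1 := by simpa [pow_two] using h _ _ .sq1
      sq2 := by simpa [pow_two] using h _ _ .sq2
      r21 := by simpa using (congrArg Neg.neg (h _ _ .r12)).symm
      r10 := by simpa [q_sq_inv] using h _ _ .r10
      r20 := by simpa using h _ _ .r20 }
  mpr h := by
    rintro _ _ (_ | _)
    exacts [by simpa [pow_two] using h.sq0, by simpa [pow_two] using h.sq1,
      by simpa [pow_two] using h.sq2, by simpa using (congrArg Neg.neg h.r21).symm,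
      by simpa [q_sq_inv] using h.r10, by simpa using h.r20]

theorem map_crossRhs {t : TGen → B} {θ : Fin 3 → B} (f : B →ₐ[k⟦X⟧] B') (i : Fin 3) :
    f (crossRhs k t θ τ .a i) = upperRhs (qParam k) (f ∘ θ) (f (t .a)) (f (t .c)) τ i ∧
    f (crossRhs k t θ τ .b i) = upperRhs (qParam k) (f ∘ θ) (f (t .b)) (f (t .d)) τ i ∧
    f (crossRhs k t θ τ .c i) = lowerRhs (qParam k) (f ∘ θ) (f (t .a)) (f (t .c)) τ i ∧
    f (crossRhs k t θ τ .d i) = lowerRhs (qParam k) (f ∘ θ) (f (t .b)) (f (t .d)) τ i := by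
  simp only [← map_upperRhs, ← map_lowerRhs]
  cases τ <;> simp only [crossRhs, q_sq_inv] <;> exact ⟨rfl, rfl, rfl, rfl⟩

theorem glFormsRel_iff {t : TGen → B} {θ : Fin 3 → B} (f : B →ₐ[k⟦X⟧] B') :
    (∀ x y, GLFormsRel k t θ τ x y → f x = f y) ↔
      MatRels (qParam k) (f ∘ t) ∧ FormsRels (qParam k) τ (f ∘ t) (f ∘ θ) := by
  refine ⟨fun h => ?_, ?_⟩
  · have cross i x : f (θ i) * f (t x) = f (crossRhs k t θ τ x i) := by
      simpa using h _ _ (.cross i x)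
    exact ⟨(glqRel_iff f).1 fun _ _ hxy => h _ _ (.tt hxy),
      { toThetaRels := (thetaRel_iff f).1 fun _ _ hxy => h _ _ (.θθ hxy)
        ac := ⟨fun i => (cross i .a).trans (map_crossRhs f i).1,
          fun i => (cross i .c).trans (map_crossRhs f i).2.2.1⟩
        bd := ⟨fun i => (cross i .b).trans (map_crossRhs f i).2.1,
          fun i => (cross i .d).trans (map_crossRhs f i).2.2.2⟩ }⟩
  · rintro ⟨h, h'⟩ _ _ (hxy | ⟨i, x⟩ | hxy)
    · exact (glqRel_iff f).2 h _ _ hxy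
    · obtain ⟨ha, hb, hc, hd⟩ := map_crossRhs (t := t) (θ := θ) (τ := τ) f i
      rw [map_mul]
      cases x
      exacts [(h'.ac.upper i).trans ha.symm, (h'.bd.upper i).trans hb.symm,
        (h'.ac.lower i).trans hc.symm, (h'.bd.lower i).trans hd.symm]
    · exact (thetaRel_iff f).2 h'.toThetaRels _ _ hxy

theorem map_detq_eq_one_iff {t : TGen → B} (f : B →ₐ[k⟦X⟧] B') :
    f (detq k t) = f 1 ↔ detq k (f ∘ t) = 1 := by
  simp [detq]

theorem slqRel_iff {t : TGen → B} (f : B →ₐ[k⟦X⟧] B') :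
    (∀ x y, SLqRel k t x y → f x = f y) ↔ SLRels (qParam k) (f ∘ t) := by
  refine ⟨fun h => ⟨(glqRel_iff f).1 fun _ _ hxy => h _ _ (.base hxy),
    (map_detq_eq_one_iff f).1 (h _ _ .det)⟩, ?_⟩
  rintro h _ _ (hxy | _)
  exacts [(glqRel_iff f).2 h.toMatRels _ _ hxy, (map_detq_eq_one_iff f).2 h.det]

theorem slFormsRel_iff {t : TGen → B} {θ : Fin 3 → B} (f : B →ₐ[k⟦X⟧] B') :
    (∀ x y, SLFormsRel k t θ τ x y → f x = f y) ↔
      SLRels (qParam k) (f ∘ t) ∧ FormsRels (qParam k) τ (f ∘ t) (f ∘ θ) := by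
  refine ⟨fun h => ?_, ?_⟩
  · obtain ⟨h₁, h₂⟩ := (glFormsRel_iff f).1 fun _ _ hxy => h _ _ (.base hxy)
    exact ⟨⟨h₁, (map_detq_eq_one_iff f).1 (h _ _ .det)⟩, h₂⟩
  · rintro ⟨h, h'⟩ _ _ (hxy | _)
    exacts [(glFormsRel_iff f).2 ⟨h.toMatRels, h'⟩ _ _ hxy, (map_detq_eq_one_iff f).2 h.det]

variable (k)

theorem presents_tAq : Presents (FunRel (qParam k)) (tAq k) :=
  presents_ringQuot fun _ _ _ f => slqRel_iff f

theorem presents_gMq (τ : Kind) : Presents (ExtRel (qParam k) τ) (gMq k τ) :=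
  presents_ringQuot fun _ _ _ f => slFormsRel_iff f

theorem presents_mkMqGL (τ : Kind) :
    Presents (GLExtRel (qParam k) τ) (mkMqGL k τ ∘ FreeAlgebra.ι k⟦X⟧) :=
  presents_ringQuot fun _ _ _ f => glFormsRel_iff f

end QuantumPresentations

section ClassicalPresentations

variable (k : Type u) [Field k] [CharZero k]

/-- The parameters of the classical algebras. -/
def oneParam : QParam k where
  q := 1
  qi := 1
  li := 2⁻¹
  q_mul_qi := one_mul 1
  add_mul_li := by rw [one_add_one_eq_two]; exact mul_inv_cancel₀ two_ne_zero

@[simp]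
theorem oneParam_q : (oneParam k).q = 1 := rfl

@[simp]
theorem oneParam_qi : (oneParam k).qi = 1 := rfl

@[simp]
theorem oneParam_mu : (oneParam k).mu = 0 := sub_self 1

@[simp]
theorem oneParam_lam : (oneParam k).lam = 2 := one_add_one_eq_two

variable {k} {B B' : Type*} [Ring B] [Algebra k B] [Ring B'] [Algebra k B'] {τ : Kind}
  {t : TGen → B} {θ : Fin 3 → B} {x y : B}

theorem slRels_oneParam_iff : SLRels (oneParam k) t ↔
    (∀ x y, t x * t y = t y * t x) ∧ t .a * t .d - t .b * t .c = 1 := by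
  refine ⟨fun ⟨⟨hab, hac, had, hbc, hcd, hbd⟩, hdet⟩ => ⟨fun x y => ?_, by simpa using hdet⟩,
    fun ⟨h, hdet⟩ => ⟨⟨?_, ?_, ?_, h _ _, ?_, ?_⟩, by simpa using hdet⟩⟩
  · simp only [oneParam_mu, oneParam_q, one_smul, zero_smul, sub_eq_zero] at hab hac had hcd hbd
    cases x <;> cases y <;> simp only [*]
  · simpa using h .a .b
  · simpa using h .a .c
  · simpa [sub_eq_zero] using h .a .d
  · simpa using h .c .d
  · simpa using h .b .d

theorem upperRhs_oneParam (i : Fin 3) : upperRhs (oneParam k) θ x y τ i = x * θ i := by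
  cases τ <;> fin_cases i <;> simp [upperRhs]

theorem lowerRhs_oneParam (i : Fin 3) : lowerRhs (oneParam k) θ x y τ i = y * θ i := by
  cases τ <;> fin_cases i <;> simp [lowerRhs]

theorem thetaRels_oneParam_iff :
    ThetaRels (oneParam k) θ ↔ ∀ i j, θ i * θ j = -(θ j * θ i) := by
  refine ⟨fun ⟨h00, h11, h22, h21, h10, h20⟩ i j => ?_, fun h => ?_⟩
  · simp only [oneParam_mu, oneParam_q, oneParam_qi, one_smul, zero_smul, mul_zero, zero_mul,
      one_pow] at h00 h10 h20
    fin_cases i <;> fin_cases j <;> simp [*]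
  · have sq i : θ i * θ i = 0 := by
      have : (2 : k) • (θ i * θ i) = 0 := by rw [two_smul]; exact eq_neg_iff_add_eq_zero.1 (h i i)
      simpa using this
    exact ⟨by simp [sq], sq 1, sq 2, h 2 1, by simpa using h 1 0, by simpa using h 2 0⟩

theorem formsRels_oneParam_iff : FormsRels (oneParam k) τ t θ ↔
    (∀ x i, t x * θ i = θ i * t x) ∧ ∀ i j, θ i * θ j = -(θ j * θ i) := by
  refine ⟨fun ⟨hθ, ⟨ha, hc⟩, ⟨hb, hd⟩⟩ => ⟨fun x i => ?_, thetaRels_oneParam_iff.1 hθ⟩,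
    fun ⟨h, hθ⟩ => ⟨thetaRels_oneParam_iff.2 hθ, ⟨?_, ?_⟩, ⟨?_, ?_⟩⟩⟩
  · simp only [upperRhs_oneParam, lowerRhs_oneParam] at ha hc hb hd
    cases x <;> simp only [*]
  all_goals simp only [upperRhs_oneParam, lowerRhs_oneParam, h, implies_true]

theorem aRel_iff (f : B →ₐ[k] B') :
    (∀ x y, ARel t x y → f x = f y) ↔ SLRels (oneParam k) (f ∘ t) := by
  rw [slRels_oneParam_iff]
  refine ⟨fun h => ⟨fun x y => ?_, ?_⟩, ?_⟩
  · simpa using h _ _ (.comm x y)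
  · simpa using h _ _ .det
  · rintro ⟨h, hdet⟩ _ _ (⟨x, y⟩ | _)
    exacts [by simpa using h x y, by simpa using hdet]

theorem mRel_iff (f : B →ₐ[k] B') : (∀ x y, MRel t θ x y → f x = f y) ↔
    SLRels (oneParam k) (f ∘ t) ∧ FormsRels (oneParam k) τ (f ∘ t) (f ∘ θ) := by
  rw [formsRels_oneParam_iff, ← aRel_iff]
  refine ⟨fun h => ⟨fun _ _ hxy => h _ _ (.base hxy), fun x i => ?_, fun i j => ?_⟩, ?_⟩
  · simpa using h _ _ (.tθ x i)
  · simpa using h _ _ (.θθ i j)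
  · rintro ⟨h, h', h''⟩ _ _ (hxy | ⟨x, i⟩ | ⟨i, j⟩)
    exacts [h _ _ hxy, by simpa using h' x i, by simpa using h'' i j]

variable (k)

theorem presents_tA : Presents (FunRel (oneParam k)) (tA k) :=
  presents_ringQuot fun _ _ _ f => aRel_iff f

theorem presents_gM (τ : Kind) : Presents (ExtRel (oneParam k) τ) (gM k) :=
  presents_ringQuot fun _ _ _ f => mRel_iff f

end ClassicalPresentations

/-! ### Specialization of the parameters -/

section Specialization

variable {R S : Type*} [CommRing R] [CommRing S] (P : QParam R) (φ : R →+* S) {C : Type*} [Ring C]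
  [Algebra R C] [Algebra S C] {τ : Kind} {t : TGen → C} {θ : Fin 3 → C} {x y : C}

/-- The image of deformation parameters under a ring homomorphism. -/
def QParam.map : QParam S where
  q := φ P.q
  qi := φ P.qi
  li := φ P.li
  q_mul_qi := by rw [← map_mul, P.q_mul_qi, map_one]
  add_mul_li := by rw [← map_add, ← map_mul, P.add_mul_li, map_one]

theorem QParam.map_q : (P.map φ).q = φ P.q := rfl

theorem QParam.map_qi : (P.map φ).qi = φ P.qi := rfl

theorem QParam.map_li : (P.map φ).li = φ P.li := rfl

theorem QParam.map_mu : (P.map φ).mu = φ P.mu := (map_sub φ _ _).symm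

theorem QParam.map_lam : (P.map φ).lam = φ P.lam := (map_add φ _ _).symm

variable {φ}

theorem slRels_map_iff (hφ : ∀ (r : R) (x : C), r • x = φ r • x) :
    SLRels (P.map φ) t ↔ SLRels P t := by
  have hq (x : C) : (P.map φ).q • x = P.q • x := (hφ _ x).symm
  have hmu (x : C) : (P.map φ).mu • x = P.mu • x := by rw [P.map_mu, hφ]
  constructor <;> intro h <;>
    exact ⟨⟨by simpa only [hq] using h.ab, by simpa only [hq] using h.ac,
      by simpa only [hmu] using h.ad, h.bc, by simpa only [hq] using h.cd,
      by simpa only [hq] using h.bd⟩, by simpa only [hq] using h.det⟩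

theorem thetaRels_map_iff (hφ : ∀ (r : R) (x : C), r • x = φ r • x) :
    ThetaRels (P.map φ) θ ↔ ThetaRels P θ := by
  have hsq (x : C) : ((P.map φ).q ^ 2 * (P.map φ).mu * (P.map φ).li) • x =
      (P.q ^ 2 * P.mu * P.li) • x := by
    rw [hφ, map_mul, map_mul, map_pow, P.map_q, P.map_mu, P.map_li]
  have hq (x : C) : (P.map φ).q ^ 2 • x = P.q ^ 2 • x := by rw [hφ, map_pow, P.map_q]
  have hqi (x : C) : (P.map φ).qi ^ 2 • x = P.qi ^ 2 • x := by rw [hφ (P.qi ^ 2), map_pow, P.map_qi]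
  constructor <;> intro h <;>
    exact ⟨by simpa only [hsq] using h.sq0, h.sq1, h.sq2, h.r21,
      by simpa only [hqi] using h.r10, by simpa only [hq] using h.r20⟩

theorem colRels_map_iff (hφ : ∀ (r : R) (x : C), r • x = φ r • x) :
    ColRels (P.map φ) τ θ x y ↔ ColRels P τ θ x y := by
  have upper : upperRhs (P.map φ) θ x y τ = upperRhs P θ x y τ := by
    cases τ <;> simp only [upperRhs, hφ, map_mul, map_pow, QParam.map_q, QParam.map_qi,
      QParam.map_mu, QParam.map_lam]
  have lower : lowerRhs (P.map φ) θ x y τ = lowerRhs P θ x y τ := by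
    cases τ <;> simp only [lowerRhs, hφ, map_mul, map_pow, QParam.map_q, QParam.map_qi,
      QParam.map_mu, QParam.map_lam]
  constructor <;> rintro ⟨hx, hy⟩ <;>
    exact ⟨by simpa only [upper] using hx, by simpa only [lower] using hy⟩

theorem formsRels_map_iff (hφ : ∀ (r : R) (x : C), r • x = φ r • x) :
    FormsRels (P.map φ) τ t θ ↔ FormsRels P τ t θ :=
  ⟨fun ⟨h, h₁, h₂⟩ => ⟨(thetaRels_map_iff P hφ).1 h, (colRels_map_iff P hφ).1 h₁,
    (colRels_map_iff P hφ).1 h₂⟩, fun ⟨h, h₁, h₂⟩ => ⟨(thetaRels_map_iff P hφ).2 h,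
    (colRels_map_iff P hφ).2 h₁, (colRels_map_iff P hφ).2 h₂⟩⟩

theorem qParam_map_constantCoeff (k : Type*) [Field k] [CharZero k] :
    (qParam k).map PowerSeries.constantCoeff = oneParam k := by
  ext
  · exact constantCoeff_q k
  · exact constantCoeff_q_inv k
  · simp [QParam.map, oneParam, constantCoeff_lam]

end Specialization

/-! ### Reduction modulo `h` -/

section Reduction

section Semilinear

variable {R : Type u} [CommRing R] {ι : Type}
  {Rel : ∀ (B : Type u) [Ring B] [Algebra R B], (ι → B) → Prop} {X : Type u} [Ring X] [Algebra R X]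
  {g : ι → X}

theorem Presents.exists_ringHom (h : Presents Rel g) {S B : Type u} [CommRing S] [Ring B]
    [Algebra S B] (φ : R →+* S) {t : ι → B} (ht : @Rel B _ (Algebra.compHom B φ) t) :
    ∃ f : X →+* B, (∀ (r : R) x, f (r • x) = φ r • f x) ∧ ∀ s, f (g s) = t s := by
  let _ : Algebra R B := Algebra.compHom B φ
  obtain ⟨f, hf⟩ := h.lift B t ht
  exact ⟨f, map_smul f, hf⟩

theorem Presents.ringHom_ext (h : Presents Rel g) {B : Type*} [Ring B] {f₁ f₂ : X →+* B}
    (hR : ∀ r : R, f₁ (r • 1) = f₂ (r • 1)) (hg : ∀ s, f₁ (g s) = f₂ (g s)) : f₁ = f₂ := by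
  ext x
  have hx : x ∈ Algebra.adjoin R (Set.range g) := h.adjoin_eq_top ▸ Algebra.mem_top
  induction hx using Algebra.adjoin_induction with
  | mem x hx => obtain ⟨s, rfl⟩ := hx; exact hg s
  | algebraMap r => rw [Algebra.algebraMap_eq_smul_one, hR]
  | add x y _ _ hx hy => rw [map_add, hx, hy, map_add]
  | mul x y _ _ hx hy => rw [map_mul, hx, hy, map_mul]

theorem Presents.surjective_ringHom (h : Presents Rel g) {B : Type*} [Ring B] {f : B →+* X}
    (hR : ∀ r : R, r • 1 ∈ f.range) (hg : ∀ s, g s ∈ f.range) : Function.Surjective f := by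
  intro x
  have hx : x ∈ Algebra.adjoin R (Set.range g) := h.adjoin_eq_top ▸ Algebra.mem_top
  change x ∈ f.range
  induction hx using Algebra.adjoin_induction with
  | mem x hx => obtain ⟨s, rfl⟩ := hx; exact hg s
  | algebraMap r => rw [Algebra.algebraMap_eq_smul_one]; exact hR r
  | add x y _ _ hx hy => exact add_mem hx hy
  | mul x y _ _ hx hy => exact mul_mem hx hy

end Semilinear

variable {k : Type u} [Field k]

/-- The ideal `h B` of a `k⟦h⟧`-algebra `B`. -/
def hIdeal (k : Type*) [Field k] (B : Type*) [Ring B] [Algebra k⟦X⟧ B] : Ideal B where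
  carrier := {x | ∃ y, x = (PowerSeries.X : k⟦X⟧) • y}
  add_mem' := by
    rintro _ _ ⟨x, rfl⟩ ⟨y, rfl⟩
    exact ⟨x + y, (smul_add _ _ _).symm⟩
  zero_mem' := ⟨0, (smul_zero _).symm⟩
  smul_mem' := by
    rintro c _ ⟨x, rfl⟩
    exact ⟨c * x, by simp⟩

instance (k : Type*) [Field k] (B : Type*) [Ring B] [Algebra k⟦X⟧ B] :
    (hIdeal k B).IsTwoSided where
  mul_mem_of_left := by
    rintro _ y ⟨x, rfl⟩
    exact ⟨x * y, by simp⟩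

theorem smul_eq_constantCoeff_smul {B : Type*} [Ring B] [Algebra k⟦X⟧ B] (r : k⟦X⟧)
    (x : B ⧸ hIdeal k B) :
    r • x = (PowerSeries.C (PowerSeries.constantCoeff r) : k⟦X⟧) • x := by
  obtain ⟨x, rfl⟩ := Ideal.Quotient.mkₐ_surjective k⟦X⟧ (hIdeal k B) x
  obtain ⟨s, hs⟩ : PowerSeries.X ∣ r - PowerSeries.C (PowerSeries.constantCoeff r) :=
    PowerSeries.X_dvd_iff.2 (by simp)
  rw [← map_smul, ← map_smul]
  exact Ideal.Quotient.eq.2 ⟨s • x, by rw [← sub_smul, hs, mul_smul]⟩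

variable {ι : Type} {Rh : ∀ (B : Type u) [Ring B] [Algebra k⟦X⟧ B], (ι → B) → Prop}
  {R₀ : ∀ (B : Type u) [Ring B] [Algebra k B], (ι → B) → Prop}
  {Bh B : Type u} [Ring Bh] [Algebra k⟦X⟧ Bh] [Ring B] [Algebra k B] {gh : ι → Bh} {g : ι → B}

theorem Presents.exists_isReduction (hh : Presents Rh gh) (h₀ : Presents R₀ g)
    (hmap : ∀ (C : Type u) [Ring C] [Algebra k⟦X⟧ C] (f : Bh →ₐ[k⟦X⟧] C), Rh C (f ∘ gh))
    (compat : ∀ (C : Type u) [Ring C] [Algebra k⟦X⟧ C] [Algebra k C] (t : ι → C),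
      (∀ (r : k⟦X⟧) (x : C), r • x = PowerSeries.constantCoeff r • x) → (R₀ C t ↔ Rh C t)) :
    ∃ π : Bh →ₛₗ[(PowerSeries.constantCoeff : k⟦X⟧ →+* k)] B, IsReduction π ∧
      ∀ s, π (gh s) = g s := by
  obtain ⟨π, π_smul, πg⟩ := hh.exists_ringHom (PowerSeries.constantCoeff : k⟦X⟧ →+* k)
    (@compat B _ (Algebra.compHom B _) _ g (fun _ _ => rfl) |>.1 h₀.rel)
  let mk := Ideal.Quotient.mkₐ k⟦X⟧ (hIdeal k Bh)
  obtain ⟨σ, σ_smul, σg⟩ := h₀.exists_ringHom (PowerSeries.C : k →+* k⟦X⟧)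
    (@compat _ _ _ (Algebra.compHom _ _) _ smul_eq_constantCoeff_smul |>.2 (hmap _ mk))
  have σπ : σ.comp π = mk := hh.ringHom_ext
    (fun r => by simp [π_smul, σ_smul, ← smul_eq_constantCoeff_smul]) (by simp [πg, σg])
  have surj : Function.Surjective π := h₀.surjective_ringHom
    (fun r => ⟨(PowerSeries.C r : k⟦X⟧) • 1, by simp [π_smul]⟩) fun s => ⟨gh s, πg s⟩
  refine ⟨{ toFun := π, map_add' := map_add π, map_smul' := π_smul },
    ⟨map_one π, map_mul π, surj, fun x => ⟨fun hx => ?_, ?_⟩⟩, πg⟩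
  · have hσ : σ (π x) = mk x := DFunLike.congr_fun σπ x
    exact Ideal.Quotient.eq_zero_iff_mem.1 (hσ.symm.trans ((congrArg σ hx).trans (map_zero σ)))
  · rintro ⟨y, rfl⟩
    simp

variable [CharZero k]

theorem exists_isReduction_A :
    ∃ π : Aq k →ₛₗ[(PowerSeries.constantCoeff : k⟦X⟧ →+* k)] A k, IsReduction π ∧
      ∀ x, π (tAq k x) = tA k x :=
  (presents_tAq k).exists_isReduction (presents_tA k) (fun _ _ _ f => (presents_tAq k).rel.map f)
    fun _ _ _ _ _ hC => qParam_map_constantCoeff k ▸ slRels_map_iff _ hC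

theorem exists_isReduction_M (τ : Kind) :
    ∃ π : Mq k τ →ₛₗ[(PowerSeries.constantCoeff : k⟦X⟧ →+* k)] M k, IsReduction π ∧
      ∀ s, π (gMq k τ s) = gM k s :=
  (presents_gMq k τ).exists_isReduction (presents_gM k τ)
    (fun _ _ _ f => ⟨(presents_gMq k τ).rel.1.map f, (presents_gMq k τ).rel.2.map f⟩)
    fun _ _ _ _ _ hC => qParam_map_constantCoeff k ▸
      and_congr (slRels_map_iff _ hC) (formsRels_map_iff _ hC)

end Reduction

/-! ### A basis of the function algebra -/

theorem mul_pow_of_mul_eq_smul {R A : Type*} [CommRing R] [Ring A] [Algebra R A] {x y : A} {r : R}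
    (hxy : x * y = r • (y * x)) (i : ℕ) : x * y ^ i = r ^ i • (y ^ i * x) := by
  induction i with
  | zero => simp
  | succ i ih =>
    rw [pow_succ, ← mul_assoc, ih, smul_mul_assoc, mul_assoc, hxy, mul_smul_comm, smul_smul,
      ← mul_assoc, pow_succ]

namespace FunModel

variable {R : Type*} [CommRing R]

/-- The free module on the words `bⁱ cʲ zₙ`, where `zₙ` is `aⁿ` for `n ≥ 0` and `d⁻ⁿ` for `n ≤ 0`.
It carries the regular representation of the function algebra. -/
abbrev V (R : Type*) [CommRing R] := (ℕ × ℕ × ℤ) →₀ R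

/-- The basis vector `bⁱ cʲ zₙ` of `V`. -/
abbrev e (R : Type*) [CommRing R] (i j : ℕ) (n : ℤ) : V R := Finsupp.single (i, j, n) 1

theorem hom_ext {W : Type*} [AddCommGroup W] [Module R W] {f g : V R →ₗ[R] W}
    (h : ∀ i j n, f (e R i j n) = g (e R i j n)) : f = g :=
  Finsupp.lhom_ext' fun ⟨i, j, n⟩ => LinearMap.ext_ring (h i j n)

section Representation

variable (P : QParam R)

/-- The coefficient `α` in `a zₙ = (1 + α b c) zₙ₊₁`. -/
def up (n : ℤ) : R := if 0 ≤ n then 0 else P.q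

/-- The coefficient `δ` in `d zₙ = (1 + δ b c) zₙ₋₁`. -/
def down (n : ℤ) : R := if n ≤ 0 then 0 else P.qi

theorem up_add_down (n : ℤ) : up P (n - 1) + P.q ^ 2 * down P n = P.q := by
  have := P.q_mul_qi
  unfold up down
  split_ifs <;> first | omega | linear_combination P.q * this | simp

theorem up_mul_down (n : ℤ) : up P (n - 1) * down P n = 0 := by
  unfold up down
  split_ifs <;> first | omega | simp

theorem down_add_up (n : ℤ) : down P (n + 1) + P.qi ^ 2 * up P n = P.qi := by
  have := P.q_mul_qi
  unfold up down
  split_ifs <;> first | omega | linear_combination P.qi * this | simp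

theorem down_mul_up (n : ℤ) : down P (n + 1) * up P n = 0 := by
  unfold up down
  split_ifs <;> first | omega | simp

/-- Left multiplication by the matrix entries on `V`. -/
def op : TGen → Module.End R (V R)
  | .a => Finsupp.linearCombination R fun (i, j, n) => P.q ^ (i + j) •
      (e R i j (n + 1) + up P n • e R (i + 1) (j + 1) (n + 1))
  | .b => Finsupp.linearCombination R fun (i, j, n) => e R (i + 1) j n
  | .c => Finsupp.linearCombination R fun (i, j, n) => e R i (j + 1) n
  | .d => Finsupp.linearCombination R fun (i, j, n) => P.qi ^ (i + j) •
      (e R i j (n - 1) + down P n • e R (i + 1) (j + 1) (n - 1))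

theorem op_a (i j : ℕ) (n : ℤ) : op P .a (e R i j n) =
    P.q ^ (i + j) • (e R i j (n + 1) + up P n • e R (i + 1) (j + 1) (n + 1)) := by
  simp only [op, Finsupp.linearCombination_single, one_smul]

theorem op_b (i j : ℕ) (n : ℤ) : op P .b (e R i j n) = e R (i + 1) j n := by
  simp only [op, Finsupp.linearCombination_single, one_smul]

theorem op_c (i j : ℕ) (n : ℤ) : op P .c (e R i j n) = e R i (j + 1) n := by
  simp only [op, Finsupp.linearCombination_single, one_smul]

theorem op_d (i j : ℕ) (n : ℤ) : op P .d (e R i j n) =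
    P.qi ^ (i + j) • (e R i j (n - 1) + down P n • e R (i + 1) (j + 1) (n - 1)) := by
  simp only [op, Finsupp.linearCombination_single, one_smul]

theorem op_a_op_d (i j : ℕ) (n : ℤ) :
    op P .a (op P .d (e R i j n)) = e R i j n + P.q • e R (i + 1) (j + 1) n := by
  have hpow : P.q ^ (i + j) * P.qi ^ (i + j) = 1 := by rw [← mul_pow, P.q_mul_qi, one_pow]
  have hadd := up_add_down P n
  have hmul := up_mul_down P n
  simp only [op_d, map_smul, map_add, op_a, sub_add_cancel]
  match_scalars <;> grind

theorem op_d_op_a (i j : ℕ) (n : ℤ) :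
    op P .d (op P .a (e R i j n)) = e R i j n + P.qi • e R (i + 1) (j + 1) n := by
  have hpow : P.q ^ (i + j) * P.qi ^ (i + j) = 1 := by rw [← mul_pow, P.q_mul_qi, one_pow]
  have hadd := down_add_up P n
  have hmul := down_mul_up P n
  simp only [op_d, map_smul, map_add, op_a, add_sub_cancel_right]
  match_scalars <;> grind

theorem slRels_op : SLRels P (op P) := by
  have hq := P.q_mul_qi
  refine ⟨⟨?_, ?_, ?_, ?_, ?_, ?_⟩, ?_⟩ <;> refine hom_ext fun i j n => ?_ <;>
    simp only [Module.End.mul_apply, LinearMap.smul_apply, LinearMap.sub_apply,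
      Module.End.one_apply, op_a_op_d, op_d_op_a] <;>
    simp only [op_a, op_b, op_c, op_d, map_smul, map_add, QParam.mu] <;>
    match_scalars <;> grind

end Representation

section Words

variable {A : Type*} [Ring A] [Algebra R A] (t : TGen → A)

/-- The elements `zₙ`, equal to `aⁿ` for `n ≥ 0` and to `d⁻ⁿ` for `n ≤ 0`. -/
def z (n : ℤ) : A := if 0 ≤ n then t .a ^ n.toNat else t .d ^ (-n).toNat

/-- The linear map which sends the basis vectors of `V` to the words `bⁱ cʲ zₙ` in an algebra. -/
def word : V R →ₗ[R] A :=
  Finsupp.linearCombination R fun (i, j, n) => t .b ^ i * t .c ^ j * z t n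

theorem word_e (i j : ℕ) (n : ℤ) : word t (e R i j n) = t .b ^ i * t .c ^ j * z t n := by
  simp [word]

theorem z_natCast (m : ℕ) : z t (m : ℤ) = t .a ^ m := by
  simp [z]

theorem z_neg_natCast (m : ℕ) : z t (-(m : ℤ)) = t .d ^ m := by
  obtain rfl | hm := Nat.eq_zero_or_pos m
  · simp [z]
  · rw [z, if_neg (by omega), neg_neg, Int.toNat_natCast]

variable {t} {P : QParam R}

theorem a_mul_z (h : SLRels P t) (n : ℤ) :
    t .a * z t n = z t (n + 1) + up P n • (t .b * t .c * z t (n + 1)) := by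
  obtain ⟨m, rfl⟩ | ⟨m, rfl⟩ : (∃ m : ℕ, n = m) ∨ ∃ m : ℕ, n = -((m + 1 : ℕ) : ℤ) := by
    obtain h | h := le_or_gt 0 n
    · exact .inl ⟨n.toNat, by omega⟩
    · exact .inr ⟨(-n - 1).toNat, by omega⟩
  · rw [up, if_pos (by omega), ← Nat.cast_succ, z_natCast, z_natCast, pow_succ', zero_smul,
      add_zero]
  · rw [up, if_neg (by omega), show -((m + 1 : ℕ) : ℤ) + 1 = -(m : ℤ) by push_cast; ring,
      z_neg_natCast, z_neg_natCast, pow_succ', ← mul_assoc, h.mul_ad, add_mul, one_mul,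
      smul_mul_assoc]

theorem d_mul_z (h : SLRels P t) (n : ℤ) :
    t .d * z t n = z t (n - 1) + down P n • (t .b * t .c * z t (n - 1)) := by
  obtain ⟨m, rfl⟩ | ⟨m, rfl⟩ : (∃ m : ℕ, n = -m) ∨ ∃ m : ℕ, n = (m + 1 : ℕ) := by
    obtain h | h := le_or_gt n 0
    · exact .inl ⟨(-n).toNat, by omega⟩
    · exact .inr ⟨(n - 1).toNat, by omega⟩
  · rw [down, if_pos (by omega), show -(m : ℤ) - 1 = -((m + 1 : ℕ) : ℤ) by push_cast; ring,
      z_neg_natCast, z_neg_natCast, pow_succ', zero_smul, add_zero]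
  · rw [down, if_neg (by omega), show ((m + 1 : ℕ) : ℤ) - 1 = m by push_cast; ring, z_natCast,
      z_natCast, pow_succ', ← mul_assoc, h.mul_da, add_mul, one_mul, smul_mul_assoc]

theorem mul_pow_mul_pow_mul {x : A} {r : R} (hb : x * t .b = r • (t .b * x))
    (hc : x * t .c = r • (t .c * x)) (i j : ℕ) (w : A) :
    x * (t .b ^ i * t .c ^ j * w) = r ^ (i + j) • (t .b ^ i * t .c ^ j * (x * w)) := by
  rw [← mul_assoc, ← mul_assoc, mul_pow_of_mul_eq_smul hb, smul_mul_assoc, mul_assoc _ x,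
    mul_pow_of_mul_eq_smul hc, mul_smul_comm, smul_smul, ← pow_add, smul_mul_assoc]
  simp only [mul_assoc]

theorem pow_mul_pow_mul_mul (h : SLRels P t) (i j : ℕ) (w : A) :
    t .b ^ i * t .c ^ j * (t .b * t .c * w) = t .b ^ (i + 1) * t .c ^ (j + 1) * w := by
  have hcb : t .c ^ j * t .b = t .b * t .c ^ j := Commute.pow_left h.bc.symm j
  rw [pow_succ, pow_succ]
  simp only [mul_assoc]
  rw [← mul_assoc (t .c ^ j), hcb, mul_assoc]

theorem word_op (h : SLRels P t) (x : TGen) (v : V R) : word t (op P x v) = t x * word t v := by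
  suffices (word t).comp (op P x) = (LinearMap.mulLeft R (t x)).comp (word t) from
    LinearMap.congr_fun this v
  refine hom_ext fun i j n => ?_
  rw [LinearMap.comp_apply, LinearMap.comp_apply, LinearMap.mulLeft_apply, word_e]
  cases x
  · rw [mul_pow_mul_pow_mul h.ab h.ac, op_a, map_smul, map_add, map_smul, word_e, word_e, a_mul_z h,
      mul_add, mul_smul_comm, pow_mul_pow_mul_mul h]
  · rw [op_b, word_e, pow_succ', mul_assoc, mul_assoc, mul_assoc]
  · have hcb : t .c * t .b ^ i = t .b ^ i * t .c := Commute.pow_right h.bc.symm i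
    rw [op_c, word_e, pow_succ', ← mul_assoc, ← mul_assoc, ← mul_assoc, hcb]
  · rw [mul_pow_mul_pow_mul (P.eq_qi_smul h.bd) (P.eq_qi_smul h.cd), op_d, map_smul, map_add,
      map_smul, word_e, word_e, d_mul_z h, mul_add, mul_smul_comm, pow_mul_pow_mul_mul h]

variable (P)

theorem op_a_pow (m : ℕ) : (op P .a ^ m) (e R 0 0 0) = e R 0 0 m := by
  induction m with
  | zero => rfl
  | succ m ih => rw [pow_succ', Module.End.mul_apply, ih, op_a, up, if_pos (by omega)]; simp

theorem op_d_pow (m : ℕ) : (op P .d ^ m) (e R 0 0 0) = e R 0 0 (-m) := by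
  induction m with
  | zero => rfl
  | succ m ih =>
    rw [pow_succ', Module.End.mul_apply, ih, op_d, down, if_pos (by omega)]
    simp [sub_eq_add_neg, add_comm]

theorem z_op (n : ℤ) : z (op P) n (e R 0 0 0) = e R 0 0 n := by
  obtain ⟨m, rfl | rfl⟩ := n.eq_nat_or_neg
  · rw [z_natCast, op_a_pow]
  · rw [z_neg_natCast, op_d_pow]

theorem op_b_pow (i i' j : ℕ) (n : ℤ) : (op P .b ^ i) (e R i' j n) = e R (i' + i) j n := by
  induction i with
  | zero => rfl
  | succ i ih => rw [pow_succ', Module.End.mul_apply, ih, op_b, add_assoc]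

theorem op_c_pow (j i j' : ℕ) (n : ℤ) : (op P .c ^ j) (e R i j' n) = e R i (j' + j) n := by
  induction j with
  | zero => rfl
  | succ j ih => rw [pow_succ', Module.End.mul_apply, ih, op_c, add_assoc]

theorem word_op_apply (i j : ℕ) (n : ℤ) : word (op P) (e R i j n) (e R 0 0 0) = e R i j n := by
  rw [word_e, Module.End.mul_apply, Module.End.mul_apply, z_op, op_c_pow, op_b_pow, zero_add,
    zero_add]

theorem map_word {B : Type*} [Ring B] [Algebra R B] (f : A →ₐ[R] B) (v : V R) :
    f (word t v) = word (f ∘ t) v := by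
  suffices f.toLinearMap.comp (word t) = word (f ∘ t) from LinearMap.congr_fun this v
  refine hom_ext fun i j n => ?_
  simp only [LinearMap.comp_apply, word_e, AlgHom.toLinearMap_apply, map_mul, map_pow, z]
  split_ifs <;> simp

end Words

end FunModel

open FunModel in
theorem Presents.free_of_funRel {R : Type u} [CommRing R] {P : QParam R} {A : Type u} [Ring A]
    [Algebra R A] {t : TGen → A} (hA : Presents (FunRel P) t) : Module.Free R A := by
  obtain ⟨ρ, hρ⟩ := hA.lift _ (op P) (slRels_op P)
  have word_ρ (x : A) : ∀ v, word t (ρ x v) = x * word t v := by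
    have hx : x ∈ Algebra.adjoin R (Set.range t) := hA.adjoin_eq_top ▸ Algebra.mem_top
    induction hx using Algebra.adjoin_induction with
    | mem x hx => obtain ⟨s, rfl⟩ := hx; rw [hρ]; exact word_op hA.rel s
    | algebraMap r => simp [Algebra.algebraMap_eq_smul_one]
    | add x y _ _ hx hy => simp [hx, hy, add_mul]
    | mul x y _ _ hx hy => simp [hx, hy, mul_assoc]
  refine Module.Free.of_equiv (LinearEquiv.ofLinearMap (word t)
    ((LinearMap.applyₗ (R := R) (e R 0 0 0)).comp ρ.toLinearMap) ?_ ?_)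
  · ext x
    simpa [word_e, z] using word_ρ x (e R 0 0 0)
  · refine FunModel.hom_ext fun i j n => ?_
    change ρ (word t (e R i j n)) (e R 0 0 0) = e R i j n
    rw [map_word (B := Module.End R (V R)) ρ, show ρ ∘ t = op P from funext hρ, word_op_apply]

/-! ### Normal forms in the external algebra -/

namespace ExtModel

variable {R : Type*} [CommRing R] (P : QParam R) {A : Type*} [Ring A] [Algebra R A]

/-- Linear combinations of the monomials `1, θ⁰, θ¹, θ², θ⁰θ¹, θ⁰θ², θ¹θ², θ⁰θ¹θ²`, in this order,
with coefficients in `A` on the left. The external algebra acts on them from the right. -/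
abbrev W (A : Type*) := Fin 8 → A

/-- The coefficients of the monomial `1`. -/
abbrev one (A : Type*) [Ring A] : W A := ![1, 0, 0, 0, 0, 0, 0, 0]

/-- Right multiplication by an element of `A` which commutes with the one-forms up to powers
of `q`. -/
def diag (x : A) : Module.End A (W A) where
  toFun v := ![v 0 * x, v 1 * x, P.q • (v 2 * x), P.qi • (v 3 * x), P.q • (v 4 * x),
    P.qi • (v 5 * x), v 6 * x, v 7 * x]
  map_add' v w := by ext J; fin_cases J <;> simp [add_mul]
  map_smul' f v := by ext J; fin_cases J <;> simp [mul_assoc]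

/-- Right multiplication by the upper entry of a column `(x, y)`, for type I. -/
def upperI (x y : A) : Module.End A (W A) where
  toFun v := ![v 0 * x, v 1 * x - (P.mu * P.lam) • (v 3 * y),
    P.qi • (v 2 * x) + (P.q ^ 2 * P.mu) • (v 1 * y), P.q • (v 3 * x),
    P.qi • (v 4 * x) + (P.mu * P.lam * P.qi) • (v 6 * y), P.q • (v 5 * x),
    v 6 * x + (P.q * P.mu) • (v 5 * y), v 7 * x]
  map_add' v w := by ext J; fin_cases J <;> simp [add_mul] <;> abel
  map_smul' f v := by ext J; fin_cases J <;> simp [mul_assoc, mul_add, mul_sub]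

/-- Right multiplication by the lower entry of a column `(x, y)`, for type II. -/
def lowerII (x y : A) : Module.End A (W A) where
  toFun v := ![v 0 * y, v 1 * y - (P.mu * P.lam * P.qi ^ 2) • (v 2 * x), P.qi • (v 2 * y),
    P.q • (v 3 * y) + P.mu • (v 1 * x), P.qi • (v 4 * y),
    P.q • (v 5 * y) - (P.mu * P.lam * P.qi) • (v 6 * x),
    v 6 * y - (P.q * P.mu) • (v 4 * x), v 7 * y]
  map_add' v w := by ext J; fin_cases J <;> simp [add_mul] <;> abel
  map_smul' f v := by ext J; fin_cases J <;> simp [mul_assoc, mul_add, mul_sub]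

/-- Right multiplication by `θ⁰`. -/
def theta0 : Module.End A (W A) where
  toFun v := ![0, v 0, 0, 0, -(P.qi ^ 2 • v 2), -(P.q ^ 2 • v 3), (P.q ^ 2 * P.mu * P.li) • v 1,
    v 6]
  map_add' v w := by ext J; fin_cases J <;> simp [add_comm]
  map_smul' f v := by ext J; fin_cases J <;> simp

/-- Right multiplication by `θ¹`. -/
def theta1 : Module.End A (W A) where
  toFun v := ![0, 0, v 0, 0, v 1, 0, -v 3, -v 5]
  map_add' v w := by ext J; fin_cases J <;> simp [add_comm]
  map_smul' f v := by ext J; fin_cases J <;> simp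

/-- Right multiplication by `θ²`. -/
def theta2 : Module.End A (W A) where
  toFun v := ![0, 0, 0, v 0, 0, v 1, v 2, v 4]
  map_add' v w := by ext J; fin_cases J <;> simp
  map_smul' f v := by ext J; fin_cases J <;> simp

/-- Right multiplication by the upper entry of a column `(x, y)`. -/
def upperOp (x y : A) : Kind → Module.End A (W A)
  | .I => upperI P x y
  | .II => diag P x

/-- Right multiplication by the lower entry of a column `(x, y)`. -/
def lowerOp (x y : A) : Kind → Module.End A (W A)
  | .I => diag P y
  | .II => lowerII P x y

/-- Right multiplication by the matrix entries. -/
def opT (t : TGen → A) (τ : Kind) : TGen → Module.End A (W A)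
  | .a => upperOp P (t .a) (t .c) τ
  | .b => upperOp P (t .b) (t .d) τ
  | .c => lowerOp P (t .a) (t .c) τ
  | .d => lowerOp P (t .b) (t .d) τ

/-- Right multiplication by the one-forms. -/
def opTheta : Fin 3 → Module.End A (W A) := ![theta0 P, theta1, theta2]

variable {P}

theorem diag_apply (x : A) (v : W A) : diag P x v =
    ![v 0 * x, v 1 * x, P.q • (v 2 * x), P.qi • (v 3 * x), P.q • (v 4 * x),
      P.qi • (v 5 * x), v 6 * x, v 7 * x] := rfl

theorem upperI_apply (x y : A) (v : W A) : upperI P x y v =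
    ![v 0 * x, v 1 * x - (P.mu * P.lam) • (v 3 * y),
      P.qi • (v 2 * x) + (P.q ^ 2 * P.mu) • (v 1 * y), P.q • (v 3 * x),
      P.qi • (v 4 * x) + (P.mu * P.lam * P.qi) • (v 6 * y), P.q • (v 5 * x),
      v 6 * x + (P.q * P.mu) • (v 5 * y), v 7 * x] := rfl

theorem lowerII_apply (x y : A) (v : W A) : lowerII P x y v =
    ![v 0 * y, v 1 * y - (P.mu * P.lam * P.qi ^ 2) • (v 2 * x), P.qi • (v 2 * y),
      P.q • (v 3 * y) + P.mu • (v 1 * x), P.qi • (v 4 * y),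
      P.q • (v 5 * y) - (P.mu * P.lam * P.qi) • (v 6 * x),
      v 6 * y - (P.q * P.mu) • (v 4 * x), v 7 * y] := rfl

theorem theta0_apply (v : W A) : theta0 P v =
    ![0, v 0, 0, 0, -(P.qi ^ 2 • v 2), -(P.q ^ 2 • v 3), (P.q ^ 2 * P.mu * P.li) • v 1, v 6] := rfl

theorem theta1_apply (v : W A) : theta1 v = ![0, 0, v 0, 0, v 1, 0, -v 3, -v 5] := rfl

theorem theta2_apply (v : W A) : theta2 v = ![0, 0, 0, v 0, 0, v 1, v 2, v 4] := rfl

variable {x y : A} {t : TGen → A} {τ : Kind}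

theorem thetaRels_op : ThetaRels P (MulOpposite.op ∘ opTheta (A := A) P) := by
  have hq := P.q_mul_qi
  have hq' : P.qi * P.q = 1 := (mul_comm _ _).trans hq
  constructor <;> refine MulOpposite.unop_injective (LinearMap.ext fun v => ?_) <;>
  simp only [opTheta, Function.comp_apply, Matrix.cons_val, MulOpposite.unop_mul,
    MulOpposite.unop_op, Module.End.mul_apply, MulOpposite.unop_smul, MulOpposite.unop_neg,
    MulOpposite.unop_zero, LinearMap.smul_apply, LinearMap.neg_apply, LinearMap.zero_apply,
    theta0_apply, theta1_apply, theta2_apply] <;>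
  ext J <;> fin_cases J <;> simp [smul_smul, ← mul_pow, hq, hq']

theorem opTheta_comp_upper (i : Fin 3) :
    MulOpposite.op (opTheta (A := A) P i) * MulOpposite.op (upperOp P x y τ) =
      upperRhs P (MulOpposite.op ∘ opTheta P) (MulOpposite.op (upperOp P x y τ))
        (MulOpposite.op (lowerOp P x y τ)) τ i := by
  have hq := P.q_mul_qi
  have hl := P.add_mul_li
  cases τ <;> fin_cases i <;>
  refine MulOpposite.unop_injective (LinearMap.ext fun v => funext fun J => ?_) <;>
  fin_cases J <;>
  simp only [opTheta, upperOp, lowerOp, upperRhs, Function.comp_apply, Fin.zero_eta, Fin.mk_one,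
    Fin.reduceFinMk, Matrix.cons_val, MulOpposite.unop_mul, MulOpposite.unop_op,
    MulOpposite.unop_add, Module.End.mul_apply, MulOpposite.unop_smul, MulOpposite.unop_sub,
    LinearMap.add_apply, LinearMap.smul_apply, LinearMap.sub_apply, diag_apply, upperI_apply,
    theta0_apply, theta1_apply, theta2_apply, Pi.smul_apply, Pi.sub_apply, Pi.add_apply,
    smul_mul_assoc, zero_mul, neg_mul, smul_add, smul_sub, smul_zero, smul_neg] <;>
  match_scalars <;> grind [QParam.mu, QParam.lam]

theorem opTheta_comp_lower (i : Fin 3) :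
    MulOpposite.op (opTheta (A := A) P i) * MulOpposite.op (lowerOp P x y τ) =
      lowerRhs P (MulOpposite.op ∘ opTheta P) (MulOpposite.op (upperOp P x y τ))
        (MulOpposite.op (lowerOp P x y τ)) τ i := by
  have hq := P.q_mul_qi
  have hl := P.add_mul_li
  cases τ <;> fin_cases i <;>
  refine MulOpposite.unop_injective (LinearMap.ext fun v => funext fun J => ?_) <;>
  fin_cases J <;>
  simp only [opTheta, upperOp, lowerOp, lowerRhs, Function.comp_apply, Fin.zero_eta, Fin.mk_one,
    Fin.reduceFinMk, Matrix.cons_val, MulOpposite.unop_mul, MulOpposite.unop_op,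
    MulOpposite.unop_add, Module.End.mul_apply, MulOpposite.unop_smul, MulOpposite.unop_sub,
    LinearMap.add_apply, LinearMap.smul_apply, LinearMap.sub_apply, diag_apply, lowerII_apply,
    theta0_apply, theta1_apply, theta2_apply, Pi.smul_apply, Pi.sub_apply, Pi.add_apply,
    smul_mul_assoc, zero_mul, neg_mul, smul_add, smul_sub, smul_zero, smul_neg] <;>
  match_scalars <;> grind [QParam.mu, QParam.lam]

theorem formsRels_op (t : TGen → A) (τ : Kind) :
    FormsRels P τ (MulOpposite.op ∘ opT P t τ) (MulOpposite.op ∘ opTheta P) where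
  toThetaRels := thetaRels_op
  ac := ⟨opTheta_comp_upper, opTheta_comp_lower⟩
  bd := ⟨opTheta_comp_upper, opTheta_comp_lower⟩

theorem upperOp_comp_lowerOp (h : x * y = P.q • (y * x)) (τ : Kind) :
    MulOpposite.op (upperOp P x y τ) * MulOpposite.op (lowerOp P x y τ) =
      P.q • (MulOpposite.op (lowerOp P x y τ) * MulOpposite.op (upperOp P x y τ)) := by
  have hq := P.q_mul_qi
  cases τ <;>
  refine MulOpposite.unop_injective (LinearMap.ext fun v => funext fun J => ?_) <;>
  fin_cases J <;>
  simp only [upperOp, lowerOp, MulOpposite.unop_mul, MulOpposite.unop_op, Module.End.mul_apply,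
    MulOpposite.unop_smul, LinearMap.smul_apply, diag_apply, upperI_apply, lowerII_apply,
    Pi.smul_apply, Fin.zero_eta, Fin.mk_one, Fin.reduceFinMk, Matrix.cons_val, smul_mul_assoc,
    mul_smul_comm, add_mul, sub_mul, mul_assoc, h, smul_add, smul_sub] <;>
  match_scalars <;> grind [QParam.mu, QParam.lam]

theorem opT_ad (ht : SLRels P t) (τ : Kind) :
    MulOpposite.op (opT P t τ .a) * MulOpposite.op (opT P t τ .d) -
        MulOpposite.op (opT P t τ .d) * MulOpposite.op (opT P t τ .a) =
      P.mu • (MulOpposite.op (opT P t τ .b) * MulOpposite.op (opT P t τ .c)) := by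
  have hq := P.q_mul_qi
  cases τ <;>
  refine MulOpposite.unop_injective (LinearMap.ext fun v => funext fun J => ?_) <;>
  fin_cases J <;>
  simp only [opT, upperOp, lowerOp, MulOpposite.unop_mul, MulOpposite.unop_op, Module.End.mul_apply,
    MulOpposite.unop_smul, MulOpposite.unop_sub, LinearMap.smul_apply, LinearMap.sub_apply,
    diag_apply, upperI_apply, lowerII_apply, Pi.smul_apply, Pi.sub_apply, Fin.zero_eta, Fin.mk_one,
    Fin.reduceFinMk, Matrix.cons_val, smul_mul_assoc, mul_smul_comm, add_mul, sub_mul, mul_assoc,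
    ht.mul_eq_normal, mul_add, mul_one, smul_add, smul_sub] <;>
  match_scalars <;> grind [QParam.mu, QParam.lam]

theorem matRels_op (ht : SLRels P t) (τ : Kind) : MatRels P (MulOpposite.op ∘ opT P t τ) := by
  have hq := P.q_mul_qi
  refine ⟨?ab, upperOp_comp_lowerOp ht.ac τ, opT_ad ht τ, ?bc, ?cd, upperOp_comp_lowerOp ht.bd τ⟩
  all_goals cases τ <;>
  refine MulOpposite.unop_injective (LinearMap.ext fun v => funext fun J => ?_) <;>
  fin_cases J <;>
  simp only [opT, Function.comp_apply, upperOp, lowerOp, MulOpposite.unop_mul, MulOpposite.unop_op,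
    Module.End.mul_apply, MulOpposite.unop_smul, LinearMap.smul_apply, diag_apply, upperI_apply,
    lowerII_apply, Pi.smul_apply, Fin.zero_eta, Fin.mk_one, Fin.reduceFinMk, Matrix.cons_val,
    smul_mul_assoc, mul_smul_comm, add_mul, sub_mul, mul_assoc, ht.mul_eq_normal, mul_add, mul_one,
    smul_add, smul_sub] <;>
  match_scalars <;> grind [QParam.mu, QParam.lam]

theorem slRels_op (ht : SLRels P t) (τ : Kind) : SLRels P (MulOpposite.op ∘ opT P t τ) where
  toMatRels := matRels_op ht τ
  det := by
    have hq := P.q_mul_qi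
    cases τ <;>
    refine MulOpposite.unop_injective (LinearMap.ext fun v => funext fun J => ?_) <;>
    fin_cases J <;>
    simp only [opT, upperOp, lowerOp, Function.comp_apply, MulOpposite.unop_mul,
      MulOpposite.unop_op, Module.End.mul_apply, MulOpposite.unop_smul, MulOpposite.unop_sub,
      MulOpposite.unop_one, LinearMap.smul_apply, LinearMap.sub_apply, Module.End.one_apply,
      diag_apply, upperI_apply, lowerII_apply, Pi.smul_apply, Pi.sub_apply, Fin.zero_eta,
      Fin.mk_one, Fin.reduceFinMk, Matrix.cons_val, smul_mul_assoc, mul_smul_comm, add_mul, sub_mul,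
      mul_assoc, ht.mul_eq_normal, mul_add, mul_one, smul_add, smul_sub] <;>
    match_scalars <;> grind [QParam.mu, QParam.lam]

section Form

variable {M : Type*} [Ring M] [Algebra R M] (incl : A →ₐ[R] M) (θ : Fin 3 → M)

/-- The element of the external algebra with given coefficients. -/
def form : W A →ₗ[R] M where
  toFun v := incl (v 0) + incl (v 1) * θ 0 + incl (v 2) * θ 1 + incl (v 3) * θ 2 +
    incl (v 4) * (θ 0 * θ 1) + incl (v 5) * (θ 0 * θ 2) + incl (v 6) * (θ 1 * θ 2) +
    incl (v 7) * (θ 0 * (θ 1 * θ 2))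
  map_add' v w := by simp only [Pi.add_apply, map_add, add_mul]; abel
  map_smul' r v := by simp [smul_add]

variable {incl θ}

theorem form_apply (v : W A) : form incl θ v =
    incl (v 0) + incl (v 1) * θ 0 + incl (v 2) * θ 1 + incl (v 3) * θ 2 +
    incl (v 4) * (θ 0 * θ 1) + incl (v 5) * (θ 0 * θ 2) + incl (v 6) * (θ 1 * θ 2) +
    incl (v 7) * (θ 0 * (θ 1 * θ 2)) := rfl

theorem form_upperOp (hθ : ThetaRels P θ) (h : ColRels P τ θ (incl x) (incl y)) (v : W A) :
    form incl θ (upperOp P x y τ v) = form incl θ v * incl x := by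
  have hq := P.q_mul_qi
  have hl := P.add_mul_li
  have hu := h.upper
  have hu' := fun i => mul_mul_of_eq (hu i)
  have hlo' := fun i => mul_mul_of_eq (h.lower i)
  obtain ⟨h00, h11, -, h21, h10, -⟩ := hθ
  cases τ <;>
  simp only [upperOp, form_apply, diag_apply, upperI_apply, Matrix.cons_val, map_add, map_sub,
    map_smul, map_mul, add_mul, sub_mul, mul_assoc, hu, hu', hlo', upperRhs, lowerRhs, mul_add,
    mul_sub, smul_mul_assoc, mul_smul_comm, h00, h11, h21, h10, mul_mul_of_eq h00,
    mul_mul_of_eq h11, mul_neg, smul_add, smul_neg, mul_zero, zero_mul, smul_zero] <;>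
  match_scalars <;> grind [QParam.mu, QParam.lam]

theorem form_lowerOp (hθ : ThetaRels P θ) (h : ColRels P τ θ (incl x) (incl y)) (v : W A) :
    form incl θ (lowerOp P x y τ v) = form incl θ v * incl y := by
  have hq := P.q_mul_qi
  have hl := P.add_mul_li
  have hlo := h.lower
  have hlo' := fun i => mul_mul_of_eq (hlo i)
  have hu' := fun i => mul_mul_of_eq (h.upper i)
  obtain ⟨h00, -, h22, h21, -, -⟩ := hθ
  cases τ <;>
  simp only [lowerOp, form_apply, diag_apply, lowerII_apply, Matrix.cons_val, map_add, map_sub,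
    map_smul, map_mul, add_mul, sub_mul, mul_assoc, hlo, hlo', hu', upperRhs, lowerRhs, mul_add,
    mul_sub, smul_mul_assoc, mul_smul_comm, h00, h22, h21, mul_mul_of_eq h00, mul_mul_of_eq h21,
    neg_mul, mul_neg, smul_add, smul_sub, smul_neg, mul_zero, smul_zero] <;>
  match_scalars <;> grind [QParam.mu, QParam.lam]

theorem form_opT (h : FormsRels P τ (incl ∘ t) θ) (x : TGen) (v : W A) :
    form incl θ (opT P t τ x v) = form incl θ v * incl (t x) := by
  cases x
  exacts [form_upperOp h.toThetaRels h.ac v, form_upperOp h.toThetaRels h.bd v,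
    form_lowerOp h.toThetaRels h.ac v, form_lowerOp h.toThetaRels h.bd v]

theorem form_opTheta (h : ThetaRels P θ) (i : Fin 3) (v : W A) :
    form incl θ (opTheta P i v) = form incl θ v * θ i := by
  have hq := P.q_mul_qi
  obtain ⟨h00, h11, h22, h21, h10, h20⟩ := h
  fin_cases i <;>
  simp only [opTheta, form_apply, theta0_apply, theta1_apply, theta2_apply, Fin.zero_eta,
    Fin.mk_one, Fin.reduceFinMk, Matrix.cons_val, map_neg, map_zero, map_smul, add_mul, mul_assoc,
    smul_mul_assoc, mul_smul_comm, h00, h11, h22, h21, h10, h20, mul_mul_of_eq h00,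
    mul_mul_of_eq h11, mul_mul_of_eq h21, mul_mul_of_eq h10, neg_mul, mul_neg, smul_neg, mul_zero,
    zero_mul, smul_zero, neg_neg] <;>
  match_scalars <;> grind

end Form

end ExtModel

section Freeness

open ExtModel

variable {R : Type u} [CommRing R] {P : QParam R} {τ : Kind} {A M : Type u} [Ring A] [Algebra R A]
  [Ring M] [Algebra R M] {t : TGen → A} {g : Gen → M} {incl : A →ₐ[R] M}
  {ρ : M →ₐ[R] (Module.End A (W A))ᵐᵒᵖ}

theorem form_unop_apply (hM : Presents (ExtRel P τ) g) (hincl : ∀ x, incl (t x) = g (.t x))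
    (hρt : ∀ x, ρ (g (.t x)) = MulOpposite.op (opT P t τ x))
    (hρθ : ∀ i, ρ (g (.θ i)) = MulOpposite.op (opTheta P i)) (x : M) (v : W A) :
    form incl (g ∘ .θ) ((ρ x).unop v) = form incl (g ∘ .θ) v * x := by
  have hforms : FormsRels P τ (incl ∘ t) (g ∘ .θ) := by
    simpa only [show incl ∘ t = g ∘ .t from funext hincl] using hM.rel.2
  have hx : x ∈ Algebra.adjoin R (Set.range g) := hM.adjoin_eq_top ▸ Algebra.mem_top
  induction hx using Algebra.adjoin_induction generalizing v with
  | mem x hx =>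
    obtain ⟨x | i, rfl⟩ := hx
    · rw [hρt, ← hincl]
      exact form_opT hforms x v
    · rw [hρθ]
      exact form_opTheta hforms.toThetaRels i v
  | algebraMap r => simp [Algebra.algebraMap_eq_smul_one]
  | add x y _ _ hx hy => simp [hx, hy, mul_add]
  | mul x y _ _ hx hy => simp [hx, hy, mul_assoc]

theorem unop_incl_apply_one (hA : Presents (FunRel P) t) (hincl : ∀ x, incl (t x) = g (.t x))
    (hρt : ∀ x, ρ (g (.t x)) = MulOpposite.op (opT P t τ x)) (f : A) :
    (ρ (incl f)).unop (one A) = f • one A := by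
  have hf : f ∈ Algebra.adjoin R (Set.range t) := hA.adjoin_eq_top ▸ Algebra.mem_top
  induction hf using Algebra.adjoin_induction with
  | mem x hx =>
    obtain ⟨x, rfl⟩ := hx
    rw [hincl, hρt]
    ext J
    cases τ <;> cases x <;> fin_cases J <;>
      simp [opT, upperOp, lowerOp, diag_apply, upperI_apply, lowerII_apply]
  | algebraMap r => simp [Algebra.algebraMap_eq_smul_one]
  | add x y _ _ hx hy => simp only [map_add, MulOpposite.unop_add, LinearMap.add_apply, hx, hy,
      add_smul]
  | mul x y _ _ hx hy => simp only [map_mul, MulOpposite.unop_mul, Module.End.mul_apply, hx,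
      map_smul, hy, smul_smul]

theorem Presents.nonempty_linearEquiv (hA : Presents (FunRel P) t) (hM : Presents (ExtRel P τ) g)
    (hincl : ∀ x, incl (t x) = g (.t x)) : Nonempty ((Fin 8 → A) ≃ₗ[R] M) := by
  obtain ⟨ρ, hρ⟩ := hM.lift (Module.End A (W A))ᵐᵒᵖ
    (fun
      | .t x => MulOpposite.op (opT P t τ x)
      | .θ i => MulOpposite.op (opTheta P i))
    ⟨slRels_op hA.rel τ, formsRels_op t τ⟩
  have hρt x := hρ (.t x)
  have hρθ i := hρ (.θ i)
  refine ⟨LinearEquiv.ofLinearMap (form incl (g ∘ .θ))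
    { toFun := fun m => (ρ m).unop (one A)
      map_add' := fun x y => by simp
      map_smul' := fun r x => by simp } ?_ ?_⟩
  · ext x
    simpa [form_apply] using form_unop_apply hM hincl hρt hρθ x (one A)
  · refine LinearMap.ext fun v => ?_
    change (ρ (form incl (g ∘ .θ) v)).unop (one A) = v
    simp only [form_apply, map_add, map_mul, MulOpposite.unop_add, MulOpposite.unop_mul,
      LinearMap.add_apply, Module.End.mul_apply, unop_incl_apply_one hA hincl hρt, map_smul, hρθ,
      MulOpposite.unop_op, Function.comp_apply, opTheta, Matrix.cons_val, theta0_apply,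
      theta1_apply, theta2_apply]
    ext J
    fin_cases J <;> simp

end Freeness

variable (k : Type u) [Field k]

theorem inclA_tA (x : TGen) : inclA k (tA k x) = gM k (.t x) := by
  change RingQuot.liftAlgHom k _ (RingQuot.mkAlgHom k _ _) = _
  simp [tM]

variable [CharZero k] (τ : Kind)

theorem inclAq_tAq (x : TGen) : inclAq k τ (tAq k x) = gMq k τ (.t x) := by
  change RingQuot.liftAlgHom k⟦X⟧ _ (RingQuot.mkAlgHom k⟦X⟧ _ _) = _
  simp [tMq]

instance : Module.Free k⟦X⟧ (Aq k) := (presents_tAq k).free_of_funRel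

instance : Module.Free k⟦X⟧ (Mq k τ) :=
  let ⟨e⟩ := (presents_tAq k).nonempty_linearEquiv (presents_gMq k τ) (inclAq_tAq k τ)
  Module.Free.of_equiv e

/-! ### Parity -/

section Parity

theorem koszul_add_left (p r s : ZMod 2) : koszul (p + r) s = koszul p s * koszul r s := by
  revert p r s; decide

theorem koszul_add_right (p r s : ZMod 2) : koszul p (r + s) = koszul p r * koszul p s := by
  revert p r s; decide

theorem koszul_comm (p r : ZMod 2) : koszul p r = koszul r p := by
  revert p r; decide

theorem koszul_mul_self (p r : ZMod 2) : koszul p r * koszul p r = 1 := by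
  revert p r; decide

theorem koszul_zero_left (p : ZMod 2) : koszul 0 p = 1 := by
  revert p; decide

theorem koszul_zero_right (p : ZMod 2) : koszul p 0 = 1 := by
  revert p; decide

theorem koszul_one_one : koszul 1 1 = -1 := by decide

theorem eq_zero_or_one_of_zmod_two (p : ZMod 2) : p = 0 ∨ p = 1 := by
  revert p; decide

variable {R B : Type*} [CommRing R] [Ring B] [Algebra R B] {g : Gen → B}

theorem prod_mem_parityPart (w : List Gen) :
    (w.map g).prod ∈ parityPart R g (w.map Gen.deg).sum :=
  Submodule.subset_span ⟨w, rfl, rfl⟩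

theorem gen_mem_parityPart (s : Gen) : g s ∈ parityPart R g s.deg := by
  simpa using prod_mem_parityPart (R := R) (g := g) [s]

theorem one_mem_parityPart : (1 : B) ∈ parityPart R g 0 := by
  simpa using prod_mem_parityPart (R := R) (g := g) []

theorem algebraMap_mem_parityPart (r : R) : algebraMap R B r ∈ parityPart R g 0 := by
  rw [Algebra.algebraMap_eq_smul_one]
  exact Submodule.smul_mem _ _ one_mem_parityPart

theorem mul_mem_parityPart {p r : ZMod 2} {x y : B} (hx : x ∈ parityPart R g p)
    (hy : y ∈ parityPart R g r) : x * y ∈ parityPart R g (p + r) := by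
  have hxy := Submodule.mul_mem_mul hx hy
  rw [parityPart, parityPart, Submodule.span_mul_span] at hxy
  refine Submodule.span_mono ?_ hxy
  rintro _ ⟨_, ⟨w, rfl, rfl⟩, _, ⟨w', rfl, rfl⟩, rfl⟩
  exact ⟨w ++ w', by simp, by simp⟩

theorem exists_parity_decomposition (hg : Algebra.adjoin R (Set.range g) = ⊤) (x : B) :
    ∃ x₀ ∈ parityPart R g 0, ∃ x₁ ∈ parityPart R g 1, x = x₀ + x₁ := by
  have hx : x ∈ Algebra.adjoin R (Set.range g) := hg ▸ Algebra.mem_top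
  induction hx using Algebra.adjoin_induction with
  | mem x hx =>
    obtain ⟨s | i, rfl⟩ := hx
    · exact ⟨_, gen_mem_parityPart (.t s), 0, zero_mem _, (add_zero _).symm⟩
    · exact ⟨0, zero_mem _, _, gen_mem_parityPart (.θ i), (zero_add _).symm⟩
  | algebraMap r => exact ⟨_, algebraMap_mem_parityPart r, 0, zero_mem _, (add_zero _).symm⟩
  | add x y _ _ ix iy =>
    obtain ⟨x₀, hx₀, x₁, hx₁, rfl⟩ := ix
    obtain ⟨y₀, hy₀, y₁, hy₁, rfl⟩ := iy
    exact ⟨_, add_mem hx₀ hy₀, _, add_mem hx₁ hy₁, by abel⟩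
  | mul x y _ _ ix iy =>
    obtain ⟨x₀, hx₀, x₁, hx₁, rfl⟩ := ix
    obtain ⟨y₀, hy₀, y₁, hy₁, rfl⟩ := iy
    refine ⟨x₀ * y₀ + x₁ * y₁, add_mem ?_ ?_, x₀ * y₁ + x₁ * y₀, add_mem ?_ ?_, by noncomm_ring⟩
    · simpa using mul_mem_parityPart hx₀ hy₀
    · simpa [show (1 : ZMod 2) + 1 = 0 by decide] using mul_mem_parityPart hx₁ hy₁
    · simpa using mul_mem_parityPart hx₀ hy₁
    · simpa using mul_mem_parityPart hx₁ hy₀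

/-- Supercommutativity of the algebra generated by the `g s`, stated on generators. -/
def Supercommute (g : Gen → B) : Prop :=
  ∀ s s', g s * g s' = koszul s.deg s'.deg • (g s' * g s)

theorem Supercommute.gen_mul_prod (hg : Supercommute g) (s : Gen) (w : List Gen) :
    g s * (w.map g).prod = koszul s.deg (w.map Gen.deg).sum • ((w.map g).prod * g s) := by
  induction w with
  | nil => simp [koszul_zero_right]
  | cons s' w ih =>
    simp only [List.map_cons, List.prod_cons, List.sum_cons, koszul_add_right]
    rw [← mul_assoc, hg, smul_mul_assoc, mul_assoc, ih, mul_smul_comm, smul_smul, mul_assoc]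

theorem Supercommute.prod_mul_prod (hg : Supercommute g) (w w' : List Gen) :
    (w.map g).prod * (w'.map g).prod =
      koszul (w.map Gen.deg).sum (w'.map Gen.deg).sum • ((w'.map g).prod * (w.map g).prod) := by
  induction w with
  | nil => simp [koszul_zero_left]
  | cons s w ih =>
    simp only [List.map_cons, List.prod_cons, List.sum_cons, koszul_add_left]
    rw [mul_assoc, ih, mul_smul_comm, ← mul_assoc, hg.gen_mul_prod, smul_mul_assoc, smul_smul,
      mul_assoc, mul_comm (koszul _ _)]

theorem Supercommute.mul_eq (hg : Supercommute g) {p r : ZMod 2} {x y : B}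
    (hx : x ∈ parityPart R g p) (hy : y ∈ parityPart R g r) :
    x * y = koszul p r • (y * x) := by
  refine LinearMap.eqOn_span (f := LinearMap.mulRight R y)
    (g := koszul p r • LinearMap.mulLeft R y) ?_ hx
  rintro _ ⟨w, rfl, rfl⟩
  refine LinearMap.eqOn_span (f := LinearMap.mulLeft R (w.map g).prod)
    (g := koszul _ r • LinearMap.mulRight R (w.map g).prod) ?_ hy
  rintro _ ⟨w', rfl, rfl⟩
  exact hg.prod_mul_prod w w'

/-- `σ` is the parity automorphism `x ↦ (-1)^deg x · x`, which recovers the grading when `2` is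
invertible. -/
def IsParity (g : Gen → B) (σ : B →ₐ[R] B) : Prop :=
  ∀ s, σ (g s) = koszul s.deg 1 • g s

theorem IsParity.apply_of_mem {σ : B →ₐ[R] B} (hσ : IsParity g σ) {p : ZMod 2} {x : B}
    (hx : x ∈ parityPart R g p) : σ x = koszul p 1 • x := by
  refine LinearMap.eqOn_span (f := σ.toLinearMap) (g := koszul p 1 • LinearMap.id) ?_ hx
  rintro _ ⟨w, rfl, rfl⟩
  change σ (w.map g).prod = koszul _ 1 • (w.map g).prod
  clear hx
  induction w with
  | nil => simp [koszul_zero_left]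
  | cons s w ih =>
    simp only [List.map_cons, List.prod_cons, List.sum_cons, map_mul, hσ s, ih, koszul_add_left]
    rw [smul_mul_smul_comm]

theorem IsParity.apply_of_mem_zero {σ : B →ₐ[R] B} (hσ : IsParity g σ) {x : B}
    (hx : x ∈ parityPart R g 0) : σ x = x := by
  rw [hσ.apply_of_mem hx, koszul_zero_left, one_smul]

/-- The power `σ^p` of a parity automorphism. -/
def parityPow (σ : B →ₐ[R] B) (p : ZMod 2) : B →ₐ[R] B := if p = 1 then σ else AlgHom.id R B

theorem parityPow_zero (σ : B →ₐ[R] B) : parityPow σ 0 = AlgHom.id R B := rfl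

theorem parityPow_one (σ : B →ₐ[R] B) : parityPow σ 1 = σ := rfl

theorem IsParity.parityPow_of_mem {σ : B →ₐ[R] B} (hσ : IsParity g σ) {p : ZMod 2}
    (r : ZMod 2) {x : B} (hx : x ∈ parityPart R g p) : parityPow σ r x = koszul p r • x := by
  obtain rfl | rfl := eq_zero_or_one_of_zmod_two r
  · rw [parityPow_zero, AlgHom.id_apply, koszul_zero_right, one_smul]
  · rw [parityPow_one, hσ.apply_of_mem hx]

variable [Invertible (2 : R)]

/-- The projection onto the component of degree `p`, for a parity automorphism `σ`. -/
def parityProj (σ : B →ₐ[R] B) (p : ZMod 2) : B →ₗ[R] B :=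
  ⅟(2 : R) • (LinearMap.id + koszul p 1 • σ.toLinearMap)

theorem parityProj_apply (σ : B →ₐ[R] B) (p : ZMod 2) (x : B) :
    parityProj σ p x = ⅟(2 : R) • (x + koszul p 1 • σ x) := rfl

theorem parityProj_zero_add_one (σ : B →ₐ[R] B) (x : B) :
    parityProj σ 0 x + parityProj σ 1 x = x := by
  have htwo : x + σ x + (x - σ x) = (2 : R) • x := by rw [two_smul]; abel
  rw [parityProj_apply, parityProj_apply, koszul_zero_left, koszul_one_one, ← smul_add, one_smul,
    neg_one_smul, ← sub_eq_add_neg, htwo, invOf_smul_smul]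

theorem IsParity.parityProj_of_mem {σ : B →ₐ[R] B} (hσ : IsParity g σ) {p : ZMod 2} {x : B}
    (hx : x ∈ parityPart R g p) : parityProj σ p x = x := by
  rw [parityProj_apply, hσ.apply_of_mem hx, smul_smul, koszul_mul_self, one_smul, ← two_smul R,
    invOf_smul_smul]

theorem IsParity.parityProj_of_mem_ne {σ : B →ₐ[R] B} (hσ : IsParity g σ) {p r : ZMod 2}
    (hpr : p ≠ r) {x : B} (hx : x ∈ parityPart R g p) : parityProj σ r x = 0 := by
  have hsign : koszul r 1 * koszul p 1 = -1 := by clear hx; revert p r; decide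
  rw [parityProj_apply, hσ.apply_of_mem hx, smul_smul, hsign, neg_one_smul, add_neg_cancel,
    smul_zero]

theorem IsParity.parityProj_mem {σ : B →ₐ[R] B} (hσ : IsParity g σ)
    (hg : Algebra.adjoin R (Set.range g) = ⊤) (p : ZMod 2) (x : B) :
    parityProj σ p x ∈ parityPart R g p := by
  obtain ⟨x₀, h₀, x₁, h₁, rfl⟩ := exists_parity_decomposition hg x
  rw [map_add]
  obtain rfl | rfl := eq_zero_or_one_of_zmod_two p
  · rwa [hσ.parityProj_of_mem h₀, hσ.parityProj_of_mem_ne one_ne_zero h₁, add_zero]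
  · rwa [hσ.parityProj_of_mem h₁, hσ.parityProj_of_mem_ne zero_ne_one h₀, zero_add]

/-- The graded commutator `x y - (-1)^(deg x deg y) y x`. The sign is read off as `y σ^(deg y)(x)`,
so that only the second argument has to be split into its homogeneous components. -/
def superComm (σ : B →ₐ[R] B) : B →ₗ[R] B →ₗ[R] B :=
  LinearMap.mul R B - (LinearMap.mul R B).flip.compl₂ (parityProj σ 0)
    - ((LinearMap.mul R B).flip.comp σ.toLinearMap).compl₂ (parityProj σ 1)

theorem superComm_apply (σ : B →ₐ[R] B) (x y : B) :
    superComm σ x y = x * y - parityProj σ 0 y * x - parityProj σ 1 y * σ x := rfl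

theorem IsParity.superComm_of_mem_right {σ : B →ₐ[R] B} (hσ : IsParity g σ) {p : ZMod 2} (x : B)
    {y : B} (hy : y ∈ parityPart R g p) : superComm σ x y = x * y - y * parityPow σ p x := by
  rw [superComm_apply]
  obtain rfl | rfl := eq_zero_or_one_of_zmod_two p
  · rw [hσ.parityProj_of_mem hy, hσ.parityProj_of_mem_ne zero_ne_one hy, zero_mul, sub_zero,
      parityPow_zero, AlgHom.id_apply]
  · rw [hσ.parityProj_of_mem hy, hσ.parityProj_of_mem_ne one_ne_zero hy, zero_mul, sub_zero,
      parityPow_one]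

theorem IsParity.superComm_of_mem {σ : B →ₐ[R] B} (hσ : IsParity g σ) {p r : ZMod 2} {x y : B}
    (hx : x ∈ parityPart R g p) (hy : y ∈ parityPart R g r) :
    superComm σ x y = x * y - koszul p r • (y * x) := by
  rw [hσ.superComm_of_mem_right x hy, hσ.parityPow_of_mem r hx, mul_smul_comm]

theorem map_superComm {B' : Type*} [Ring B'] [Algebra R B'] {σ : B →ₐ[R] B} {σ' : B' →ₐ[R] B'}
    {F : B →ₐ[R] B'} (hF : ∀ x, F (σ x) = σ' (F x)) (x y : B) :
    F (superComm σ x y) = superComm σ' (F x) (F y) := by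
  simp only [superComm_apply, parityProj_apply, map_sub, map_mul, map_smul, map_add, map_zsmul, hF]

end Parity

/-! ### The semiclassical limit of a deformation -/

section Deformation

theorem koszul_jacobi {B : Type*} [Ring B] (p r s : ZMod 2) (x y z : B) :
    koszul p s • ((x * y - koszul p r • (y * x)) * z -
        koszul (p + r) s • (z * (x * y - koszul p r • (y * x)))) +
      koszul r s • ((z * x - koszul s p • (x * z)) * y -
        koszul (s + p) r • (y * (z * x - koszul s p • (x * z)))) +
      koszul p r • ((y * z - koszul r s • (z * y)) * x -
        koszul (r + s) p • (x * (y * z - koszul r s • (z * y)))) = 0 := by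
  have h11 : (1 : ZMod 2) + 1 = 0 := by decide
  obtain rfl | rfl := eq_zero_or_one_of_zmod_two p <;>
  obtain rfl | rfl := eq_zero_or_one_of_zmod_two r <;>
  obtain rfl | rfl := eq_zero_or_one_of_zmod_two s <;>
  simp only [koszul_zero_left, koszul_zero_right, koszul_one_one, zero_add, add_zero, h11] <;>
  noncomm_ring

theorem coeff_one_X_mul {R : Type*} [CommSemiring R] (s : R⟦X⟧) :
    PowerSeries.coeff 1 (PowerSeries.X * s) = PowerSeries.constantCoeff s := by
  rw [← zero_add 1, PowerSeries.coeff_succ_X_mul, PowerSeries.coeff_zero_eq_constantCoeff_apply]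

instance invertibleTwoPowerSeries (k : Type*) [Field k] [CharZero k] : Invertible (2 : k⟦X⟧) :=
  (Invertible.map (PowerSeries.C : k →+* k⟦X⟧) 2).copy 2 (map_ofNat _ 2).symm

/-- A flat deformation `Bh` over `k⟦h⟧` of a supercommutative algebra `B`, both generated by four
even and three odd elements and equipped with their parity automorphisms. It carries what is needed
to take the semiclassical limit of the graded commutator of `Bh`. -/
structure Deformation (k : Type*) [Field k] [CharZero k] (Bh B : Type*) [Ring Bh]
    [Algebra k⟦X⟧ Bh] [Ring B] [Algebra k B] where
  gh : Gen → Bh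
  g : Gen → B
  adjoin_gh : Algebra.adjoin k⟦X⟧ (Set.range gh) = ⊤
  π : Bh →ₛₗ[(PowerSeries.constantCoeff : k⟦X⟧ →+* k)] B
  isReduction : IsReduction π
  π_gh : ∀ s, π (gh s) = g s
  σh : Bh →ₐ[k⟦X⟧] Bh
  isParity_h : IsParity gh σh
  σ : B →ₐ[k] B
  isParity : IsParity g σ
  X_smul_injective : Function.Injective fun x : Bh => (PowerSeries.X : k⟦X⟧) • x
  supercommute : Supercommute g

namespace Deformation

variable {k : Type*} [Field k] [CharZero k] {Bh B : Type*} [Ring Bh] [Algebra k⟦X⟧ Bh] [Ring B]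
  [Algebra k B] (D : Deformation k Bh B)

local notation "ℏ" => (PowerSeries.X : PowerSeries k)

theorem π_mul (x y : Bh) : D.π (x * y) = D.π x * D.π y := D.isReduction.map_mul x y

theorem π_h_smul (x : Bh) : D.π (ℏ • x) = 0 := (D.isReduction.ker _).2 ⟨x, rfl⟩

theorem π_C_smul (c : k) (x : Bh) : D.π ((PowerSeries.C c : k⟦X⟧) • x) = c • D.π x := by
  rw [map_smulₛₗ, PowerSeries.constantCoeff_C]

theorem π_prod (w : List Gen) : D.π (w.map D.gh).prod = (w.map D.g).prod := by
  induction w with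
  | nil => simpa using D.isReduction.map_one
  | cons s w ih =>
    rw [List.map_cons, List.prod_cons, π_mul, ih, D.π_gh, List.map_cons, List.prod_cons]

theorem π_mem_parityPart {p : ZMod 2} {x : Bh} (hx : x ∈ parityPart k⟦X⟧ D.gh p) :
    D.π x ∈ parityPart k D.g p := by
  unfold parityPart at hx
  induction hx using Submodule.span_induction with
  | mem x hx =>
    obtain ⟨w, rfl, rfl⟩ := hx
    rw [π_prod]
    exact prod_mem_parityPart w
  | zero => simp
  | add x y _ _ hx hy => rw [map_add]; exact add_mem hx hy
  | smul c x _ hx => rw [map_smulₛₗ]; exact Submodule.smul_mem _ _ hx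

theorem exists_lift_mem_parityPart {p : ZMod 2} {x : B} (hx : x ∈ parityPart k D.g p) :
    ∃ y ∈ parityPart k⟦X⟧ D.gh p, D.π y = x := by
  unfold parityPart at hx
  induction hx using Submodule.span_induction with
  | mem x hx =>
    obtain ⟨w, rfl, rfl⟩ := hx
    exact ⟨_, prod_mem_parityPart w, D.π_prod w⟩
  | zero => exact ⟨0, zero_mem _, map_zero _⟩
  | add x y _ _ hx hy =>
    obtain ⟨x, hx, rfl⟩ := hx
    obtain ⟨y, hy, rfl⟩ := hy
    exact ⟨x + y, add_mem hx hy, map_add _ _ _⟩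
  | smul c x _ hx =>
    obtain ⟨x, hx, rfl⟩ := hx
    exact ⟨_, Submodule.smul_mem _ (PowerSeries.C c) hx, D.π_C_smul c x⟩

theorem π_superComm_of_mem {p r : ZMod 2} {x y : Bh} (hx : x ∈ parityPart k⟦X⟧ D.gh p)
    (hy : y ∈ parityPart k⟦X⟧ D.gh r) : D.π (superComm D.σh x y) = 0 := by
  rw [D.isParity_h.superComm_of_mem hx hy, map_sub, map_zsmul, π_mul, π_mul,
    D.supercommute.mul_eq (D.π_mem_parityPart hx) (D.π_mem_parityPart hy), sub_self]

theorem π_superComm (x y : Bh) : D.π (superComm D.σh x y) = 0 := by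
  obtain ⟨x₀, hx₀, x₁, hx₁, rfl⟩ := exists_parity_decomposition D.adjoin_gh x
  obtain ⟨y₀, hy₀, y₁, hy₁, rfl⟩ := exists_parity_decomposition D.adjoin_gh y
  simp only [map_add, LinearMap.add_apply, D.π_superComm_of_mem hx₀ hy₀,
    D.π_superComm_of_mem hx₀ hy₁, D.π_superComm_of_mem hx₁ hy₀, D.π_superComm_of_mem hx₁ hy₁,
    add_zero]

theorem exists_superComm_eq (x y : Bh) : ∃ w, superComm D.σh x y = ℏ • w :=
  (D.isReduction.ker _).1 (D.π_superComm x y)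

/-- The quotient `[x, y] / h` of the graded commutator, as a plain function. -/
def divCommFun (x y : Bh) : Bh := (D.exists_superComm_eq x y).choose

theorem h_smul_divCommFun (x y : Bh) : ℏ • D.divCommFun x y = superComm D.σh x y :=
  (D.exists_superComm_eq x y).choose_spec.symm

/-- The graded commutator divided by `h`. -/
def divComm : Bh →ₗ[k⟦X⟧] Bh →ₗ[k⟦X⟧] Bh :=
  LinearMap.mk₂ k⟦X⟧ D.divCommFun
    (fun x x' y => D.X_smul_injective <| by
      simp only [smul_add, h_smul_divCommFun, map_add, LinearMap.add_apply])
    (fun c x y => D.X_smul_injective <| by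
      simp only [smul_comm ℏ c, h_smul_divCommFun, map_smul, LinearMap.smul_apply])
    (fun x y y' => D.X_smul_injective <| by simp only [smul_add, h_smul_divCommFun, map_add])
    (fun c x y => D.X_smul_injective <| by
      simp only [smul_comm ℏ c, h_smul_divCommFun, map_smul])

theorem h_smul_divComm (x y : Bh) : ℏ • D.divComm x y = superComm D.σh x y :=
  D.h_smul_divCommFun x y

theorem h_smul_divComm_of_mem {p r : ZMod 2} {x y : Bh} (hx : x ∈ parityPart k⟦X⟧ D.gh p)
    (hy : y ∈ parityPart k⟦X⟧ D.gh r) :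
    ℏ • D.divComm x y = x * y - koszul p r • (y * x) := by
  rw [h_smul_divComm, D.isParity_h.superComm_of_mem hx hy]

theorem π_divComm_congr {x x' y y' : Bh} (hx : D.π x = D.π x') (hy : D.π y = D.π y') :
    D.π (D.divComm x y) = D.π (D.divComm x' y') := by
  obtain ⟨u, hu⟩ := (D.isReduction.ker (x - x')).1 (by rw [map_sub, hx, sub_self])
  obtain ⟨v, hv⟩ := (D.isReduction.ker (y - y')).1 (by rw [map_sub, hy, sub_self])
  obtain rfl : x = x' + ℏ • u := by rw [← hu]; abel
  obtain rfl : y = y' + ℏ • v := by rw [← hv]; abel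
  simp only [map_add, map_smul, LinearMap.add_apply, LinearMap.smul_apply, π_h_smul, add_zero]

/-- The semiclassical limit of the graded commutator: the reduction of `[x, y] / h` for arbitrary
lifts `x` and `y`. -/
def bracket : B →ₗ[k] B →ₗ[k] B :=
  let s := Function.surjInv D.isReduction.surjective
  have hs : ∀ x, D.π (s x) = x := Function.surjInv_eq D.isReduction.surjective
  LinearMap.mk₂ k (fun x y => D.π (D.divComm (s x) (s y)))
    (fun x x' y => by
      rw [← map_add, ← LinearMap.add_apply, ← map_add]
      exact D.π_divComm_congr (by simp only [map_add, hs]) rfl)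
    (fun c x y => by
      rw [← π_C_smul, ← LinearMap.smul_apply, ← map_smul]
      exact D.π_divComm_congr (by simp only [π_C_smul, hs]) rfl)
    (fun x y y' => by
      rw [← map_add, ← map_add]
      exact D.π_divComm_congr rfl (by simp only [map_add, hs]))
    (fun c x y => by
      rw [← π_C_smul, ← map_smul]
      exact D.π_divComm_congr rfl (by simp only [π_C_smul, hs]))

theorem bracket_π (x y : Bh) : D.bracket (D.π x) (D.π y) = D.π (D.divComm x y) :=
  D.π_divComm_congr (Function.surjInv_eq D.isReduction.surjective _)
    (Function.surjInv_eq D.isReduction.surjective _)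

theorem mem_parityPart_of_h_smul_mem {p : ZMod 2} {x : Bh}
    (hx : ℏ • x ∈ parityPart k⟦X⟧ D.gh p) : x ∈ parityPart k⟦X⟧ D.gh p := by
  have hproj := D.isParity_h.parityProj_of_mem hx
  rw [map_smul] at hproj
  rw [← D.X_smul_injective hproj]
  exact D.isParity_h.parityProj_mem D.adjoin_gh p x

theorem divComm_mem_parityPart {p r : ZMod 2} {x y : Bh} (hx : x ∈ parityPart k⟦X⟧ D.gh p)
    (hy : y ∈ parityPart k⟦X⟧ D.gh r) : D.divComm x y ∈ parityPart k⟦X⟧ D.gh (p + r) := by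
  refine D.mem_parityPart_of_h_smul_mem ?_
  rw [D.h_smul_divComm_of_mem hx hy]
  refine sub_mem (mul_mem_parityPart hx hy) (zsmul_mem ?_ _)
  rw [add_comm]
  exact mul_mem_parityPart hy hx

theorem h_smul_h_smul_divComm_divComm {p r s : ZMod 2} {x y z : Bh}
    (hx : x ∈ parityPart k⟦X⟧ D.gh p) (hy : y ∈ parityPart k⟦X⟧ D.gh r)
    (hz : z ∈ parityPart k⟦X⟧ D.gh s) :
    ℏ • ℏ • D.divComm (D.divComm x y) z = (x * y - koszul p r • (y * x)) * z -
      koszul (p + r) s • (z * (x * y - koszul p r • (y * x))) := by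
  rw [D.h_smul_divComm_of_mem (D.divComm_mem_parityPart hx hy) hz, smul_sub,
    smul_comm ℏ (koszul _ _), ← smul_mul_assoc, ← mul_smul_comm, D.h_smul_divComm_of_mem hx hy]

theorem bracket_mem_parityPart {p r : ZMod 2} {x y : B} (hx : x ∈ parityPart k D.g p)
    (hy : y ∈ parityPart k D.g r) : D.bracket x y ∈ parityPart k D.g (p + r) := by
  obtain ⟨x, hx', rfl⟩ := D.exists_lift_mem_parityPart hx
  obtain ⟨y, hy', rfl⟩ := D.exists_lift_mem_parityPart hy
  rw [bracket_π]
  exact D.π_mem_parityPart (D.divComm_mem_parityPart hx' hy')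

theorem bracket_symm {p r : ZMod 2} {x y : B} (hx : x ∈ parityPart k D.g p)
    (hy : y ∈ parityPart k D.g r) : D.bracket x y = -(koszul p r • D.bracket y x) := by
  obtain ⟨x, hx', rfl⟩ := D.exists_lift_mem_parityPart hx
  obtain ⟨y, hy', rfl⟩ := D.exists_lift_mem_parityPart hy
  rw [bracket_π, bracket_π, ← map_zsmul D.π, ← map_neg]
  refine congrArg D.π (D.X_smul_injective ?_)
  simp only [smul_neg, smul_comm ℏ (koszul _ _), D.h_smul_divComm_of_mem hx' hy',
    D.h_smul_divComm_of_mem hy' hx', smul_sub, smul_smul, koszul_comm r p, koszul_mul_self]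
  rw [one_smul, neg_sub]

theorem bracket_leibniz {r s : ZMod 2} (x : B) {y z : B} (hy : y ∈ parityPart k D.g r)
    (hz : z ∈ parityPart k D.g s) :
    D.bracket (x * y) z = x * D.bracket y z + koszul r s • (D.bracket x z * y) := by
  obtain ⟨x, rfl⟩ := D.isReduction.surjective x
  obtain ⟨y, hy', rfl⟩ := D.exists_lift_mem_parityPart hy
  obtain ⟨z, hz', rfl⟩ := D.exists_lift_mem_parityPart hz
  simp only [← π_mul, bracket_π, ← map_zsmul D.π, ← map_add]
  refine congrArg D.π (D.X_smul_injective ?_)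
  change ℏ • _ = ℏ • _
  rw [smul_add, smul_comm ℏ (koszul r s), ← mul_smul_comm, ← smul_mul_assoc]
  simp only [h_smul_divComm, D.isParity_h.superComm_of_mem_right _ hz', map_mul,
    D.isParity_h.parityPow_of_mem s hy']
  simp only [mul_sub, sub_mul, smul_sub, mul_smul_comm, mul_assoc]
  abel

theorem bracket_jacobi {p r s : ZMod 2} {x y z : B} (hx : x ∈ parityPart k D.g p)
    (hy : y ∈ parityPart k D.g r) (hz : z ∈ parityPart k D.g s) :
    koszul p s • D.bracket (D.bracket x y) z + koszul r s • D.bracket (D.bracket z x) y +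
      koszul p r • D.bracket (D.bracket y z) x = 0 := by
  obtain ⟨x, hx', rfl⟩ := D.exists_lift_mem_parityPart hx
  obtain ⟨y, hy', rfl⟩ := D.exists_lift_mem_parityPart hy
  obtain ⟨z, hz', rfl⟩ := D.exists_lift_mem_parityPart hz
  simp only [bracket_π, ← map_zsmul D.π, ← map_add]
  rw [← map_zero D.π]
  refine congrArg D.π (D.X_smul_injective (D.X_smul_injective ?_))
  simp only [smul_add, smul_comm ℏ (koszul _ _), smul_zero,
    D.h_smul_h_smul_divComm_divComm hx' hy' hz', D.h_smul_h_smul_divComm_divComm hz' hx' hy',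
    D.h_smul_h_smul_divComm_divComm hy' hz' hx']
  exact koszul_jacobi p r s x y z

theorem exists_commutator_eq {p r : ZMod 2} {x y : Bh} (hx : x ∈ parityPart k⟦X⟧ D.gh p)
    (hy : y ∈ parityPart k⟦X⟧ D.gh r) :
    ∃ w, x * y - koszul p r • (y * x) = ℏ • w ∧ D.π w = D.bracket (D.π x) (D.π y) :=
  ⟨D.divComm x y, (D.h_smul_divComm_of_mem hx hy).symm, (D.bracket_π x y).symm⟩

theorem bracket_eq_of_commutator_eq {p r : ZMod 2} {x y z₁ z₂ : Bh} {r₁ r₂ : k⟦X⟧}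
    (hx : x ∈ parityPart k⟦X⟧ D.gh p) (hy : y ∈ parityPart k⟦X⟧ D.gh r)
    (h₁ : PowerSeries.constantCoeff r₁ = 0) (h₂ : PowerSeries.constantCoeff r₂ = 0)
    (h : x * y - koszul p r • (y * x) = r₁ • z₁ + r₂ • z₂) :
    D.bracket (D.π x) (D.π y) =
      PowerSeries.coeff 1 r₁ • D.π z₁ + PowerSeries.coeff 1 r₂ • D.π z₂ := by
  obtain ⟨s₁, rfl⟩ := PowerSeries.X_dvd_iff.2 h₁
  obtain ⟨s₂, rfl⟩ := PowerSeries.X_dvd_iff.2 h₂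
  have hdiv : D.divComm x y = s₁ • z₁ + s₂ • z₂ := D.X_smul_injective <| by
    simp only [D.h_smul_divComm_of_mem hx hy, h, smul_add, mul_smul]
  rw [bracket_π, hdiv, map_add, map_smulₛₗ, map_smulₛₗ, coeff_one_X_mul, coeff_one_X_mul]

end Deformation

end Deformation

/-! ### Covariance of the limit bracket -/

section TensorParity

variable {R B : Type*} [CommRing R] [Ring B] [Algebra R B] {g : Gen → B} [Invertible (2 : R)]
  {σ : B →ₐ[R] B}

theorem IsParity.parityProj_map_tmul_of_mem_left (hσ : IsParity g σ) (p : ZMod 2) {f : B}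
    (hf : f ∈ parityPart R g 0) (m : B) :
    parityProj (Algebra.TensorProduct.map σ σ) p (f ⊗ₜ m) = f ⊗ₜ parityProj σ p m := by
  simp only [parityProj_apply, Algebra.TensorProduct.map_tmul, hσ.apply_of_mem_zero hf,
    ← TensorProduct.tmul_add, ← TensorProduct.tmul_smul]

theorem IsParity.parityProj_map_tmul_of_mem_right (hσ : IsParity g σ) (p : ZMod 2) (m : B) {f : B}
    (hf : f ∈ parityPart R g 0) :
    parityProj (Algebra.TensorProduct.map σ σ) p (m ⊗ₜ f) = parityProj σ p m ⊗ₜ f := by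
  simp only [parityProj_apply, Algebra.TensorProduct.map_tmul, hσ.apply_of_mem_zero hf,
    ← TensorProduct.add_tmul, TensorProduct.smul_tmul']

theorem IsParity.superComm_tmul_of_mem_left (hσ : IsParity g σ) {f f' : B}
    (hf : f ∈ parityPart R g 0) (hf' : f' ∈ parityPart R g 0) (m m' : B) :
    superComm (Algebra.TensorProduct.map σ σ) (f ⊗ₜ m) (f' ⊗ₜ m') =
      superComm σ f f' ⊗ₜ (m * m') + (f' * f) ⊗ₜ superComm σ m m' := by
  rw [superComm_apply, hσ.parityProj_map_tmul_of_mem_left _ hf',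
    hσ.parityProj_map_tmul_of_mem_left _ hf', hσ.superComm_of_mem hf hf', superComm_apply]
  simp only [Algebra.TensorProduct.map_tmul, hσ.apply_of_mem_zero hf, koszul_zero_left, one_smul,
    Algebra.TensorProduct.tmul_mul_tmul, TensorProduct.tmul_sub, TensorProduct.sub_tmul]
  abel

theorem IsParity.superComm_tmul_of_mem_right (hσ : IsParity g σ) (m m' : B) {f f' : B}
    (hf : f ∈ parityPart R g 0) (hf' : f' ∈ parityPart R g 0) :
    superComm (Algebra.TensorProduct.map σ σ) (m ⊗ₜ f) (m' ⊗ₜ f') =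
      superComm σ m m' ⊗ₜ (f' * f) + (m * m') ⊗ₜ superComm σ f f' := by
  rw [superComm_apply, hσ.parityProj_map_tmul_of_mem_right _ _ hf',
    hσ.parityProj_map_tmul_of_mem_right _ _ hf', hσ.superComm_of_mem hf hf', superComm_apply]
  simp only [Algebra.TensorProduct.map_tmul, hσ.apply_of_mem_zero hf, koszul_zero_left, one_smul,
    Algebra.TensorProduct.tmul_mul_tmul, TensorProduct.tmul_sub, TensorProduct.sub_tmul]
  abel

end TensorParity

namespace Deformation

variable {k : Type*} [Field k] [CharZero k] {Bh B : Type*} [Ring Bh] [Algebra k⟦X⟧ Bh] [Ring B]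
  [Algebra k B] (D : Deformation k Bh B)

local notation "ℏ" => (PowerSeries.X : PowerSeries k)

/-- The part of the bracket on `B ⊗ B` in which the first factor of the second argument has degree
`r`. As for `superComm`, the Koszul sign is absorbed into `σ^r`. -/
def tensorBracketPart (r : ZMod 2) : B ⊗[k] B →ₗ[k] B ⊗[k] B →ₗ[k] B ⊗[k] B :=
  TensorProduct.map₂ (D.bracket.compl₂ (parityProj D.σ r))
      (LinearMap.mul k B ∘ₗ (parityPow D.σ r).toLinearMap) +
    TensorProduct.map₂ ((LinearMap.mul k B).compl₂ (parityProj D.σ r))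
      (D.bracket ∘ₗ (parityPow D.σ r).toLinearMap)

/-- The extension of the bracket to `B ⊗ B`. -/
def tensorBracket : B ⊗[k] B →ₗ[k] B ⊗[k] B →ₗ[k] B ⊗[k] B :=
  D.tensorBracketPart 0 + D.tensorBracketPart 1

theorem tensorBracketPart_tmul (r : ZMod 2) (x y z w : B) :
    D.tensorBracketPart r (x ⊗ₜ y) (z ⊗ₜ w) =
      D.bracket x (parityProj D.σ r z) ⊗ₜ (parityPow D.σ r y * w) +
        (x * parityProj D.σ r z) ⊗ₜ D.bracket (parityPow D.σ r y) w := rfl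

theorem tensorBracket_tmul_of_mem_right {r : ZMod 2} (x y : B) {z : B}
    (hz : z ∈ parityPart k D.g r) (w : B) :
    D.tensorBracket (x ⊗ₜ y) (z ⊗ₜ w) =
      D.bracket x z ⊗ₜ (parityPow D.σ r y * w) + (x * z) ⊗ₜ D.bracket (parityPow D.σ r y) w := by
  rw [tensorBracket, LinearMap.add_apply, LinearMap.add_apply, tensorBracketPart_tmul,
    tensorBracketPart_tmul]
  obtain rfl | rfl := eq_zero_or_one_of_zmod_two r
  · simp only [D.isParity.parityProj_of_mem hz, D.isParity.parityProj_of_mem_ne zero_ne_one hz,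
      map_zero, mul_zero, TensorProduct.zero_tmul, add_zero]
  · simp only [D.isParity.parityProj_of_mem hz, D.isParity.parityProj_of_mem_ne one_ne_zero hz,
      map_zero, mul_zero, TensorProduct.zero_tmul, zero_add]

theorem tensorBracket_tmul_of_mem {p r : ZMod 2} (x : B) {y z : B} (hy : y ∈ parityPart k D.g p)
    (hz : z ∈ parityPart k D.g r) (w : B) : D.tensorBracket (x ⊗ₜ y) (z ⊗ₜ w) =
      koszul p r • (D.bracket x z ⊗ₜ (y * w) + (x * z) ⊗ₜ D.bracket y w) := by
  rw [D.tensorBracket_tmul_of_mem_right x y hz, D.isParity.parityPow_of_mem r hy, smul_mul_assoc,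
    map_zsmul, LinearMap.smul_apply, TensorProduct.tmul_smul, TensorProduct.tmul_smul, smul_add]

theorem tensorBracket_tmul_of_even_left (x : B) {y : B} (hy : y ∈ parityPart k D.g 0) (z w : B) :
    D.tensorBracket (x ⊗ₜ y) (z ⊗ₜ w) =
      D.bracket x z ⊗ₜ (y * w) + (x * z) ⊗ₜ D.bracket y w := by
  have hσ (r : ZMod 2) : parityPow D.σ r y = y := by
    rw [D.isParity.parityPow_of_mem r hy, koszul_zero_left, one_smul]
  nth_rw 2 3 [← parityProj_zero_add_one D.σ z]
  simp only [tensorBracket, LinearMap.add_apply, tensorBracketPart_tmul, hσ, map_add, mul_add,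
    TensorProduct.add_tmul]
  abel

/-- The reduction map of `Bh ⊗ Bh`. -/
abbrev tensorπ : Bh ⊗[k⟦X⟧] Bh →ₛₗ[(PowerSeries.constantCoeff : k⟦X⟧ →+* k)] B ⊗[k] B :=
  TensorProduct.map D.π D.π

/-- The graded commutator of `u` and `v` quantizes the bracket of their reductions. -/
def TensorQuantizes (u v : Bh ⊗[k⟦X⟧] Bh) : Prop :=
  ∃ w, superComm (Algebra.TensorProduct.map D.σh D.σh) u v = ℏ • w ∧
    D.tensorπ w = D.tensorBracket (D.tensorπ u) (D.tensorπ v)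

theorem tensorQuantizes_apply {A M : Type*} [AddCommGroup A] [Module k⟦X⟧ A] [AddCommGroup M]
    [Module k⟦X⟧ M] (F : A ⊗[k⟦X⟧] M →ₗ[k⟦X⟧] Bh ⊗[k⟦X⟧] Bh)
    (hF : ∀ f m f' m', D.TensorQuantizes (F (f ⊗ₜ m)) (F (f' ⊗ₜ m'))) (u v : A ⊗[k⟦X⟧] M) :
    D.TensorQuantizes (F u) (F v) := by
  induction u using TensorProduct.induction_on with
  | zero => exact ⟨0, by simp, by simp⟩
  | add u u' hu hu' =>
    obtain ⟨w, hw, hπ⟩ := hu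
    obtain ⟨w', hw', hπ'⟩ := hu'
    exact ⟨w + w', by simp only [map_add, LinearMap.add_apply, hw, hw', smul_add],
      by simp only [map_add, LinearMap.add_apply, hπ, hπ']⟩
  | tmul f m =>
    induction v using TensorProduct.induction_on with
    | zero => exact ⟨0, by simp, by simp⟩
    | add v v' hv hv' =>
      obtain ⟨w, hw, hπ⟩ := hv
      obtain ⟨w', hw', hπ'⟩ := hv'
      exact ⟨w + w', by simp only [map_add, hw, hw', smul_add], by simp only [map_add, hπ, hπ']⟩
    | tmul f' m' => exact hF f m f' m'

theorem π_mul_comm_of_even {f f' : Bh} (hf : f ∈ parityPart k⟦X⟧ D.gh 0)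
    (hf' : f' ∈ parityPart k⟦X⟧ D.gh 0) : D.π f * D.π f' = D.π f' * D.π f := by
  rw [D.supercommute.mul_eq (D.π_mem_parityPart hf) (D.π_mem_parityPart hf'), koszul_zero_left,
    one_smul]

theorem tensorQuantizes_of_even_left {f f' : Bh} (hf : f ∈ parityPart k⟦X⟧ D.gh 0)
    (hf' : f' ∈ parityPart k⟦X⟧ D.gh 0) (m m' : Bh) :
    D.TensorQuantizes (f ⊗ₜ m) (f' ⊗ₜ m') := by
  refine ⟨D.divComm f f' ⊗ₜ (m * m') + (f' * f) ⊗ₜ D.divComm m m', ?_, ?_⟩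
  · rw [D.isParity_h.superComm_tmul_of_mem_left hf hf', ← h_smul_divComm, ← h_smul_divComm,
      TensorProduct.tmul_smul, ← TensorProduct.smul_tmul', smul_add]
  · simp only [map_add, TensorProduct.map_tmul,
      D.tensorBracket_tmul_of_mem_right _ _ (D.π_mem_parityPart hf'), parityPow_zero,
      AlgHom.id_apply, bracket_π, π_mul, D.π_mul_comm_of_even hf hf']

theorem tensorQuantizes_of_even_right (m m' : Bh) {f f' : Bh} (hf : f ∈ parityPart k⟦X⟧ D.gh 0)
    (hf' : f' ∈ parityPart k⟦X⟧ D.gh 0) :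
    D.TensorQuantizes (m ⊗ₜ f) (m' ⊗ₜ f') := by
  refine ⟨D.divComm m m' ⊗ₜ (f' * f) + (m * m') ⊗ₜ D.divComm f f', ?_, ?_⟩
  · rw [D.isParity_h.superComm_tmul_of_mem_right m m' hf hf', ← h_smul_divComm, ← h_smul_divComm,
      TensorProduct.tmul_smul, ← TensorProduct.smul_tmul', smul_add]
  · simp only [map_add, TensorProduct.map_tmul,
      D.tensorBracket_tmul_of_even_left _ (D.π_mem_parityPart hf), bracket_π, π_mul,
      D.π_mul_comm_of_even hf hf']

theorem bracket_covariant (hinj : Function.Injective fun u : Bh ⊗[k⟦X⟧] Bh => ℏ • u)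
    (F : Bh →ₐ[k⟦X⟧] Bh ⊗[k⟦X⟧] Bh)
    (hσ : ∀ x, F (D.σh x) = Algebra.TensorProduct.map D.σh D.σh (F x)) (E : B → B ⊗[k] B)
    (hE : ∀ x, D.tensorπ (F x) = E (D.π x)) (hF : ∀ x y, D.TensorQuantizes (F x) (F y)) (x y : B) :
    E (D.bracket x y) = D.tensorBracket (E x) (E y) := by
  obtain ⟨x, rfl⟩ := D.isReduction.surjective x
  obtain ⟨y, rfl⟩ := D.isReduction.surjective y
  obtain ⟨w, hw, hπw⟩ := hF x y
  have hdiv : F (D.divComm x y) = w := hinj <| by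
    simp only [← map_smul F, h_smul_divComm, map_superComm hσ, hw]
  rw [bracket_π, ← hE, ← hE, ← hE, hdiv, hπw]

end Deformation

/-! ### Centrality of the quantum determinant -/

section DetCentral

section Relations

variable {R : Type*} [CommRing R] {P : QParam R} {B : Type*} [Ring B] [Algebra R B]
  {t : TGen → B} {θ : Fin 3 → B} {τ : Kind}

theorem MatRels.mul_da (ht : MatRels P t) :
    t .d * t .a = t .a * t .d - P.mu • (t .b * t .c) := by
  rw [← ht.ad, sub_sub_cancel]

theorem MatRels.det_commute (ht : MatRels P t) (x : TGen) :
    Commute (t .a * t .d - P.q • (t .b * t .c)) (t x) := by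
  have hq := P.q_mul_qi
  have hbd := P.eq_qi_smul ht.bd
  have hcd := P.eq_qi_smul ht.cd
  rw [commute_iff_eq]
  cases x <;>
  simp only [mul_sub, sub_mul, mul_assoc, ht.ac, hbd, hcd, ht.bc.symm, ht.mul_da,
    mul_mul_of_eq ht.ab, mul_mul_of_eq ht.ac, mul_mul_of_eq hbd, mul_mul_of_eq ht.bc.symm,
    mul_mul_of_eq ht.mul_da, smul_mul_assoc, mul_smul_comm] <;>
  match_scalars <;> grind [QParam.mu]

theorem FormsRels.det_commute (h : FormsRels P τ t θ) (ht : MatRels P t) (i : Fin 3) :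
    Commute (t .a * t .d - P.q • (t .b * t .c)) (θ i) := by
  have hq := P.q_mul_qi
  have hcd := P.eq_qi_smul ht.cd
  have ha w := fun i => mul_mul_of_eq (h.ac.upper i) w
  have hb w := fun i => mul_mul_of_eq (h.bd.upper i) w
  have hc := h.ac.lower
  have hd := h.bd.lower
  rw [commute_iff_eq]
  cases τ <;> simp only [upperRhs, lowerRhs] at ha hb hc hd <;> fin_cases i <;>
  simp only [Fin.zero_eta, Fin.mk_one, Fin.reduceFinMk, mul_sub, sub_mul, mul_add, add_mul,
    mul_assoc, ha, hb, hc, hd, Matrix.cons_val, mul_mul_of_eq ht.ab, mul_mul_of_eq hcd,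
    smul_mul_assoc, mul_smul_comm, smul_sub, smul_add] <;>
  match_scalars <;> grind [QParam.mu, QParam.lam]

end Relations

theorem Presents.commute {R : Type u} [CommRing R] {ι : Type}
    {Rel : ∀ (B : Type u) [Ring B] [Algebra R B], (ι → B) → Prop} {X : Type u} [Ring X]
    [Algebra R X] {g : ι → X} (h : Presents Rel g) {z : X} (hz : ∀ s, Commute z (g s)) (x : X) :
    Commute z x := by
  have hle : Algebra.adjoin R (Set.range g) ≤ Subalgebra.centralizer R {z} := by
    refine Algebra.adjoin_le ?_
    rintro _ ⟨s, rfl⟩ _ rfl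
    exact hz s
  exact hle (h.adjoin_eq_top ▸ Algebra.mem_top) z rfl

variable (k : Type u) [Field k] [CharZero k] (τ : Kind)

theorem commute_detq_tMqGL (x : MqGL k τ) : Commute (detq k (tMqGL k τ)) x := by
  have hMqGL := presents_mkMqGL k τ
  refine hMqGL.commute (fun s => ?_) x
  obtain x | i := s
  exacts [hMqGL.rel.1.det_commute x, hMqGL.rel.2.det_commute hMqGL.rel.1 i]

theorem detq_tMq : detq k (tMq k τ) = 1 := (presents_gMq k τ).rel.1.det

end DetCentral

/-! ### The parity automorphism -/

theorem Presents.exists_isParity {R : Type u} [CommRing R] {P : QParam R} {τ : Kind} {M : Type u}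
    [Ring M] [Algebra R M] {g : Gen → M} (hM : Presents (ExtRel P τ) g) :
    ∃ σ : M →ₐ[R] M, IsParity g σ := by
  have hθ : (fun s : Gen => koszul s.deg 1 • g s) ∘ Gen.θ = -(g ∘ .θ) := by
    ext i
    simp [Gen.deg, koszul_one_one]
  have ht : (fun s : Gen => koszul s.deg 1 • g s) ∘ Gen.t = g ∘ .t := by
    ext x
    simp [Gen.deg, koszul_zero_left]
  have upper (x y : M) (i : Fin 3) :
      upperRhs P (-(g ∘ .θ)) x y τ i = -upperRhs P (g ∘ .θ) x y τ i := by
    cases τ <;> fin_cases i <;> simp [upperRhs] <;> abel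
  have lower (x y : M) (i : Fin 3) :
      lowerRhs P (-(g ∘ .θ)) x y τ i = -lowerRhs P (g ∘ .θ) x y τ i := by
    cases τ <;> fin_cases i <;> simp [lowerRhs] <;> abel
  refine hM.lift M (fun s => koszul s.deg 1 • g s) ?_
  rw [ExtRel, ht, hθ]
  obtain ⟨hsl, ⟨h00, h11, h22, h21, h10, h20⟩, hac, hbd⟩ := hM.rel
  refine ⟨hsl, ⟨?_, ?_, ?_, ?_, ?_, ?_⟩, ⟨fun i => ?_, fun i => ?_⟩, ⟨fun i => ?_, fun i => ?_⟩⟩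
  · simpa only [Pi.neg_apply, neg_mul_neg] using h00
  · simpa only [Pi.neg_apply, neg_mul_neg] using h11
  · simpa only [Pi.neg_apply, neg_mul_neg] using h22
  · simpa only [Pi.neg_apply, neg_mul_neg] using h21
  · simpa only [Pi.neg_apply, neg_mul_neg] using h10
  · simpa only [Pi.neg_apply, neg_mul_neg] using h20
  · rw [Pi.neg_apply, neg_mul, upper, hac.upper]
  · rw [Pi.neg_apply, neg_mul, lower, hac.lower]
  · rw [Pi.neg_apply, neg_mul, upper, hbd.upper]
  · rw [Pi.neg_apply, neg_mul, lower, hbd.lower]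

/-! ### Uniqueness of the brackets -/

section Unique

theorem span_range_word {R B : Type*} [CommRing R] [Ring B] [Algebra R B] {g : Gen → B}
    (hg : Algebra.adjoin R (Set.range g) = ⊤) :
    Submodule.span R (Set.range fun w : List Gen => (w.map g).prod) = ⊤ := by
  have hle (p) : parityPart R g p ≤
      Submodule.span R (Set.range fun w : List Gen => (w.map g).prod) := by
    refine Submodule.span_mono ?_
    rintro _ ⟨w, -, rfl⟩
    exact ⟨w, rfl⟩
  refine Submodule.eq_top_iff'.2 fun x => ?_
  obtain ⟨x₀, h₀, x₁, h₁, rfl⟩ := exists_parity_decomposition hg x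
  exact add_mem (hle _ h₀) (hle _ h₁)

namespace IsGradedPoisson

variable {k : Type u} [Field k] {br br' : M k →ₗ[k] M k →ₗ[k] M k}

theorem one_left (h : IsGradedPoisson br) {p : ZMod 2} {z : M k}
    (hz : z ∈ parityPart k (gM k) p) : br 1 z = 0 := by
  have hone := h.leibniz 0 p 1 1 one_mem_parityPart z hz
  rwa [koszul_zero_left, one_smul, mul_one, one_mul, mul_one, left_eq_add] at hone

theorem word_left_eq (h : IsGradedPoisson br) (h' : IsGradedPoisson br') {p : ZMod 2} {z : M k}
    (hz : z ∈ parityPart k (gM k) p) (hg : ∀ s, br (gM k s) z = br' (gM k s) z) (w : List Gen) :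
    br (w.map (gM k)).prod z = br' (w.map (gM k)).prod z := by
  induction w with
  | nil => rw [List.map_nil, List.prod_nil, h.one_left hz, h'.one_left hz]
  | cons s w ih =>
    rw [List.map_cons, List.prod_cons, h.leibniz _ _ _ _ (prod_mem_parityPart w) _ hz,
      h'.leibniz _ _ _ _ (prod_mem_parityPart w) _ hz, ih, hg]

theorem swap_eq (h : IsGradedPoisson br) (h' : IsGradedPoisson br') {p r : ZMod 2} {x y : M k}
    (hx : x ∈ parityPart k (gM k) p) (hy : y ∈ parityPart k (gM k) r) (hxy : br x y = br' x y) :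
    br y x = br' y x := by
  rw [h.symm _ _ _ hy _ hx, h'.symm _ _ _ hy _ hx, hxy]

variable [CharZero k]

theorem ext (h : IsGradedPoisson br) (h' : IsGradedPoisson br')
    (hg : ∀ s s', br (gM k s) (gM k s') = br' (gM k s) (gM k s')) : br = br' := by
  have hword (w w' : List Gen) : br (w.map (gM k)).prod (w'.map (gM k)).prod =
      br' (w.map (gM k)).prod (w'.map (gM k)).prod :=
    h.word_left_eq h' (prod_mem_parityPart w') (fun s =>
      h.swap_eq h' (prod_mem_parityPart w') (gen_mem_parityPart s)
        (h.word_left_eq h' (gen_mem_parityPart s) (fun s' => hg s' s) w')) w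
  have hspan := span_range_word (presents_gM k .I).adjoin_eq_top
  exact LinearMap.ext_on_range hspan fun w => LinearMap.ext_on_range hspan (hword w)

theorem even_self (h : IsGradedPoisson br) {x : M k} (hx : x ∈ parityPart k (gM k) 0) :
    br x x = 0 := by
  have hsymm := h.symm _ _ _ hx _ hx
  rw [koszul_zero_left, one_smul] at hsymm
  have htwo : (2 : k) • br x x = 0 := by rw [two_smul]; exact eq_neg_iff_add_eq_zero.1 hsymm
  simpa using htwo

end IsGradedPoisson

theorem HasBracketValues.unique {k : Type u} [Field k] [CharZero k] {τ : Kind}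
    {br br' : M k →ₗ[k] M k →ₗ[k] M k} (hv : HasBracketValues τ br) (hv' : HasBracketValues τ br')
    (h : IsGradedPoisson br) (h' : IsGradedPoisson br') : br = br' := by
  have swap {s s' : Gen} : br (gM k s) (gM k s') = br' (gM k s) (gM k s') →
      br (gM k s') (gM k s) = br' (gM k s') (gM k s) :=
    h.swap_eq h' (gen_mem_parityPart s) (gen_mem_parityPart s')
  have self (x) : br (gM k (.t x)) (gM k (.t x)) = br' (gM k (.t x)) (gM k (.t x)) := by
    rw [h.even_self (gen_mem_parityPart (.t x)), h'.even_self (gen_mem_parityPart (.t x))]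
  have cross i x := (hv.cross i x).trans (hv'.cross i x).symm
  have ab := hv.ab.trans hv'.ab.symm
  have ac := hv.ac.trans hv'.ac.symm
  have bd := hv.bd.trans hv'.bd.symm
  have cd := hv.cd.trans hv'.cd.symm
  have cb := hv.cb.trans hv'.cb.symm
  have ad := hv.ad.trans hv'.ad.symm
  have θ01 := hv.θ01.trans hv'.θ01.symm
  have θ02 := hv.θ02.trans hv'.θ02.symm
  have θ12 := hv.θ12.trans hv'.θ12.symm
  refine h.ext h' fun s s' => ?_
  obtain x | i := s <;> obtain x' | i' := s'
  · cases x <;> cases x'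
    exacts [self _, ab, ac, ad, swap ab, self _, swap cb, bd, swap ac, cb, self _, cd,
      swap ad, swap bd, swap cd, self _]
  · exact swap (cross i' x)
  · exact cross i x'
  · fin_cases i <;> fin_cases i'
    exacts [hv.θ00.trans hv'.θ00.symm, θ01, θ02, swap θ01, hv.θ11.trans hv'.θ11.symm, θ12,
      swap θ02, swap θ12, hv.θ22.trans hv'.θ22.symm]

end Unique

/-! ### The bracket induced by `Mq` -/

section InducedBracket

variable (k : Type u) [Field k]

theorem supercommute_gM [CharZero k] : Supercommute (gM k) := by
  obtain ⟨hcomm, -⟩ := slRels_oneParam_iff.1 (presents_gM k .I).rel.1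
  obtain ⟨hcross, hanti⟩ := formsRels_oneParam_iff.1 (presents_gM k .I).rel.2
  intro s s'
  obtain x | i := s <;> obtain x' | i' := s' <;>
  simp only [Gen.deg, koszul_zero_left, koszul_zero_right, koszul_one_one, one_smul, neg_smul]
  exacts [hcomm _ _, hcross _ _, (hcross _ _).symm, hanti _ _]

variable [CharZero k]

theorem coeff_one_q : PowerSeries.coeff 1 (q k) = -1 := by
  simp [q, PowerSeries.evalNegHom, PowerSeries.coeff_exp]

theorem coeff_one_q_inv : PowerSeries.coeff 1 (q k)⁻¹ = 1 := by
  have h := congrArg (PowerSeries.coeff 1) (qParam k).q_mul_qi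
  rw [qParam_q, qParam_qi, PowerSeries.coeff_one_mul, constantCoeff_q, constantCoeff_q_inv,
    coeff_one_q, PowerSeries.coeff_one, if_neg one_ne_zero] at h
  linear_combination h

theorem constantCoeff_mu : PowerSeries.constantCoeff (mu k) = 0 := by
  simp [mu, constantCoeff_q]

theorem coeff_one_mu : PowerSeries.coeff 1 (mu k) = -2 := by
  rw [mu, map_sub, coeff_one_q, coeff_one_q_inv]
  norm_num

variable (τ : Kind)

/-- `Mq` as a deformation of `M`. -/
def deformation : Deformation k (Mq k τ) (M k) where
  gh := gMq k τ
  g := gM k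
  adjoin_gh := (presents_gMq k τ).adjoin_eq_top
  π := (exists_isReduction_M τ).choose
  isReduction := (exists_isReduction_M τ).choose_spec.1
  π_gh := (exists_isReduction_M τ).choose_spec.2
  σh := (presents_gMq k τ).exists_isParity.choose
  isParity_h := (presents_gMq k τ).exists_isParity.choose_spec
  σ := (presents_gM k τ).exists_isParity.choose
  isParity := (presents_gM k τ).exists_isParity.choose_spec
  X_smul_injective := smul_right_injective _ PowerSeries.X_ne_zero
  supercommute := supercommute_gM k

theorem isGradedPoisson_bracket : IsGradedPoisson (deformation k τ).bracket where
  degree _ _ _ hx _ hy := (deformation k τ).bracket_mem_parityPart hx hy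
  symm _ _ _ hx _ hy := (deformation k τ).bracket_symm hx hy
  leibniz _ _ x _ hy _ hz := (deformation k τ).bracket_leibniz x hy hz
  jacobi _ _ _ _ hx _ hy _ hz := (deformation k τ).bracket_jacobi hx hy hz

variable {k τ}

theorem π_gMq (s : Gen) : (deformation k τ).π (gMq k τ s) = gM k s := (deformation k τ).π_gh s

theorem π_gMq_mul_gMq (s s' : Gen) :
    (deformation k τ).π (gMq k τ s * gMq k τ s') = gM k s * gM k s' := by
  rw [(deformation k τ).π_mul, π_gMq, π_gMq]

theorem bracket_gM_eq {s s' s₁ s₂ : Gen} {r : k⟦X⟧} (h₀ : PowerSeries.constantCoeff r = 0)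
    (h : gMq k τ s * gMq k τ s' - koszul s.deg s'.deg • (gMq k τ s' * gMq k τ s) =
      r • (gMq k τ s₁ * gMq k τ s₂)) :
    (deformation k τ).bracket (gM k s) (gM k s') =
      PowerSeries.coeff 1 r • (gM k s₁ * gM k s₂) := by
  have hbr := (deformation k τ).bracket_eq_of_commutator_eq (gen_mem_parityPart s)
    (gen_mem_parityPart s') h₀ (map_zero _) (z₁ := gMq k τ s₁ * gMq k τ s₂) (r₂ := 0)
    (z₂ := 0) (h.trans (by rw [smul_zero, add_zero]))
  rwa [(deformation k τ).π_gh, (deformation k τ).π_gh, π_gMq_mul_gMq, map_zero, map_zero,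
    smul_zero, add_zero] at hbr

theorem bracket_gM_eq_zero {s s' : Gen}
    (h : gMq k τ s * gMq k τ s' = koszul s.deg s'.deg • (gMq k τ s' * gMq k τ s)) :
    (deformation k τ).bracket (gM k s) (gM k s') = 0 := by
  rw [bracket_gM_eq (s₁ := s) (s₂ := s') (map_zero _) (by rw [h, sub_self, zero_smul]), map_zero,
    zero_smul]

theorem bracket_gM_self_eq_zero {s : Gen} (h : gMq k τ s * gMq k τ s = 0) :
    (deformation k τ).bracket (gM k s) (gM k s) = 0 :=
  bracket_gM_eq_zero (by rw [h, smul_zero])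

theorem bracket_tM_of_q_commute {x y : TGen}
    (h : gMq k τ (.t x) * gMq k τ (.t y) = q k • (gMq k τ (.t y) * gMq k τ (.t x))) :
    (deformation k τ).bracket (tM k x) (tM k y) = -(tM k x * tM k y) := by
  have hcomm : gM k (.t y) * gM k (.t x) = gM k (.t x) * gM k (.t y) := by
    simpa [Gen.deg, koszul_zero_left] using supercommute_gM k (.t y) (.t x)
  have hbr := bracket_gM_eq (s := .t x) (s' := .t y) (r := q k - 1)
    (s₁ := .t y) (s₂ := .t x) (by simp [constantCoeff_q])
    (by rw [Gen.deg, Gen.deg, koszul_zero_left, one_smul, h, sub_smul, one_smul])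
  rw [hcomm, map_sub, coeff_one_q, PowerSeries.coeff_one, if_neg one_ne_zero, sub_zero, neg_smul,
    one_smul] at hbr
  exact hbr

theorem bracket_θM_tM_eq {i j : Fin 3} {x y : TGen} {r r' : k⟦X⟧}
    (h₁ : PowerSeries.constantCoeff r = 1) (h₀ : PowerSeries.constantCoeff r' = 0)
    (h : gMq k τ (.θ i) * gMq k τ (.t x) = r • (gMq k τ (.t x) * gMq k τ (.θ i)) +
      r' • (gMq k τ (.t y) * gMq k τ (.θ j))) :
    (deformation k τ).bracket (θM k i) (tM k x) =
      PowerSeries.coeff 1 r • (tM k x * θM k i) + PowerSeries.coeff 1 r' • (tM k y * θM k j) := by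
  have hcommutator : gMq k τ (.θ i) * gMq k τ (.t x) -
      koszul (Gen.θ i).deg (Gen.t x).deg • (gMq k τ (.t x) * gMq k τ (.θ i)) =
      (r - 1) • (gMq k τ (.t x) * gMq k τ (.θ i)) + r' • (gMq k τ (.t y) * gMq k τ (.θ j)) := by
    rw [h, Gen.deg, Gen.deg, koszul_zero_right, one_smul, sub_smul, one_smul, add_sub_right_comm]
  have hbr := (deformation k τ).bracket_eq_of_commutator_eq (gen_mem_parityPart (.θ i))
    (gen_mem_parityPart (.t x)) (by simp [h₁]) h₀ hcommutator
  rwa [(deformation k τ).π_gh, (deformation k τ).π_gh, π_gMq_mul_gMq, π_gMq_mul_gMq, map_sub,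
    PowerSeries.coeff_one, if_neg one_ne_zero, sub_zero] at hbr

theorem bracket_θM_tM_eq_diag {i : Fin 3} {x : TGen} {r : k⟦X⟧}
    (h₁ : PowerSeries.constantCoeff r = 1)
    (h : gMq k τ (.θ i) * gMq k τ (.t x) = r • (gMq k τ (.t x) * gMq k τ (.θ i))) :
    (deformation k τ).bracket (θM k i) (tM k x) = PowerSeries.coeff 1 r • (tM k x * θM k i) := by
  have hbr := bracket_θM_tM_eq (j := i) (y := x) h₁ (map_zero _)
    (h.trans (by rw [zero_smul, add_zero]))
  rwa [map_zero, zero_smul, add_zero] at hbr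

/-- The brackets of type `τ` of `θ⁰, θ¹, θ²` with the upper entry `x` of a column `(x, y)`. -/
def upperBracket (x y : TGen) : Kind → Fin 3 → M k
  | .I => ![-((2 : k) • (tM k y * θM k 1)), tM k x * θM k 1,
      (4 : k) • (tM k y * θM k 0) - tM k x * θM k 2]
  | .II => ![0, -(tM k x * θM k 1), tM k x * θM k 2]

/-- The brackets of type `τ` of `θ⁰, θ¹, θ²` with the lower entry `y` of a column `(x, y)`. -/
def lowerBracket (x y : TGen) : Kind → Fin 3 → M k
  | .I => ![0, -(tM k y * θM k 1), tM k y * θM k 2]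
  | .II => ![-((2 : k) • (tM k x * θM k 2)), (4 : k) • (tM k x * θM k 0) + tM k y * θM k 1,
      -(tM k y * θM k 2)]

theorem bracket_θM_tM_eq_zero {i : Fin 3} {x : TGen}
    (h : gMq k τ (.θ i) * gMq k τ (.t x) = gMq k τ (.t x) * gMq k τ (.θ i)) :
    (deformation k τ).bracket (θM k i) (tM k x) = 0 :=
  bracket_gM_eq_zero (by rw [h, Gen.deg, Gen.deg, koszul_zero_right, one_smul])

theorem bracket_θM_tM_of_q_commute {i : Fin 3} {x : TGen}
    (h : gMq k τ (.θ i) * gMq k τ (.t x) = q k • (gMq k τ (.t x) * gMq k τ (.θ i))) :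
    (deformation k τ).bracket (θM k i) (tM k x) = -(tM k x * θM k i) := by
  rw [bracket_θM_tM_eq_diag (constantCoeff_q k) h, coeff_one_q, neg_smul, one_smul]

theorem bracket_θM_tM_of_q_inv_commute {i : Fin 3} {x : TGen}
    (h : gMq k τ (.θ i) * gMq k τ (.t x) = (q k)⁻¹ • (gMq k τ (.t x) * gMq k τ (.θ i))) :
    (deformation k τ).bracket (θM k i) (tM k x) = tM k x * θM k i := by
  rw [bracket_θM_tM_eq_diag (constantCoeff_q_inv k) h, coeff_one_q_inv, one_smul]

theorem bracket_upper {x y : TGen} (h : ColRels (qParam k) τ (gMq k τ ∘ .θ) (gMq k τ (.t x))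
    (gMq k τ (.t y))) (i : Fin 3) :
    (deformation k τ).bracket (θM k i) (tM k x) = upperBracket x y τ i := by
  cases τ <;> fin_cases i
  · refine (bracket_θM_tM_eq (r := 1) (r' := q k ^ 2 * mu k) (map_one _)
      (by simp [constantCoeff_mu]) ((h.upper 0).trans (by rw [one_smul]; rfl))).trans ?_
    simp [upperBracket, PowerSeries.coeff_one, PowerSeries.coeff_one_mul, constantCoeff_q,
      constantCoeff_mu, coeff_one_mu]
  · exact bracket_θM_tM_of_q_inv_commute (h.upper 1)
  · refine (bracket_θM_tM_eq (r' := -(mu k * lam k)) (constantCoeff_q k)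
      (by simp [constantCoeff_mu])
      ((h.upper 2).trans (by rw [neg_smul, ← sub_eq_add_neg]; rfl))).trans ?_
    simp only [map_neg, PowerSeries.coeff_one_mul, constantCoeff_mu, coeff_one_mu,
      constantCoeff_lam, coeff_one_q, upperBracket]
    change _ = (4 : k) • (tM k y * θM k 0) - tM k x * θM k 2
    module
  · exact bracket_θM_tM_eq_zero (h.upper 0)
  · exact bracket_θM_tM_of_q_commute (h.upper 1)
  · exact bracket_θM_tM_of_q_inv_commute (h.upper 2)

theorem bracket_lower {x y : TGen} (h : ColRels (qParam k) τ (gMq k τ ∘ .θ) (gMq k τ (.t x))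
    (gMq k τ (.t y))) (i : Fin 3) :
    (deformation k τ).bracket (θM k i) (tM k y) = lowerBracket x y τ i := by
  cases τ <;> fin_cases i
  · exact bracket_θM_tM_eq_zero (h.lower 0)
  · exact bracket_θM_tM_of_q_commute (h.lower 1)
  · exact bracket_θM_tM_of_q_inv_commute (h.lower 2)
  · refine (bracket_θM_tM_eq (r := 1) (map_one _) (constantCoeff_mu k)
      ((h.lower 0).trans (by rw [one_smul]; rfl))).trans ?_
    simp [lowerBracket, PowerSeries.coeff_one, coeff_one_mu]
  · refine (bracket_θM_tM_eq (r' := -(mu k * lam k * (q k)⁻¹ ^ 2)) (constantCoeff_q_inv k)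
      (by simp [constantCoeff_mu])
      ((h.lower 1).trans (by rw [neg_smul, ← sub_eq_add_neg]; rfl))).trans ?_
    simp only [map_neg, map_mul, map_pow, PowerSeries.coeff_one_mul, constantCoeff_mu, coeff_one_mu,
      constantCoeff_lam, constantCoeff_q_inv, coeff_one_q_inv, lowerBracket]
    change _ = (4 : k) • (tM k x * θM k 0) + tM k y * θM k 1
    module
  · exact bracket_θM_tM_of_q_commute (h.lower 2)

variable (k τ)

theorem bracket_cross (i : Fin 3) (x : TGen) :
    (deformation k τ).bracket (θM k i) (tM k x) = crossBracket k τ x i := by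
  obtain ⟨-, -, hac, hbd⟩ := (presents_gMq k τ).rel
  cases x
  · rw [bracket_upper hac]; cases τ <;> rfl
  · rw [bracket_upper hbd]; cases τ <;> rfl
  · rw [bracket_lower hac]; cases τ <;> rfl
  · rw [bracket_lower hbd]; cases τ <;> rfl

theorem bracket_a_d :
    (deformation k τ).bracket (tM k .a) (tM k .d) = -((2 : k) • (tM k .b * tM k .c)) := by
  refine (bracket_gM_eq (s₁ := .t .b) (s₂ := .t .c) (constantCoeff_mu k) ?_).trans ?_
  · rw [Gen.deg, Gen.deg, koszul_zero_left, one_smul]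
    exact (presents_gMq k τ).rel.1.ad
  · rw [coeff_one_mu, neg_smul]; rfl

theorem bracket_θ_self :
    (deformation k τ).bracket (θM k 0) (θM k 0) = -((2 : k) • (θM k 1 * θM k 2)) := by
  have hcoeff : PowerSeries.coeff 1 (2 * (q k ^ 2 * mu k * (lam k)⁻¹)) = (-2 : k) := by
    simp only [two_mul, map_add, PowerSeries.coeff_one_mul, map_mul, map_pow, constantCoeff_mu,
      constantCoeff_q, coeff_one_mu, PowerSeries.constantCoeff_inv, constantCoeff_lam]
    ring
  refine (bracket_gM_eq (s₁ := .θ 1) (s₂ := .θ 2) (r := 2 * (q k ^ 2 * mu k * (lam k)⁻¹))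
    (by simp [constantCoeff_mu]) ?_).trans ?_
  · rw [Gen.deg, koszul_one_one, neg_smul, one_smul, sub_neg_eq_add, mul_smul, two_smul]
    exact congrArg₂ (· + ·) (presents_gMq k τ).rel.2.sq0 (presents_gMq k τ).rel.2.sq0
  · rw [hcoeff, neg_smul]; rfl

theorem bracket_θ_eq {i j : Fin 3} {r : k⟦X⟧} (hr : PowerSeries.constantCoeff r = 1)
    (h : gMq k τ (.θ j) * gMq k τ (.θ i) = -(r ^ 2 • (gMq k τ (.θ i) * gMq k τ (.θ j)))) :
    (deformation k τ).bracket (θM k i) (θM k j) =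
      (-2 * PowerSeries.coeff 1 r) • (θM k i * θM k j) := by
  have hcoeff : PowerSeries.coeff 1 (1 - r ^ 2) = -2 * PowerSeries.coeff 1 r := by
    rw [pow_two, map_sub, PowerSeries.coeff_one_mul, hr, PowerSeries.coeff_one, if_neg one_ne_zero]
    ring
  refine (bracket_gM_eq (s₁ := .θ i) (s₂ := .θ j) (r := 1 - r ^ 2) (by simp [hr]) ?_).trans ?_
  · rw [Gen.deg, Gen.deg, koszul_one_one, h, neg_smul, one_smul, neg_neg, sub_smul, one_smul]
  · rw [hcoeff]; rfl

theorem hasBracketValues : HasBracketValues τ (deformation k τ).bracket := by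
  obtain ⟨⟨⟨hab, hac, -, hbc, hcd, hbd⟩, -⟩, ⟨-, h11, h22, h21, h10, h20⟩, -, -⟩ :=
    (presents_gMq k τ).rel
  refine ⟨bracket_tM_of_q_commute hab, bracket_tM_of_q_commute hac, bracket_tM_of_q_commute hbd,
    bracket_tM_of_q_commute hcd, ?_, bracket_a_d k τ, bracket_cross k τ, bracket_θ_self k τ,
    ?_, ?_, ?_, ?_, ?_⟩
  · refine bracket_gM_eq_zero ?_
    rw [Gen.deg, Gen.deg, koszul_zero_left, one_smul]
    exact hbc.symm
  · rw [bracket_θ_eq k τ (constantCoeff_q_inv k) h10, coeff_one_q_inv, mul_one, neg_smul]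
  · rw [bracket_θ_eq k τ (constantCoeff_q k) h20, coeff_one_q, neg_mul_neg, mul_one]
  · exact bracket_gM_self_eq_zero h11
  · refine bracket_gM_eq_zero ?_
    rw [Gen.deg, Gen.deg, koszul_one_one, neg_smul, one_smul]
    exact (neg_eq_iff_eq_neg.2 h21).symm
  · exact bracket_gM_self_eq_zero h22

end InducedBracket

/-! ### The classical limit of the comultiplications -/

section Reduction

theorem map_map_comm {R S : Type*} [CommSemiring R] [CommSemiring S] {φ : R →+* S}
    {M₁ M₂ N₁ N₂ : Type*} [AddCommMonoid M₁] [Module R M₁] [AddCommMonoid M₂] [Module R M₂]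
    [AddCommMonoid N₁] [Module R N₁] [AddCommMonoid N₂] [Module R N₂]
    {M₁' M₂' N₁' N₂' : Type*} [AddCommMonoid M₁'] [Module S M₁'] [AddCommMonoid M₂'] [Module S M₂']
    [AddCommMonoid N₁'] [Module S N₁'] [AddCommMonoid N₂'] [Module S N₂']
    {f₁ : M₁ →ₗ[R] N₁} {f₂ : M₂ →ₗ[R] N₂} {f₁' : M₁' →ₗ[S] N₁'} {f₂' : M₂' →ₗ[S] N₂'}
    {α₁ : M₁ →ₛₗ[φ] M₁'} {α₂ : M₂ →ₛₗ[φ] M₂'} {β₁ : N₁ →ₛₗ[φ] N₁'} {β₂ : N₂ →ₛₗ[φ] N₂'}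
    (h₁ : ∀ x, β₁ (f₁ x) = f₁' (α₁ x)) (h₂ : ∀ x, β₂ (f₂ x) = f₂' (α₂ x)) (u : M₁ ⊗[R] M₂) :
    TensorProduct.map β₁ β₂ (TensorProduct.map f₁ f₂ u) =
      TensorProduct.map f₁' f₂' (TensorProduct.map α₁ α₂ u) := by
  induction u using TensorProduct.induction_on with
  | zero => simp only [map_zero]
  | add u v hu hv => simp only [map_add, hu, hv]
  | tmul x y => simp only [TensorProduct.map_tmul, h₁, h₂]

variable {k : Type*} [Field k] {A₁ A₂ B₁ B₂ : Type*} [Ring A₁] [Ring A₂] [Ring B₁] [Ring B₂]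
  [Algebra k⟦X⟧ A₁] [Algebra k⟦X⟧ A₂] [Algebra k B₁] [Algebra k B₂]
  {f : A₁ →ₛₗ[(PowerSeries.constantCoeff : k⟦X⟧ →+* k)] B₁}
  {f' : A₂ →ₛₗ[(PowerSeries.constantCoeff : k⟦X⟧ →+* k)] B₂}

/-- A reduction modulo `h` as a ring homomorphism. -/
@[simps]
def IsReduction.ringHom (hf : IsReduction f) : A₁ →+* B₁ where
  toFun := f
  map_one' := hf.map_one
  map_mul' := hf.map_mul
  map_zero' := map_zero f
  map_add' := map_add f

theorem IsReduction.map_tensor_mul (hf : IsReduction f) (hf' : IsReduction f')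
    (u v : A₁ ⊗[k⟦X⟧] A₂) : TensorProduct.map f f' (u * v) =
      TensorProduct.map f f' u * TensorProduct.map f f' v := by
  induction u using TensorProduct.induction_on with
  | zero => simp
  | add u u' hu hu' => rw [add_mul, map_add, hu, hu', map_add, add_mul]
  | tmul x y =>
    induction v using TensorProduct.induction_on with
    | zero => simp
    | add v v' hv hv' => rw [mul_add, map_add, hv, hv', map_add, mul_add]
    | tmul x' y' => simp [hf.map_mul, hf'.map_mul]

/-- The tensor product of two reductions modulo `h` as a ring homomorphism. -/
@[simps]
def IsReduction.tensorRingHom (hf : IsReduction f) (hf' : IsReduction f') :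
    A₁ ⊗[k⟦X⟧] A₂ →+* B₁ ⊗[k] B₂ where
  toFun := TensorProduct.map f f'
  map_one' := by
    rw [Algebra.TensorProduct.one_def, TensorProduct.map_tmul, hf.map_one, hf'.map_one,
      Algebra.TensorProduct.one_def]
  map_mul' := hf.map_tensor_mul hf'
  map_zero' := map_zero _
  map_add' := map_add _

end Reduction

theorem Presents.map_eq_map_of_isReduction {k : Type u} [Field k] {ι : Type}
    {Rel : ∀ (B : Type u) [Ring B] [Algebra k⟦X⟧ B], (ι → B) → Prop} {X : Type u} [Ring X]
    [Algebra k⟦X⟧ X] {g : ι → X} (h : Presents Rel g) {X₀ Y Y₀ : Type*} [Ring X₀] [Algebra k X₀]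
    [Ring Y] [Algebra k⟦X⟧ Y] [Ring Y₀] [Algebra k Y₀]
    {π : X →ₛₗ[(PowerSeries.constantCoeff : k⟦X⟧ →+* k)] X₀} (hπ : IsReduction π) {ψ : Y →+* Y₀}
    (hψ : ∀ (r : k⟦X⟧) y, ψ (r • y) = PowerSeries.constantCoeff r • ψ y) {F : X →ₐ[k⟦X⟧] Y}
    {F₀ : X₀ →ₐ[k] Y₀} (hg : ∀ s, ψ (F (g s)) = F₀ (π (g s))) (x : X) :
    ψ (F x) = F₀ (π x) := by
  refine DFunLike.congr_fun (f := ψ.comp F.toRingHom) (g := F₀.toRingHom.comp hπ.ringHom)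
    (h.ringHom_ext (fun r => ?_) hg) x
  change ψ (F (r • 1)) = F₀ (π (r • 1))
  rw [map_smul, hψ, map_smulₛₗ, map_smul, map_one, map_one, hπ.map_one, map_one]

section Limit

variable (k : Type u) [Field k] [CharZero k] (τ : Kind)

/-- The reduction `Aq → A`. -/
def redA : Aq k →ₛₗ[(PowerSeries.constantCoeff : k⟦X⟧ →+* k)] A k :=
  exists_isReduction_A.choose

theorem isReduction_redA : IsReduction (redA k) := exists_isReduction_A.choose_spec.1

theorem redA_tAq (x : TGen) : redA k (tAq k x) = tA k x := exists_isReduction_A.choose_spec.2 x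

/-- The reduction `Mq → M`. -/
abbrev redM : Mq k τ →ₛₗ[(PowerSeries.constantCoeff : k⟦X⟧ →+* k)] M k := (deformation k τ).π

theorem isReduction_redM : IsReduction (redM k τ) := (deformation k τ).isReduction

variable {k τ}

theorem redM_inclAq (x : Aq k) : redM k τ (inclAq k τ x) = inclA k (redA k x) :=
  (presents_tAq k).map_eq_map_of_isReduction (isReduction_redA k)
    (ψ := (isReduction_redM k τ).ringHom) (map_smulₛₗ (redM k τ)) (fun x => by
      rw [inclAq_tAq, redA_tAq, inclA_tA, IsReduction.ringHom_apply, π_gMq]) x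

theorem inclAq_mem_parityPart (x : Aq k) : inclAq k τ x ∈ parityPart k⟦X⟧ (gMq k τ) 0 := by
  have hx : x ∈ Algebra.adjoin k⟦X⟧ (Set.range (tAq k)) :=
    (presents_tAq k).adjoin_eq_top ▸ Algebra.mem_top
  induction hx using Algebra.adjoin_induction with
  | mem x hx =>
    obtain ⟨s, rfl⟩ := hx
    rw [inclAq_tAq]
    exact gen_mem_parityPart (.t s)
  | algebraMap r =>
    rw [AlgHom.commutes]
    exact algebraMap_mem_parityPart r
  | add x y _ _ hx hy => rw [map_add]; exact add_mem hx hy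
  | mul x y _ _ hx hy => rw [map_mul]; simpa using mul_mem_parityPart hx hy

theorem limit_thetaTensor (i : Fin 3) :
    TensorProduct.map (redA k) (redM k τ) (thetaTensor (qParam k) (tAq k) (gMq k τ ∘ .θ) i) =
      thetaTensor (oneParam k) (tA k) (gM k ∘ .θ) i := by
  have hlam : PowerSeries.constantCoeff (qParam k).lam = 2 := constantCoeff_lam k
  rw [thetaTensor_eq, thetaTensor_eq]
  fin_cases i <;>
  simp [hlam, redA_tAq, π_gMq, (isReduction_redA k).map_mul, constantCoeff_q, pow_two]

theorem thetaTensor_oneParam (i : Fin 3) :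
    thetaTensor (oneParam k) (tA k) (gM k ∘ .θ) i =
      ![(1 + (2 : k) • (tA k .b * tA k .c)) ⊗ₜ θM k 0 - (tA k .a * tA k .c) ⊗ₜ θM k 1 +
          (tA k .b * tA k .d) ⊗ₜ θM k 2,
        -(((2 : k) • (tA k .a * tA k .b)) ⊗ₜ θM k 0) + (tA k .a ^ 2) ⊗ₜ θM k 1 -
          (tA k .b ^ 2) ⊗ₜ θM k 2,
        ((2 : k) • (tA k .c * tA k .d)) ⊗ₜ θM k 0 - (tA k .c ^ 2) ⊗ₜ θM k 1 +
          (tA k .d ^ 2) ⊗ₜ θM k 2] i := by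
  obtain ⟨hcomm, hdet⟩ := slRels_oneParam_iff.1 (presents_tA k).rel
  have had : tA k .a * tA k .d = 1 + tA k .b * tA k .c := sub_eq_iff_eq_add.1 hdet
  rw [thetaTensor_eq]
  fin_cases i <;>
  simp [had, hcomm .b .a, hcomm .d .c, two_smul, add_assoc, θM]

variable {C : Comultiplications k (A k) (M k) (inclA k)}
  {Q : Comultiplications k⟦X⟧ (Aq k) (Mq k τ) (inclAq k τ)}

theorem IsClassical.left_eq_thetaTensor (hC : IsClassical C) (i : Fin 3) :
    C.ΔL (θM k i) = thetaTensor (oneParam k) (tA k) (gM k ∘ .θ) i := by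
  rw [thetaTensor_oneParam]
  fin_cases i
  exacts [hC.left0, hC.left1, hC.left2]

theorem IsQuantum.left_eq_thetaTensor (hQ : IsQuantum Q) (i : Fin 3) :
    Q.ΔL (θMq k τ i) = thetaTensor (qParam k) (tAq k) (gMq k τ ∘ .θ) i := by
  rw [thetaTensor_eq]
  fin_cases i
  exacts [hQ.left0, hQ.left1, hQ.left2]

theorem limit_Δ (hC : IsClassical C) (hQ : IsQuantum Q) (x : Aq k) :
    TensorProduct.map (redA k) (redA k) (Q.Δ x) = C.Δ (redA k x) := by
  refine (presents_tAq k).map_eq_map_of_isReduction (isReduction_redA k)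
    (ψ := (isReduction_redA k).tensorRingHom (isReduction_redA k))
    (fun r u => map_smulₛₗ (TensorProduct.map _ _) r u) (fun x => ?_) x
  obtain ⟨ha, hb, hc, hd, -, -, -, -⟩ := hQ.matrix
  obtain ⟨ha', hb', hc', hd', -, -, -, -⟩ := hC.matrix
  cases x <;> simp [redA_tAq, ha, hb, hc, hd, ha', hb', hc', hd']

theorem limit_ε (hC : IsClassical C) (hQ : IsQuantum Q) (x : Aq k) :
    PowerSeries.constantCoeff (Q.ε x) = C.ε (redA k x) := by
  refine (presents_tAq k).map_eq_map_of_isReduction (isReduction_redA k)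
    (ψ := (PowerSeries.constantCoeff : k⟦X⟧ →+* k)) (map_mul _) (fun x => ?_) x
  obtain ⟨-, -, -, -, ha, hb, hc, hd⟩ := hQ.matrix
  obtain ⟨-, -, -, -, ha', hb', hc', hd'⟩ := hC.matrix
  cases x <;> simp [redA_tAq, ha, hb, hc, hd, ha', hb', hc', hd']

theorem limit_ΔL (hC : IsClassical C) (hQ : IsQuantum Q) (x : Mq k τ) :
    TensorProduct.map (redA k) (redM k τ) (Q.ΔL x) = C.ΔL (redM k τ x) := by
  refine (presents_gMq k τ).map_eq_map_of_isReduction (isReduction_redM k τ)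
    (ψ := (isReduction_redA k).tensorRingHom (isReduction_redM k τ))
    (fun r u => map_smulₛₗ (TensorProduct.map _ _) r u) (fun s => ?_) x
  rw [IsReduction.tensorRingHom_apply]
  obtain x | i := s
  · rw [← inclAq_tAq, Q.ΔL_incl, redM_inclAq, C.ΔL_incl, ← limit_Δ hC hQ]
    exact map_map_comm (f₁ := .id) (f₁' := .id) (f₂ := (inclAq k τ).toLinearMap)
      (f₂' := (inclA k).toLinearMap) (fun _ => rfl) redM_inclAq (Q.Δ (tAq k x))
  · rw [π_gMq]
    exact (congrArg _ (hQ.left_eq_thetaTensor i)).trans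
      ((limit_thetaTensor i).trans (hC.left_eq_thetaTensor i).symm)

theorem limit_ΔR (hC : IsClassical C) (hQ : IsQuantum Q) (x : Mq k τ) :
    TensorProduct.map (redM k τ) (redA k) (Q.ΔR x) = C.ΔR (redM k τ x) := by
  refine (presents_gMq k τ).map_eq_map_of_isReduction (isReduction_redM k τ)
    (ψ := (isReduction_redM k τ).tensorRingHom (isReduction_redA k))
    (fun r u => map_smulₛₗ (TensorProduct.map _ _) r u) (fun s => ?_) x
  rw [IsReduction.tensorRingHom_apply]
  obtain x | i := s
  · rw [← inclAq_tAq, Q.ΔR_incl, redM_inclAq, C.ΔR_incl, ← limit_Δ hC hQ]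
    exact map_map_comm (f₁ := (inclAq k τ).toLinearMap) (f₁' := (inclA k).toLinearMap) (f₂ := .id)
      (f₂' := .id) redM_inclAq (fun _ => rfl) (Q.Δ (tAq k x))
  · rw [π_gMq]
    refine (congrArg _ (hQ.right i)).trans (Eq.trans ?_ (hC.right i).symm)
    rw [TensorProduct.map_tmul, (isReduction_redA k).map_one]
    exact congrArg (· ⊗ₜ 1) (π_gMq (.θ i))

theorem mul_comm_A (x y : A k) : x * y = y * x := by
  have hcomm := (slRels_oneParam_iff.1 (presents_tA k).rel).1
  exact (presents_tA k).commute (fun s => ((presents_tA k).commute (fun s' => hcomm s s') x).symm) y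

theorem exists_inclA_eq_bracket (f g : A k) :
    ∃ e : A k, inclA k e = (deformation k τ).bracket (inclA k f) (inclA k g) := by
  obtain ⟨f, rfl⟩ := (isReduction_redA k).surjective f
  obtain ⟨g, rfl⟩ := (isReduction_redA k).surjective g
  obtain ⟨e, he⟩ := ((isReduction_redA k).ker (f * g - g * f)).1 (by
    rw [map_sub, (isReduction_redA k).map_mul, (isReduction_redA k).map_mul, mul_comm_A, sub_self])
  refine ⟨redA k e, ?_⟩
  obtain ⟨w, hw, hπw⟩ := (deformation k τ).exists_commutator_eq
    (inclAq_mem_parityPart (τ := τ) f) (inclAq_mem_parityPart g)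
  have hwe : w = inclAq k τ e := (deformation k τ).X_smul_injective <| by
    change (PowerSeries.X : k⟦X⟧) • w = (PowerSeries.X : k⟦X⟧) • inclAq k τ e
    rw [← hw, ← map_smul, ← he, koszul_zero_left, one_smul, map_sub, map_mul, map_mul]
  rw [← redM_inclAq (τ := τ), ← redM_inclAq (τ := τ), ← redM_inclAq (τ := τ), ← hwe, hπw]

end Limit

/-! ### Covariance of the bracket -/

section Covariance

open Algebra.TensorProduct

variable {k : Type u} [Field k] [CharZero k] {τ : Kind}
  {C : Comultiplications k (A k) (M k) (inclA k)}
  {Q : Comultiplications k⟦X⟧ (Aq k) (Mq k τ) (inclAq k τ)}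

theorem σh_comp_inclAq : (deformation k τ).σh.comp (inclAq k τ) = inclAq k τ :=
  AlgHom.ext fun x => (deformation k τ).isParity_h.apply_of_mem_zero (inclAq_mem_parityPart x)

theorem σh_θMq (i : Fin 3) : (deformation k τ).σh (θMq k τ i) = -θMq k τ i := by
  refine ((deformation k τ).isParity_h.apply_of_mem (gen_mem_parityPart (.θ i))).trans ?_
  rw [Gen.deg, koszul_one_one, neg_smul, one_smul]
  rfl

theorem map_σh_inclAq_inclAq (u : Aq k ⊗[k⟦X⟧] Aq k) :
    map (deformation k τ).σh (deformation k τ).σh (map (inclAq k τ) (inclAq k τ) u) =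
      map (inclAq k τ) (inclAq k τ) u := by
  rw [← AlgHom.comp_apply, ← map_comp, σh_comp_inclAq]

variable (Q) in
/-- The left coaction of `Q`, with values in `Mq ⊗ Mq`. -/
def ΔLM : Mq k τ →ₐ[k⟦X⟧] Mq k τ ⊗[k⟦X⟧] Mq k τ :=
  (map (inclAq k τ) (.id _ _)).comp Q.ΔL

variable (Q) in
/-- The right coaction of `Q`, with values in `Mq ⊗ Mq`. -/
def ΔRM : Mq k τ →ₐ[k⟦X⟧] Mq k τ ⊗[k⟦X⟧] Mq k τ :=
  (map (.id _ _) (inclAq k τ)).comp Q.ΔR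

theorem ΔLM_inclAq (x : Aq k) : ΔLM Q (inclAq k τ x) = map (inclAq k τ) (inclAq k τ) (Q.Δ x) :=
  (congrArg (map (inclAq k τ) (.id _ _)) (Q.ΔL_incl x)).trans <|
    (LinearMap.comp_apply _ _ _).symm.trans
      (LinearMap.congr_fun (LinearMap.rTensor_comp_lTensor _ _ _) _)

theorem ΔRM_inclAq (x : Aq k) : ΔRM Q (inclAq k τ x) = map (inclAq k τ) (inclAq k τ) (Q.Δ x) :=
  (congrArg (map (.id _ _) (inclAq k τ)) (Q.ΔR_incl x)).trans <|
    (LinearMap.comp_apply _ _ _).symm.trans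
      (LinearMap.congr_fun (LinearMap.lTensor_comp_rTensor _ _ _) _)

theorem ΔLM_θMq (hQ : IsQuantum Q) (i : Fin 3) : ΔLM Q (θMq k τ i) =
    thetaTensor (qParam k) (fun x => inclAq k τ (tAq k x)) (θMq k τ) i := by
  refine (congrArg (map (inclAq k τ) (.id _ _)) (hQ.left_eq_thetaTensor i)).trans ?_
  rw [thetaTensor_eq, thetaTensor_eq]
  fin_cases i <;> simp [θMq]

theorem ΔLM_σh (hQ : IsQuantum Q) (x : Mq k τ) : ΔLM Q ((deformation k τ).σh x) =
    map (deformation k τ).σh (deformation k τ).σh (ΔLM Q x) := by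
  refine DFunLike.congr_fun (f := (ΔLM Q).comp (deformation k τ).σh)
    (g := (map (deformation k τ).σh (deformation k τ).σh).comp (ΔLM Q))
    ((presents_gMq k τ).hom_ext ?_) x
  rintro (x | i)
  · rw [AlgHom.comp_apply, AlgHom.comp_apply, ← inclAq_tAq, ← AlgHom.comp_apply _ (inclAq k τ),
      σh_comp_inclAq, ΔLM_inclAq, map_σh_inclAq_inclAq]
  · have hincl x : (deformation k τ).σh (inclAq k τ x) = inclAq k τ x :=
      AlgHom.congr_fun σh_comp_inclAq x
    change ΔLM Q ((deformation k τ).σh (θMq k τ i)) = map _ _ (ΔLM Q (θMq k τ i))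
    rw [σh_θMq, map_neg, ΔLM_θMq hQ, thetaTensor_eq]
    fin_cases i <;>
    simp [hincl, σh_θMq, TensorProduct.tmul_neg] <;> abel

theorem ΔRM_σh (hQ : IsQuantum Q) (x : Mq k τ) : ΔRM Q ((deformation k τ).σh x) =
    map (deformation k τ).σh (deformation k τ).σh (ΔRM Q x) := by
  refine DFunLike.congr_fun (f := (ΔRM Q).comp (deformation k τ).σh)
    (g := (map (deformation k τ).σh (deformation k τ).σh).comp (ΔRM Q))
    ((presents_gMq k τ).hom_ext ?_) x
  rintro (x | i)
  · rw [AlgHom.comp_apply, AlgHom.comp_apply, ← inclAq_tAq, ← AlgHom.comp_apply _ (inclAq k τ),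
      σh_comp_inclAq, ΔRM_inclAq, map_σh_inclAq_inclAq]
  · have hθ : ΔRM Q (θMq k τ i) = θMq k τ i ⊗ₜ 1 := by
      rw [ΔRM, AlgHom.comp_apply, hQ.right, map_tmul, map_one, AlgHom.id_apply]
    change ΔRM Q ((deformation k τ).σh (θMq k τ i)) = map _ _ (ΔRM Q (θMq k τ i))
    rw [σh_θMq, map_neg, hθ, map_tmul, σh_θMq, map_one, TensorProduct.neg_tmul]

theorem X_smul_injective_MqMq : Function.Injective
    fun u : Mq k τ ⊗[k⟦X⟧] Mq k τ => (PowerSeries.X : k⟦X⟧) • u :=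
  smul_right_injective _ PowerSeries.X_ne_zero

theorem bracket_covariant_left (hC : IsClassical C) (hQ : IsQuantum Q) (x y : M k) :
    (inclA k).toLinearMap.rTensor (M k) (C.ΔL ((deformation k τ).bracket x y)) =
      (deformation k τ).tensorBracket ((inclA k).toLinearMap.rTensor (M k) (C.ΔL x))
        ((inclA k).toLinearMap.rTensor (M k) (C.ΔL y)) := by
  refine (deformation k τ).bracket_covariant X_smul_injective_MqMq (ΔLM Q) (ΔLM_σh hQ)
    (fun x => (inclA k).toLinearMap.rTensor (M k) (C.ΔL x)) (fun x => ?_) (fun x y => ?_) x y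
  · rw [← limit_ΔL hC hQ]
    exact map_map_comm (f₁ := (inclAq k τ).toLinearMap) (f₁' := (inclA k).toLinearMap) (f₂ := .id)
      (f₂' := .id) redM_inclAq (fun _ => rfl) (Q.ΔL x)
  · refine (deformation k τ).tensorQuantizes_apply (map (inclAq k τ) (.id _ _)).toLinearMap
      (fun f m f' m' => ?_) (Q.ΔL x) (Q.ΔL y)
    simp only [AlgHom.toLinearMap_apply, map_tmul, AlgHom.id_apply]
    exact (deformation k τ).tensorQuantizes_of_even_left (inclAq_mem_parityPart f)
      (inclAq_mem_parityPart f') m m'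

theorem bracket_covariant_right (hC : IsClassical C) (hQ : IsQuantum Q) (x y : M k) :
    (inclA k).toLinearMap.lTensor (M k) (C.ΔR ((deformation k τ).bracket x y)) =
      (deformation k τ).tensorBracket ((inclA k).toLinearMap.lTensor (M k) (C.ΔR x))
        ((inclA k).toLinearMap.lTensor (M k) (C.ΔR y)) := by
  refine (deformation k τ).bracket_covariant X_smul_injective_MqMq (ΔRM Q) (ΔRM_σh hQ)
    (fun x => (inclA k).toLinearMap.lTensor (M k) (C.ΔR x)) (fun x => ?_) (fun x y => ?_) x y
  · rw [← limit_ΔR hC hQ]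
    exact map_map_comm (f₁ := .id) (f₁' := .id) (f₂ := (inclAq k τ).toLinearMap)
      (f₂' := (inclA k).toLinearMap) (fun _ => rfl) redM_inclAq (Q.ΔR x)
  · refine (deformation k τ).tensorQuantizes_apply (map (.id _ _) (inclAq k τ)).toLinearMap
      (fun m f m' f' => ?_) (Q.ΔR x) (Q.ΔR y)
    simp only [AlgHom.toLinearMap_apply, map_tmul, AlgHom.id_apply]
    exact (deformation k τ).tensorQuantizes_of_even_right m m' (inclAq_mem_parityPart f)
      (inclAq_mem_parityPart f')

theorem isGradedPoissonLie_bracket (hC : IsClassical C) (hQ : IsQuantum Q) :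
    IsGradedPoissonLie C (deformation k τ).bracket where
  poisson := isGradedPoisson_bracket k τ
  covariant := by
    refine ⟨(deformation k τ).tensorBracket,
      fun _ _ x _ hy _ hz w => (deformation k τ).tensorBracket_tmul_of_mem x hy hz w, fun f g => ?_,
      bracket_covariant_left hC hQ, bracket_covariant_right hC hQ⟩
    obtain ⟨e, he⟩ := exists_inclA_eq_bracket (τ := τ) f g
    have hΔ f : TensorProduct.map (inclA k).toLinearMap (inclA k).toLinearMap (C.Δ f) =
        (inclA k).toLinearMap.rTensor (M k) (C.ΔL (inclA k f)) := by
      rw [C.ΔL_incl, ← LinearMap.comp_apply, LinearMap.rTensor_comp_lTensor]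
    exact ⟨e, he, by rw [hΔ, hΔ, hΔ, he, bracket_covariant_left hC hQ]⟩

theorem isQuantization (hC : IsClassical C) (hQ : IsQuantum Q) :
    IsQuantization C (deformation k τ).bracket Q where
  free := inferInstance
  limit := ⟨redA k, redM k τ, isReduction_redA k, isReduction_redM k τ, redA_tAq k, π_gMq,
    limit_Δ hC hQ, limit_ε hC hQ, limit_ΔL hC hQ, limit_ΔR hC hQ,
    fun _ _ _ hx _ hy => (deformation k τ).exists_commutator_eq hx hy⟩

end Covariance

section Existence

variable (k : Type u) [Field k] [CharZero k] (τ : Kind)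

theorem exists_isClassical :
    ∃ C : Comultiplications k (A k) (M k) (inclA k), IsClassical C := by
  obtain ⟨C, hm, hR, hL⟩ :=
    exists_comultiplications (presents_tA k) (presents_gM k .I) (inclA_tA k)
  simp only [thetaTensor_oneParam] at hL
  exact ⟨C, hm, hR, hL 0, hL 1, hL 2⟩

theorem exists_isQuantum :
    ∃ Q : Comultiplications k⟦X⟧ (Aq k) (Mq k τ) (inclAq k τ), IsQuantum Q := by
  obtain ⟨Q, hm, hR, hL⟩ :=
    exists_comultiplications (presents_tAq k) (presents_gMq k τ) (inclAq_tAq k τ)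
  simp only [thetaTensor_eq] at hL
  exact ⟨Q, hm, hR, hL 0, hL 1, hL 2⟩

end Existence

end SLForms

end

theorem theorem3 (k : Type*) [Field k] [CharZero k] (τ : SLForms.Kind) :
    (∃ (C : SLForms.Comultiplications k (SLForms.A k) (SLForms.M k) (SLForms.inclA k))
        (br : SLForms.M k →ₗ[k] SLForms.M k →ₗ[k] SLForms.M k)
        (Q : SLForms.Comultiplications k⟦X⟧ (SLForms.Aq k) (SLForms.Mq k τ)
          (SLForms.inclAq k τ)),
      SLForms.IsClassical C ∧
      SLForms.IsGradedPoissonLie C br ∧ SLForms.HasBracketValues τ br ∧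
      (∀ br', SLForms.IsGradedPoisson br' → SLForms.HasBracketValues τ br' → br' = br) ∧
      SLForms.IsQuantum Q ∧
      SLForms.IsQuantization C br Q) ∧
    (∀ x : SLForms.MqGL k τ, Commute (SLForms.detq k (SLForms.tMqGL k τ)) x) ∧
    (∀ x : SLForms.Mq k τ, Commute (SLForms.detq k (SLForms.tMq k τ)) x) := by
  obtain ⟨C, hC⟩ := SLForms.exists_isClassical k
  obtain ⟨Q, hQ⟩ := SLForms.exists_isQuantum k τ
  have hbr := SLForms.isGradedPoissonLie_bracket hC hQ
  have hval := SLForms.hasBracketValues k τ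
  exact ⟨⟨C, (SLForms.deformation k τ).bracket, Q, hC, hbr, hval,
      fun _ h hv => hv.unique hval h hbr.poisson, hQ, SLForms.isQuantization hC hQ⟩,
    SLForms.commute_detq_tMqGL k τ,
    fun x => (SLForms.detq_tMq k τ).symm ▸ Commute.one_left x⟩
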